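/- Let $R$ be a reduced irreducible crystallographic root system in a finite-dimensional real inner product space $\mathfrak h$, with simple roots $\alpha_1,\dots,\alpha_n$, positive roots $R^+$, highest root $\varphi$, coroots $\alpha^\vee=2\alpha/\langle\alpha,\alpha\rangle$, Weyl group $W_0$ and coweight lattice $P=\{\lambda\in\mathfrak h:\langle\lambda,\alpha\rangle\in\mathbb Z\ \forall\alpha\in R\}$. Let $\widetilde W=P\rtimes W_0$ be the extended affine Weyl group, where $\mu\in P$ acts on $\mathfrak h$ as the translation $t_\mu$. Let $W\subseteq\widetilde W$ be the affine Weyl group, generated by the reflections $s_{\alpha,k}=t_{-k\alpha^\vee}s_\alpha$ $(\alpha\in R,\ k\in\mathbb Z)$, with simple reflections $s_i=s_{\alpha_i}$ $(1\le i\le n)$ and $s_0=t_{\varphi^\vee}s_\varphi$. For $w\in\widetilde W$ let $\ell(w)$ be the number of hyperplanes $\{\lambda:\langle\lambda,\alpha\rangle=-k\}$ $(\alpha\in R,\ k\in\mathbb Z)$ which separate $c_0=\{\lambda:\langle\lambda,\alpha_i\rangle>0\ (1\le i\le n),\ \langle\lambda,\varphi\rangle<1\}$ from $wc_0$. Let $q_0,\dots,q_n>1$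 be real numbers such that $q_i=q_j$ whenever $s_i,s_j$ are conjugate in $W$, and such that the system is reduced: $q_0=q_1$ if $R$ has type $A_1$, and $q_0=q_n$ if $R$ has type $C_n$ (including $C_2=B_2$); equivalently, given the other conditions, $q_0=q_i$ whenever $\alpha_i\in W_0\varphi$. Let $\mathcal H$ be the extended affine Hecke algebra: the unital $\mathbb C$-algebra with generators $T_w$ $(w\in\widetilde W)$ and relations $T_1=1$, $T_uT_v=T_{uv}$ if $\ell(uv)=\ell(u)+\ell(v)$, and $T_wT_{s_i}=T_{ws_i}+(q_i^{1/2}-q_i^{-1/2})T_w$ if $\ell(ws_i)=\ell(w)-1$. For $\mu\in P$ let $x^\mu=T_{t_\lambda}T_{t_{\lambda'}}^{-1}$, where $\mu=\lambda-\lambda'$ with $\lambda,\lambda'\in P$ dominant. For $t\in\operatorname{Hom}(P,\mathbb C^\times)$ write $t^\mu=t(\mu)$, let $(wt)^\mu=t^{w^{-1}\mu}$ for $w\in W_0$, and let $d(t)=\prod_{\alpha\in R^+}(1-t^{-\alpha^\vee})$. Call $t$ regular if $t^{\alpha^\vee}\ne1$ for all $\alpha\in R$. **Theorem.** 1. There is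 a linear functional $\mathrm{Tr}:\mathcal H\to\mathbb C$ with $\mathrm{Tr}(T_w)=\delta_{w,1}$ for all $w\in\widetilde W$. 2. For each $t\in\operatorname{Hom}(P,\mathbb C^\times)$ the principal series representation $V(t)=\mathcal H\otimes_{\mathbb C[P]}\mathbb Cv_t$ is finite dimensional, where $\mathbb C[P]$ is the span of the $x^\mu$ and $x^\mu v_t=t^\mu v_t$. Let $\chi_t$ be its character. 3. Let $F_t(h)=\sum_{\mu\in P}t^{-\mu}\,\mathrm{Tr}(x^\mu h)$. There is a family of functions $f_t:\mathcal H\to\mathbb C$ with the following two properties. (a) For some $r>0$ and all $t$ with $|t^{\alpha_i^\vee}|<r$ $(1\le i\le n)$, the series $F_t(h)$ converges absolutely for all $h\in\mathcal H$, $F_t(1)\neq0$, and $F_t(h)=f_t(h)F_t(1)$. (b) For each $h\in\mathcal H$ there is a finite linear combination $p_h(t)$ of the functions $t^\lambda$ $(\lambda\in P)$ such that $d(t)f_t(h)=p_h(t)$ for all regular $t$. 4. For every family $(f_t)$ as in 3 (the two properties determine $f_t$ for regular $t$), every regular $t$ and every $h\in\mathcal H$, $$\sum_{w\in W_0}f_{wt}(h)=\chi_t(h).$$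 -/

import Mathlib

noncomputable section

namespace AffineHecke

variable {ι M N : Type*} [AddCommGroup M] [Module ℝ M] [AddCommGroup N] [Module ℝ N]

section Lattice

variable (Φ : RootPairing ι ℝ M N)

/-- The (finite) Weyl group `W₀`: the subgroup of `GL(N)` generated by the reflections
`s_α(x) = x - ⟨x, α⟩ α^∨`. The space `N` carrying the coroots plays the role of `𝔥`, on which the
roots are linear functionals. -/
def weylGroup : Subgroup (N ≃ₗ[ℝ] N) := Subgroup.closure (Set.range Φ.coreflection)

/-- The reflection `s_α` as an element of `W₀`. -/
def weylReflection (i : ι) : weylGroup Φ :=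
  ⟨Φ.coreflection i, Subgroup.subset_closure ⟨i, rfl⟩⟩

/-- The coweight lattice `P`: the vectors on which every root takes an integral value. -/
def coweightLattice : AddSubgroup N where
  carrier := {x | ∀ i, ∃ k : ℤ, Φ.root' i x = k}
  zero_mem' i := ⟨0, by simp⟩
  add_mem' {x y} hx hy i := by
    obtain ⟨a, ha⟩ := hx i
    obtain ⟨c, hc⟩ := hy i
    exact ⟨a + c, by rw [map_add, ha, hc]; push_cast; rfl⟩
  neg_mem' {x} hx i := by
    obtain ⟨a, ha⟩ := hx i
    exact ⟨-a, by rw [map_neg, ha]; push_cast; rfl⟩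

/-- The Weyl group permutes the coroots. -/
theorem exists_coroot_eq (w : weylGroup Φ) (i : ι) :
    ∃ j, Φ.coroot j = (w : N ≃ₗ[ℝ] N) (Φ.coroot i) := by
  obtain ⟨w, hw⟩ := w
  induction hw using Subgroup.closure_induction'' generalizing i with
  | one => exact ⟨i, rfl⟩
  | mem x hx =>
    obtain ⟨k, rfl⟩ := hx
    exact ⟨Φ.reflectionPerm k i, by simp⟩
  | inv_mem x hx =>
    obtain ⟨k, rfl⟩ := hx
    exact ⟨Φ.reflectionPerm k i, by simp⟩
  | mul x y _ _ hx hy =>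
    obtain ⟨j, hj⟩ := hy i
    obtain ⟨k, hk⟩ := hx j
    exact ⟨k, by rw [hk, hj]; rfl⟩

instance finite_weylGroup [Finite ι] [Φ.IsRootSystem] : Finite (weylGroup Φ) := by
  choose f hf using exists_coroot_eq Φ
  refine Finite.of_injective f fun v w h => Subtype.ext (LinearEquiv.toLinearMap_injective ?_)
  refine LinearMap.ext_on_range (v := Φ.coroot)
    RootPairing.IsRootSystem.span_coroot_eq_top fun i => ?_
  have h1 := hf v i
  rw [h, hf w i] at h1
  exact h1.symm

variable [Φ.IsCrystallographic]

theorem coroot_mem (i : ι) : Φ.coroot i ∈ coweightLattice Φ := fun j => by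
  obtain ⟨k, hk⟩ := Φ.exists_value (S := ℤ) j i
  exact ⟨k, by simpa using hk.symm⟩

/-- The coroot `α^∨` as an element of `P`. -/
def corootP (i : ι) : coweightLattice Φ := ⟨Φ.coroot i, coroot_mem Φ i⟩

theorem weyl_mem (w : weylGroup Φ) {x : N} (hx : x ∈ coweightLattice Φ) :
    (w : N ≃ₗ[ℝ] N) x ∈ coweightLattice Φ := by
  have key : ∀ i : ι, ∀ y ∈ coweightLattice Φ, Φ.coreflection i y ∈ coweightLattice Φ := by
    intro i y hy
    obtain ⟨k, hk⟩ := hy i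
    rw [Φ.coreflection_apply, hk, Int.cast_smul_eq_zsmul]
    exact sub_mem hy (zsmul_mem (coroot_mem Φ i) k)
  obtain ⟨w, hw⟩ := w
  induction hw using Subgroup.closure_induction'' generalizing x with
  | one => exact hx
  | mem g hg => obtain ⟨i, rfl⟩ := hg; exact key i x hx
  | inv_mem g hg => obtain ⟨i, rfl⟩ := hg; exact key i x hx
  | mul a c _ _ ha hc => exact ha (hc hx)

/-- The action of `w ∈ W₀` on `P`. -/
def weylAct (w : weylGroup Φ) : coweightLattice Φ ≃+ coweightLattice Φ where
  toFun x := ⟨(w : N ≃ₗ[ℝ] N) x, weyl_mem Φ w x.2⟩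
  invFun x := ⟨((w⁻¹ : weylGroup Φ) : N ≃ₗ[ℝ] N) x, weyl_mem Φ w⁻¹ x.2⟩
  left_inv x := Subtype.ext (LinearEquiv.symm_apply_apply (w : N ≃ₗ[ℝ] N) (x : N))
  right_inv x := Subtype.ext (LinearEquiv.apply_symm_apply (w : N ≃ₗ[ℝ] N) (x : N))
  map_add' x y := Subtype.ext (map_add (w : N ≃ₗ[ℝ] N) (x : N) (y : N))

/-- The action of `W₀` on `P`, with `P` written multiplicatively. -/
def weylActHom : weylGroup Φ →* MulAut (Multiplicative (coweightLattice Φ)) where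
  toFun w := AddEquiv.toMultiplicative (weylAct Φ w)
  map_one' := rfl
  map_mul' _ _ := rfl

/-- The extended affine Weyl group `W̃ = P ⋊ W₀`. -/
abbrev ExtAffineWeyl : Type _ :=
  Multiplicative (coweightLattice Φ) ⋊[weylActHom Φ] weylGroup Φ

/-- The element `t_μ w` of `W̃`. -/
def mkAff (μ : coweightLattice Φ) (w : weylGroup Φ) : ExtAffineWeyl Φ :=
  ⟨Multiplicative.ofAdd μ, w⟩

/-- The translation `t_μ`. -/
def translation (μ : coweightLattice Φ) : ExtAffineWeyl Φ := mkAff Φ μ 1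

/-- The action of `t_μ w` on the ambient space: `x ↦ μ + w x`. -/
def affAct (g : ExtAffineWeyl Φ) (x : N) : N :=
  (Multiplicative.toAdd g.left : coweightLattice Φ) + (g.right : N ≃ₗ[ℝ] N) x

/-- The affine reflection `s_{α + kδ} = t_{-kα^∨} s_α`, that is
`x ↦ x - (⟨x, α⟩ + k) α^∨`. -/
def affineReflection (i : ι) (k : ℤ) : ExtAffineWeyl Φ :=
  mkAff Φ (-(k • corootP Φ i)) (weylReflection Φ i)

/-- The affine Weyl group `W`, as a subgroup of `W̃`: it is generated by the affine reflections. -/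
def affineWeylGroup : Subgroup (ExtAffineWeyl Φ) :=
  Subgroup.closure {g | ∃ i k, g = affineReflection Φ i k}

end Lattice

section Base

variable [Finite ι] [Nonempty ι] {Φ : RootPairing ι ℝ M N} (b : Φ.Base)

/-- (The index of) the highest root `φ`: the root of maximal height with respect to the base.
For an irreducible root system it is unique. -/
def highestRoot : ι := (Finite.exists_max b.height).choose

/-- The fundamental chamber `c₀`: all simple roots are positive on it, and so is the
affine root `α₀ = -φ + δ`. -/
def fundamentalChamber : Set N :=
  {x | (∀ i ∈ b.support, 0 < Φ.root' i x) ∧ 0 < -Φ.root' (highestRoot b) x + 1}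

/-- The hyperplane `H_{α + kδ} = {x | ⟨x, α⟩ + k = 0}` separates the sets `A` and `B`. -/
def Separates (Φ : RootPairing ι ℝ M N) (i : ι) (k : ℤ) (A B : Set N) : Prop :=
  ((∀ x ∈ A, 0 < Φ.root' i x + k) ∧ ∀ x ∈ B, Φ.root' i x + k < 0) ∨
  ((∀ x ∈ A, Φ.root' i x + k < 0) ∧ ∀ x ∈ B, 0 < Φ.root' i x + k)

variable [Φ.IsCrystallographic]

/-- The length of `g ∈ W̃`: the number of affine hyperplanes which separate `c₀` from `g c₀`.
Every affine hyperplane is `H_{α + kδ}` for exactly one pair of a positive root `α` and an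
integer `k`. -/
def length (g : ExtAffineWeyl Φ) : ℕ :=
  Set.ncard {p : ι × ℤ | b.IsPos p.1 ∧
    Separates Φ p.1 p.2 (fundamentalChamber b) (affAct Φ g '' fundamentalChamber b)}

/-- The simple reflections `s₀, s₁, …, sₙ`: `some i` stands for the simple root `αᵢ`, and `none`
for `α₀ = -φ + δ`, whose reflection is `s_{-φ+δ} = s_{φ-δ}`. -/
def simpleReflection : Option b.support → ExtAffineWeyl Φ
  | none => affineReflection Φ (highestRoot b) (-1)
  | some i => affineReflection Φ i 0

/-- Reduced parameter systems `q₀, q₁, …, qₙ`.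

The field `reduced` says that `q₀ = qᵢ` whenever `αᵢ` (equivalently, `αᵢ^∨`) is in the
`W₀`-orbit of the highest root (coroot of the highest root). In type `A₁` this is `q₀ = q₁`, and
in type `Cₙ` it is `q₀ = qₙ`; in all the other irreducible types it already follows from
`conj`, since `s₀` is then conjugate in `W` to the simple reflections in long simple roots. -/
structure IsReducedParameterSystem (q : Option b.support → ℝ) : Prop where
  one_lt : ∀ i, 1 < q i
  conj : ∀ i j, (∃ g ∈ affineWeylGroup Φ,
    g * simpleReflection b i * g⁻¹ = simpleReflection b j) → q i = q j
  reduced : ∀ i : b.support, (∃ w : weylGroup Φ,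
    (w : N ≃ₗ[ℝ] N) (Φ.coroot (highestRoot b)) = Φ.coroot i) → q none = q (some i)

variable (q : Option b.support → ℝ)

/-- The defining relations of the extended affine Hecke algebra on the generators `T_w`, `w ∈ W̃`.
The relation `T_1 = 1` says that the algebra is unital with unit `T_1`. -/
inductive HeckeRel :
    FreeAlgebra ℂ (ExtAffineWeyl Φ) → FreeAlgebra ℂ (ExtAffineWeyl Φ) → Prop
  | one : HeckeRel (FreeAlgebra.ι ℂ 1) 1
  | mul (u v : ExtAffineWeyl Φ) (h : length b (u * v) = length b u + length b v) :
      HeckeRel (FreeAlgebra.ι ℂ u * FreeAlgebra.ι ℂ v) (FreeAlgebra.ι ℂ (u * v))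
  | quadratic (w : ExtAffineWeyl Φ) (i : Option b.support)
      (h : length b (w * simpleReflection b i) + 1 = length b w) :
      HeckeRel (FreeAlgebra.ι ℂ w * FreeAlgebra.ι ℂ (simpleReflection b i))
        (FreeAlgebra.ι ℂ (w * simpleReflection b i) +
          ((√(q i) - (√(q i))⁻¹ : ℝ) : ℂ) • FreeAlgebra.ι ℂ w)

/-- The extended affine Hecke algebra `ℋ` with parameters `q`. -/
abbrev Hecke : Type _ := RingQuot (HeckeRel b q)

/-- The generator `T_w` of `ℋ`. -/
def T (w : ExtAffineWeyl Φ) : Hecke b q :=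
  RingQuot.mkAlgHom ℂ (HeckeRel b q) (FreeAlgebra.ι ℂ w)

/-- Dominant coweights, `μ ∈ P⁺`. -/
def IsDominant (μ : coweightLattice Φ) : Prop := ∀ i ∈ b.support, 0 ≤ Φ.root' i (μ : N)

end Base

section Bernstein

variable {Φ : RootPairing ι ℝ M N} (b : Φ.Base)

/-- Every coweight is a difference of two dominant coweights. -/
theorem exists_dominant_sub [Φ.IsRootSystem] (μ : coweightLattice Φ) :
    ∃ p : coweightLattice Φ × coweightLattice Φ,
      IsDominant b p.1 ∧ IsDominant b p.2 ∧ μ = p.1 - p.2 := by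
  let f : Module.Dual ℝ M :=
    b.toWeightBasis.constr ℝ fun i : b.support => max (Φ.root' i (μ : N)) 0
  obtain ⟨n, hn⟩ := Φ.toLinearMap.flip.toPerfPair.surjective f
  have hn' (i : ι) : Φ.root' i n = f (Φ.root i) := by rw [← hn]; rfl
  have hs (i : ι) (hi : i ∈ b.support) : Φ.root' i n = max (Φ.root' i (μ : N)) 0 := by
    have := b.toWeightBasis.constr_basis ℝ
      (fun i : b.support => max (Φ.root' i (μ : N)) 0) ⟨i, hi⟩
    rw [b.toWeightBasis_apply] at this
    rw [hn']
    exact this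
  have hnP : n ∈ coweightLattice Φ := by
    intro i
    have hi := b.root_mem_span_int i
    rw [RootPairing.root']
    generalize Φ.root i = y at hi
    induction hi using Submodule.span_induction with
    | mem x hx =>
      obtain ⟨j, hj, rfl⟩ := hx
      obtain ⟨k, hk⟩ := μ.2 j
      refine ⟨max k 0, ?_⟩
      have := hs j hj
      rw [hk] at this
      exact this.trans (by push_cast; rfl)
    | zero => exact ⟨0, by simp⟩
    | add x y _ _ hx hy =>
      obtain ⟨a, ha⟩ := hx
      obtain ⟨c, hc⟩ := hy
      exact ⟨a + c, by rw [map_add, LinearMap.add_apply, ha, hc]; push_cast; rfl⟩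
    | smul a x _ hx =>
      obtain ⟨c, hc⟩ := hx
      exact ⟨a * c, by rw [map_zsmul, LinearMap.smul_apply, hc]; simp⟩
  refine ⟨(⟨n, hnP⟩, ⟨n, hnP⟩ - μ), fun i hi => ?_, fun i hi => ?_, (sub_sub_cancel _ _).symm⟩
  · change 0 ≤ Φ.root' i n
    rw [hs i hi]
    exact le_max_right _ _
  · change 0 ≤ Φ.root' i (n - (μ : N))
    rw [map_sub, hs i hi]
    exact sub_nonneg.2 (le_max_left _ _)

variable [Finite ι] [Nonempty ι] [Φ.IsCrystallographic] [Φ.IsRootSystem]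
  (q : Option b.support → ℝ)

/-- The Bernstein elements: `x^μ = T_{t_λ} (T_{t_λ'})⁻¹` where `μ = λ - λ'` with `λ, λ' ∈ P⁺`
(all the `T_w` are invertible in `ℋ`, and the element does not depend on the decomposition). -/
def x (μ : coweightLattice Φ) : Hecke b q :=
  T b q (translation Φ (exists_dominant_sub b μ).choose.1) *
    Ring.inverse (T b q (translation Φ (exists_dominant_sub b μ).choose.2))

open Classical in
/-- The canonical trace functional: the linear functional on `ℋ` with `Tr(T_w) = δ_{w,1}`. -/
def Tr : Hecke b q →ₗ[ℂ] ℂ :=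
  if h : ∃ τ : Hecke b q →ₗ[ℂ] ℂ, ∀ w, τ (T b q w) = if w = 1 then 1 else 0 then h.choose else 0

end Bernstein

section Torus

variable (Φ : RootPairing ι ℝ M N)

/-- The torus `Hom(P, ℂ^×)`. -/
abbrev Torus : Type _ := Multiplicative (coweightLattice Φ) →* ℂˣ

variable {Φ}

/-- `t^μ = t(μ)`, as a complex number. -/
def Torus.pow (t : Torus Φ) (μ : coweightLattice Φ) : ℂ := (t (Multiplicative.ofAdd μ) : ℂ)

/-- The value at `t` of the Laurent polynomial `∑ a_μ x^μ`. -/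
def Torus.eval (t : Torus Φ) (p : coweightLattice Φ →₀ ℂ) : ℂ := p.sum fun μ a => a * t.pow μ

variable [Φ.IsCrystallographic]

/-- The action of `W₀` on the torus: `(wt)^μ = t^{w⁻¹ μ}`. -/
def Torus.weyl (w : weylGroup Φ) (t : Torus Φ) : Torus Φ :=
  t.comp (weylActHom Φ w⁻¹).toMonoidHom

/-- `t^{α^∨} ≠ 1` for all roots `α`. -/
def Torus.IsRegular (t : Torus Φ) : Prop := ∀ i, t.pow (corootP Φ i) ≠ 1

/-- `d(t) = ∏_{α ∈ R⁺} (1 - t^{-α^∨})`. -/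
def d (b : Φ.Base) (t : Torus Φ) : ℂ := ∏ᶠ i ∈ {i | b.IsPos i}, (1 - t.pow (-corootP Φ i))

variable [Finite ι] [Nonempty ι] [Φ.IsRootSystem] (b : Φ.Base) (q : Option b.support → ℝ)

/-- `F_t(h) = ∑_{μ ∈ P} t^{-μ} Tr(x^μ h)`. -/
def F (t : Torus Φ) (h : Hecke b q) : ℂ := ∑' μ, t.pow (-μ) * Tr b q (x b q μ * h)

/-- `f` is the family of densities `f_t`: one has `F_t = f_t · F_t(1)` on a region
`|t^{αᵢ^∨}| < r`, in which the series `F_t` converge and `F_t(1) ≠ 0`, and `t ↦ f_t(h)` is continued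
from this region to all `t` with `t^{α^∨} ≠ 1` for all roots `α` as the quotient of a Laurent
polynomial by `d(t)`. (This determines `f_t` for all these `t`.) -/
structure IsDensity (f : Torus Φ → Hecke b q → ℂ) : Prop where
  eq_on_region : ∃ r > 0, ∀ t : Torus Φ, (∀ i ∈ b.support, ‖t.pow (corootP Φ i)‖ < r) →
    F b q t 1 ≠ 0 ∧ ∀ h, (Summable fun μ => t.pow (-μ) * Tr b q (x b q μ * h)) ∧
      F b q t h = f t h * F b q t 1
  continuation : ∀ h, ∃ p : coweightLattice Φ →₀ ℂ, ∀ t : Torus Φ, t.IsRegular →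
    d b t * f t h = t.eval p

/-- The left ideal of `ℋ` generated by the elements `x^μ - t^μ`, `μ ∈ P`. -/
def principalIdeal (t : Torus Φ) : Submodule (Hecke b q) (Hecke b q) :=
  Submodule.span (Hecke b q)
    (Set.range fun μ => x b q μ - algebraMap ℂ (Hecke b q) (t.pow μ))

/-- The principal series module `V(t) = ℋ ⊗_{ℂ[P]} ℂ v_t`, where `x^μ v_t = t^μ v_t`. As
`ℂ v_t = ℂ[P] / (x^μ - t^μ : μ ∈ P)`, this is the quotient of `ℋ` by the left ideal generated by
the elements `x^μ - t^μ`; the class of `h` is `h ⊗ v_t`. -/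
abbrev PrincipalSeries (t : Torus Φ) : Type _ := Hecke b q ⧸ principalIdeal b q t

/-- The representation `π_t` of `ℋ` on `V(t)`, by left multiplication. -/
def principalRep (t : Torus Φ) : Hecke b q →ₐ[ℂ] Module.End ℂ (PrincipalSeries b q t) :=
  Algebra.lsmul ℂ ℂ (PrincipalSeries b q t)

/-- The character `χ_t` of `(π_t, V(t))`. -/
def χ (t : Torus Φ) (h : Hecke b q) : ℂ :=
  LinearMap.trace ℂ (PrincipalSeries b q t) (principalRep b q t h)

end Torus

end AffineHecke

end

/-! Consider linear functionals φ on ℋ with φ(x^μ h) = t^μ φ(h) = φ(h x^μ) (`IsLeftWeight`,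
`IsRightWeight`). Where F_t converges it is one of these: on the left, reindex the sum over P; on
the right, use in addition that `Tr` is a trace (`Tr_mul_comm`). A functional of right weight t
factors through V(t). For regular t the intertwiners T_i - κ_i/(1 - s^{-α_i^∨}) produce a basis u_w
of V(t) in which u_w has weight wt and u_1 is the generator (`exists_weightBasis`). If moreover wt ≠
t for w ≠ 1, a functional of left weight t must kill every u_w with w ≠ 1, so it is determined by
its value at 1 (`IsLeftWeight.ext`). Hence F_t = F_t(1) f_t, where f_t is the functional of both
weights t normalised by f_t(1) = 1. The coefficient of u_w in h u_w is also such a functional, of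
weight wt and with value 1 at h = 1, so it equals f_{wt}(h); summing over w gives the trace
(`χ_eq_sum_of_generic`).

All of this is rational in t. Write h = ∑ T_w X(c_w). For w of maximal length, c_w evaluated at t
has right weight t and left weight wt. Precomposing with left multiplication by a product of
intertwiners moves the left weight to t, and each intertwiner costs one factor of d(t)
(`exists_intertwining_element`, `exists_biweight`). The character is a Laurent polynomial in t
(`exists_ev_eq_χ`), and the region |t^{α_i^∨}| < r is Zariski dense (`laurent_ext`). So uniqueness
of f_t and the character formula pass from this region to all regular t.

Convergence rests on two facts. For h in the span of the T_w with w ∈ W₀, Tr(x^μ h) vanishes unless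
-μ is a nonnegative integral combination of simple coroots (`Tr_x_mul_eq_zero`). It grows at most
exponentially in the coefficients, since left multiplication by x^{-α_i^∨} is bounded for the
ℓ¹-norm of the T-coefficients. For such h, F_t(h) is thus a power series in the t^{α_i^∨}, with
constant term 1 when h = 1 (`exists_region`).

The algebra underneath is the linear independence of the T_w, obtained from commuting left and right
operators on the regular representation (`commute_leftOp_rightOp`, where the equalities between the
q_i enter), and the basis T_w x^μ, obtained from the Bernstein relation (`Ts_mul_x_nat`,
`span_bernsteinFamily`). -/

noncomputable section

set_option linter.unusedSectionVars false

namespace AffineHecke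

variable {ι M N : Type*} [AddCommGroup M] [Module ℝ M] [AddCommGroup N] [Module ℝ N]

/-! ### Integral pairing, and the action of W₀ on roots and coweights. -/

section Pairing

variable (Φ : RootPairing ι ℝ M N)

/-- The integral pairing of a root with a coweight. -/
def pair (i : ι) : coweightLattice Φ →+ ℤ where
  toFun μ := ⌊Φ.root' i (μ : N)⌋
  map_zero' := by simp
  map_add' μ ν := by
    obtain ⟨a, ha⟩ := μ.2 i
    rw [AddSubgroup.coe_add, map_add, ha, Int.floor_intCast_add, Int.floor_intCast]

theorem pair_spec (i : ι) (μ : coweightLattice Φ) : (pair Φ i μ : ℝ) = Φ.root' i (μ : N) := by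
  obtain ⟨a, ha⟩ := μ.2 i
  change ((⌊Φ.root' i (μ : N)⌋ : ℤ) : ℝ) = _
  rw [ha, Int.floor_intCast]

theorem pair_eq_iff {i : ι} {μ : coweightLattice Φ} {k : ℤ} :
    pair Φ i μ = k ↔ Φ.root' i (μ : N) = k := by
  rw [← pair_spec]; norm_cast

/-- The index of the negative of a root. -/
def negIdx (i : ι) : ι := Φ.reflectionPerm i i

@[simp] theorem root'_negIdx (i : ι) : Φ.root' (negIdx Φ i) = -Φ.root' i := by
  simp [negIdx, RootPairing.root', Φ.root_reflectionPerm]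

@[simp] theorem root_negIdx (i : ι) : Φ.root (negIdx Φ i) = -Φ.root i := by
  simp [negIdx, Φ.root_reflectionPerm]

@[simp] theorem coroot_negIdx (i : ι) : Φ.coroot (negIdx Φ i) = -Φ.coroot i := by
  simp [negIdx, Φ.coroot_reflectionPerm]

@[simp] theorem negIdx_negIdx (i : ι) : negIdx Φ (negIdx Φ i) = i :=
  Φ.root.injective (by simp)

@[simp] theorem pair_negIdx (i : ι) (μ : coweightLattice Φ) :
    pair Φ (negIdx Φ i) μ = -pair Φ i μ := by
  rw [pair_eq_iff]; push_cast; rw [pair_spec]; simp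

theorem root'_reflectionPerm_coreflection (k i : ι) (x : N) :
    Φ.root' (Φ.reflectionPerm k i) (Φ.coreflection k x) = Φ.root' i x := by
  have h1 : Φ.root' (Φ.reflectionPerm k i) = Φ.root' i - Φ.pairing i k • Φ.root' k := by
    rw [RootPairing.root', Φ.root_reflectionPerm, Φ.reflection_apply_root, map_sub, map_smul]
  have h2 := Φ.root'_coroot_eq_pairing i k
  have h3 := Φ.root'_coroot_eq_pairing k k
  rw [Φ.pairing_same] at h3
  rw [h1, Φ.coreflection_apply, map_sub, map_smul, LinearMap.sub_apply, LinearMap.sub_apply,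
    LinearMap.smul_apply, LinearMap.smul_apply, h2, h3]
  simp only [smul_eq_mul]
  ring

/-- A single index has to serve both clauses: the first pins it down, because coroots are
injectively indexed, and the second makes the pairing with coweights W₀-invariant. -/
theorem exists_idx (w : weylGroup Φ) (i : ι) :
    ∃ j, Φ.coroot j = (w : N ≃ₗ[ℝ] N) (Φ.coroot i) ∧
      ∀ x, Φ.root' j ((w : N ≃ₗ[ℝ] N) x) = Φ.root' i x := by
  obtain ⟨w, hw⟩ := w
  induction hw using Subgroup.closure_induction'' generalizing i with
  | one => exact ⟨i, rfl, fun x => rfl⟩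
  | mem x hx =>
    obtain ⟨k, rfl⟩ := hx
    exact ⟨Φ.reflectionPerm k i, by simp, root'_reflectionPerm_coreflection Φ k i⟩
  | inv_mem x hx =>
    obtain ⟨k, rfl⟩ := hx
    exact ⟨Φ.reflectionPerm k i, by simp, root'_reflectionPerm_coreflection Φ k i⟩
  | mul x y _ _ hx hy =>
    obtain ⟨j, hj, hj'⟩ := hy i
    obtain ⟨k, hk, hk'⟩ := hx j
    exact ⟨k, by rw [hk, hj]; rfl, fun z => by rw [← hj', ← hk']; rfl⟩

/-- The action of the Weyl group on the indices of the roots. -/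
instance : MulAction (weylGroup Φ) ι where
  smul w i := (exists_idx Φ w i).choose
  one_smul i := Φ.coroot.injective (exists_idx Φ 1 i).choose_spec.1
  mul_smul w v i := Φ.coroot.injective (by
    refine (exists_idx Φ (w * v) i).choose_spec.1.trans ?_
    refine Eq.trans ?_ (exists_idx Φ w (exists_idx Φ v i).choose).choose_spec.1.symm
    rw [(exists_idx Φ v i).choose_spec.1]; rfl)

theorem coroot_smul (w : weylGroup Φ) (i : ι) :
    Φ.coroot (w • i) = (w : N ≃ₗ[ℝ] N) (Φ.coroot i) :=
  (exists_idx Φ w i).choose_spec.1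

theorem root'_smul (w : weylGroup Φ) (i : ι) (x : N) :
    Φ.root' (w • i) ((w : N ≃ₗ[ℝ] N) x) = Φ.root' i x :=
  (exists_idx Φ w i).choose_spec.2 x

@[simp] theorem smul_negIdx (w : weylGroup Φ) (i : ι) :
    w • negIdx Φ i = negIdx Φ (w • i) :=
  Φ.coroot.injective (by simp [coroot_smul])

@[simp] theorem weylReflection_smul (i j : ι) :
    weylReflection Φ i • j = Φ.reflectionPerm i j :=
  Φ.coroot.injective (by rw [coroot_smul]; simp [weylReflection])

theorem weylReflection_mul_self (i : ι) : weylReflection Φ i * weylReflection Φ i = 1 :=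
  Subtype.ext (by
    change Φ.coreflection i * Φ.coreflection i = 1
    rw [← pow_two, Φ.coreflection_sq])

theorem coreflection_smul (w : weylGroup Φ) (i : ι) :
    weylReflection Φ (w • i) = w * weylReflection Φ i * w⁻¹ := by
  refine Subtype.ext (LinearEquiv.ext fun x => ?_)
  obtain ⟨y, rfl⟩ := (w : N ≃ₗ[ℝ] N).surjective x
  have : ((w * weylReflection Φ i * w⁻¹ : weylGroup Φ) : N ≃ₗ[ℝ] N) ((w : N ≃ₗ[ℝ] N) y) =
      (w : N ≃ₗ[ℝ] N) (Φ.coreflection i y) := by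
    change (w : N ≃ₗ[ℝ] N) (Φ.coreflection i ((w : N ≃ₗ[ℝ] N).symm ((w : N ≃ₗ[ℝ] N) y))) = _
    rw [LinearEquiv.symm_apply_apply]
  rw [this]
  change Φ.coreflection (w • i) _ = _
  rw [Φ.coreflection_apply, Φ.coreflection_apply, root'_smul, coroot_smul, map_sub, map_smul]

variable [Φ.IsCrystallographic]

@[simp] theorem coe_weylAct (w : weylGroup Φ) (μ : coweightLattice Φ) :
    ((weylAct Φ w μ : coweightLattice Φ) : N) = (w : N ≃ₗ[ℝ] N) (μ : N) := rfl

@[simp] theorem pair_smul (w : weylGroup Φ) (i : ι) (μ : coweightLattice Φ) :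
    pair Φ (w • i) (weylAct Φ w μ) = pair Φ i μ := by
  rw [pair_eq_iff, pair_spec, coe_weylAct, root'_smul]

@[simp] theorem weylAct_one (μ : coweightLattice Φ) : weylAct Φ 1 μ = μ := rfl

theorem weylAct_mul (w v : weylGroup Φ) (μ : coweightLattice Φ) :
    weylAct Φ (w * v) μ = weylAct Φ w (weylAct Φ v μ) := rfl

@[simp] theorem weylAct_inv_weylAct (w : weylGroup Φ) (μ : coweightLattice Φ) :
    weylAct Φ w⁻¹ (weylAct Φ w μ) = μ := by
  rw [← weylAct_mul, inv_mul_cancel, weylAct_one]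

@[simp] theorem weylAct_corootP (w : weylGroup Φ) (i : ι) :
    weylAct Φ w (corootP Φ i) = corootP Φ (w • i) :=
  Subtype.ext (by simp [corootP, coroot_smul])

@[simp] theorem corootP_negIdx (i : ι) : corootP Φ (negIdx Φ i) = -corootP Φ i :=
  Subtype.ext (by simp [corootP])

theorem weylAct_weylReflection (i : ι) (μ : coweightLattice Φ) :
    weylAct Φ (weylReflection Φ i) μ = μ - pair Φ i μ • corootP Φ i := by
  refine Subtype.ext ?_
  rw [coe_weylAct, AddSubgroup.coe_sub, AddSubgroup.coe_zsmul]
  change Φ.coreflection i _ = _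
  rw [Φ.coreflection_apply, ← pair_spec, Int.cast_smul_eq_zsmul]; rfl

theorem pair_corootP (i j : ι) : pair Φ i (corootP Φ j) = Φ.pairingIn ℤ i j := by
  rw [pair_eq_iff]
  change Φ.root' i (Φ.coroot j) = _
  rw [Φ.root'_coroot_eq_pairing]
  exact (Φ.algebraMap_pairingIn ℤ i j).symm

@[simp] theorem pair_corootP_same (i : ι) : pair Φ i (corootP Φ i) = 2 := by
  rw [pair_corootP]; simp

end Pairing

/-! ### Fundamental coweights, coefficients of roots, positivity. -/

section Positivity

variable [Finite ι] {Φ : RootPairing ι ℝ M N} (b : Φ.Base)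

theorem isPos_negIdx (i : ι) : b.IsPos (negIdx Φ i) ↔ ¬ b.IsPos i :=
  RootPairing.Base.IsPos.neg_iff_not b i

variable [Φ.IsCrystallographic] [Φ.IsRootSystem]

/-- The witness is the dual basis vector of the simple roots, carried to `N` by the perfect pairing.
It lies in P because every root is an integral combination of simple roots. -/
theorem exists_fundCoweight (i : b.support) :
    ∃ μ : coweightLattice Φ, pair Φ i μ = 1 ∧ ∀ j : b.support, j ≠ i → pair Φ j μ = 0 := by
  classical
  obtain ⟨n, hn⟩ := Φ.toLinearMap.flip.toPerfPair.surjective (b.toWeightBasis.coord i)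
  have hn' (j : ι) : Φ.root' j n = b.toWeightBasis.coord i (Φ.root j) := by rw [← hn]; rfl
  have hs (j : b.support) : Φ.root' j n = if j = i then 1 else 0 := by
    rw [hn', ← b.toWeightBasis_apply, Module.Basis.coord_apply, Module.Basis.repr_self,
      Finsupp.single_apply]
  have hnP : n ∈ coweightLattice Φ := by
    intro k
    have hi := b.root_mem_span_int k
    rw [RootPairing.root']
    generalize Φ.root k = y at hi
    induction hi using Submodule.span_induction with
    | mem x hx =>
      obtain ⟨j, hj, rfl⟩ := hx
      refine ⟨if (⟨j, hj⟩ : b.support) = i then 1 else 0, ?_⟩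
      have := hs ⟨j, hj⟩
      refine Eq.trans this ?_
      push_cast
      rfl
    | zero => exact ⟨0, by simp⟩
    | add x y _ _ hx hy =>
      obtain ⟨a, ha⟩ := hx
      obtain ⟨c, hc⟩ := hy
      exact ⟨a + c, by rw [map_add, LinearMap.add_apply, ha, hc]; push_cast; rfl⟩
    | smul a x _ hx =>
      obtain ⟨c, hc⟩ := hx
      exact ⟨a * c, by rw [map_zsmul, LinearMap.smul_apply, hc]; simp⟩
  refine ⟨⟨n, hnP⟩, ?_, fun j hj => ?_⟩
  · rw [pair_eq_iff]
    change Φ.root' i n = _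
    rw [hs]; simp
  · rw [pair_eq_iff]
    change Φ.root' j n = _
    rw [hs]; simp [hj]

/-- The fundamental coweights. -/
def fundCoweight (i : b.support) : coweightLattice Φ := (exists_fundCoweight b i).choose

@[simp] theorem pair_fundCoweight_self (i : b.support) :
    pair Φ i (fundCoweight b i) = 1 := (exists_fundCoweight b i).choose_spec.1

theorem pair_fundCoweight_ne {i j : b.support} (h : j ≠ i) :
    pair Φ j (fundCoweight b i) = 0 := (exists_fundCoweight b i).choose_spec.2 j h

/-- The coefficient of a simple root in a root. -/
def coef (k : ι) (i : b.support) : ℤ := pair Φ k (fundCoweight b i)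

theorem coef_of_eq {k : ι} {f : ι → ℤ} (h : Φ.root k = ∑ j ∈ b.support, f j • Φ.root j)
    (i : b.support) : coef b k i = f i := by
  rw [coef, pair_eq_iff, RootPairing.root', h, map_sum, LinearMap.sum_apply,
    Finset.sum_eq_single (i : ι)]
  · have := pair_spec Φ i (fundCoweight b i)
    rw [pair_fundCoweight_self, RootPairing.root'] at this
    rw [map_zsmul, LinearMap.smul_apply, ← this]; simp
  · intro j hj hji
    have := pair_spec Φ j (fundCoweight b i)
    rw [pair_fundCoweight_ne b (j := ⟨j, hj⟩) (fun h => hji (congrArg Subtype.val h)),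
      RootPairing.root'] at this
    rw [map_zsmul, LinearMap.smul_apply, ← this]; simp
  · exact fun h => absurd i.2 h

theorem root_eq_sum_coef (k : ι) : Φ.root k = ∑ j : b.support, coef b k j • Φ.root j := by
  obtain ⟨f, -, -, hf⟩ := b.exists_root_eq_sum_int k
  rw [hf, ← Finset.sum_coe_sort]
  exact Finset.sum_congr rfl fun j _ => by rw [coef_of_eq b hf]

theorem root'_eq_sum_coef (k : ι) (x : N) :
    Φ.root' k x = ∑ j : b.support, (coef b k j : ℝ) * Φ.root' j x := by
  rw [RootPairing.root', root_eq_sum_coef b k, map_sum, LinearMap.sum_apply]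
  exact Finset.sum_congr rfl fun j _ => by
    rw [map_zsmul, LinearMap.smul_apply, RootPairing.root', zsmul_eq_mul]

theorem pair_eq_sum_coef (k : ι) (μ : coweightLattice Φ) :
    pair Φ k μ = ∑ j : b.support, coef b k j * pair Φ j μ := by
  rw [pair_eq_iff, root'_eq_sum_coef b]
  push_cast
  simp only [pair_spec]

theorem height_eq_sum_coef (k : ι) : b.height k = ∑ j : b.support, coef b k j := by
  obtain ⟨f, -, -, hf⟩ := b.exists_root_eq_sum_int k
  rw [RootPairing.Base.height_eq_sum hf, ← Finset.sum_coe_sort]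
  exact Finset.sum_congr rfl fun j _ => by rw [coef_of_eq b hf]

theorem coef_nonneg {k : ι} (hk : b.IsPos k) (j : b.support) : 0 ≤ coef b k j := by
  obtain ⟨f, -, hf', hf⟩ := b.exists_root_eq_sum_int k
  rcases hf' with h | h
  · rw [coef_of_eq b hf]; exact h.le j
  · rw [RootPairing.Base.isPos_iff, RootPairing.Base.height_eq_sum hf] at hk
    exact absurd hk (not_lt.2 (Finset.sum_nonpos fun i _ => h.le i))

@[simp] theorem coef_negIdx (k : ι) (j : b.support) : coef b (negIdx Φ k) j = -coef b k j := by
  simp [coef]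

@[simp] theorem coef_self (j : b.support) : coef b j j = 1 := by simp [coef]

theorem isPos_of_coef {k : ι} (h : ∀ j, 0 ≤ coef b k j) : b.IsPos k := by
  rw [RootPairing.Base.isPos_iff', height_eq_sum_coef]
  exact Finset.sum_nonneg fun j _ => h j

theorem root_ext_coef {k l : ι} (h : ∀ j, coef b k j = coef b l j) : k = l :=
  Φ.root.injective (by rw [root_eq_sum_coef b k, root_eq_sum_coef b l]; simp only [h])

theorem pair_nonneg_of_isPos {k : ι} (hk : b.IsPos k) {μ : coweightLattice Φ}
    (hμ : IsDominant b μ) : 0 ≤ pair Φ k μ := by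
  rw [pair_eq_sum_coef b]
  refine Finset.sum_nonneg fun j _ => mul_nonneg (coef_nonneg b hk j) ?_
  have := hμ j j.2
  rw [← pair_spec] at this
  exact_mod_cast this

theorem coweight_ext {μ ν : coweightLattice Φ} (h : ∀ j : b.support, pair Φ j μ = pair Φ j ν) :
    μ = ν := by
  refine Subtype.ext (sub_eq_zero.1 ?_)
  have : ∀ i, Φ.root' i ((μ : N) - (ν : N)) = 0 := fun i => by
    rw [map_sub, ← pair_spec, ← pair_spec, pair_eq_sum_coef b i μ, pair_eq_sum_coef b i ν]
    simp [h]
  refine Φ.toLinearMap.flip.toPerfPair.injective ?_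
  rw [map_zero]
  refine LinearMap.ext_on_range (v := Φ.root) RootPairing.IsRootSystem.span_root_eq_top
    fun i => this i

theorem coweight_eq_sum (μ : coweightLattice Φ) :
    μ = ∑ j : b.support, pair Φ j μ • fundCoweight b j := by
  refine coweight_ext b fun i => ?_
  rw [map_sum, Finset.sum_eq_single i]
  · simp
  · intro j _ hj
    rw [map_zsmul, pair_fundCoweight_ne b hj.symm, smul_zero]
  · simp

theorem isDominant_fundCoweight (i : b.support) : IsDominant b (fundCoweight b i) := by
  intro j hj
  rw [← pair_spec]
  by_cases h : (⟨j, hj⟩ : b.support) = i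
  · subst h; have := pair_fundCoweight_self b ⟨j, hj⟩
    rw [this]; simp
  · rw [pair_fundCoweight_ne b h]; simp

theorem isDominant_iff {μ : coweightLattice Φ} :
    IsDominant b μ ↔ ∀ j : b.support, 0 ≤ pair Φ j μ := by
  refine ⟨fun h j => ?_, fun h j hj => ?_⟩
  · have := h j j.2
    rw [← pair_spec] at this
    exact_mod_cast this
  · rw [← pair_spec]; exact_mod_cast h ⟨j, hj⟩

variable [Φ.IsReduced]

theorem isPos_reflection {k : ι} (hk : b.IsPos k) (j : b.support) (h : k ≠ j) :
    b.IsPos (weylReflection Φ j • k) := by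
  rw [weylReflection_smul]
  exact RootPairing.Base.IsPos.reflectionPerm hk j.2 h

theorem isPos_reflection_iff {k : ι} (j : b.support) (h : k ≠ j) (h' : k ≠ negIdx Φ j) :
    b.IsPos (weylReflection Φ j • k) ↔ b.IsPos k := by
  refine ⟨fun hk => ?_, fun hk => isPos_reflection b hk j h⟩
  by_contra hk'
  rw [← isPos_negIdx] at hk'
  have := isPos_reflection b hk' j (fun h2 => h' (by rw [← h2, negIdx_negIdx]))
  rw [smul_negIdx, isPos_negIdx] at this
  exact this hk

theorem isPos_simple (j : b.support) : b.IsPos j := RootPairing.Base.isPos_of_mem_support j.2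

end Positivity

/-! ### The highest root and its pairings. -/

section HighestRoot

variable [Finite ι] {Φ : RootPairing ι ℝ M N} (b : Φ.Base)
  [Φ.IsCrystallographic] [Φ.IsRootSystem] [Φ.IsReduced]

theorem coef_eq_add {k l m : ι} (h : Φ.root k = Φ.root l + Φ.root m) (j : b.support) :
    coef b k j = coef b l j + coef b m j := by
  rw [coef, pair_eq_iff, RootPairing.root', h, map_add, LinearMap.add_apply]
  push_cast
  rw [coef, coef, pair_spec, pair_spec]

/-- A root is maximal if no other root dominates it coefficientwise. -/
def IsMaxRoot (k : ι) : Prop := ∀ l, (∀ j, coef b k j ≤ coef b l j) → l = k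

theorem IsMaxRoot.isPos {k : ι} (hk : IsMaxRoot b k) : b.IsPos k := by
  by_contra h
  rw [← isPos_negIdx] at h
  have := hk (negIdx Φ k) fun j => by
    have := coef_nonneg b h j
    rw [coef_negIdx] at this ⊢
    linarith
  have h2 := (isPos_negIdx b k).1 h
  exact h2 (this ▸ h)

/-- With a negative pairing, the sum of the root and the simple root would be a root that dominates
the maximal one. -/
theorem IsMaxRoot.pairingIn_nonneg {k : ι} (hk : IsMaxRoot b k) (i : b.support) :
    0 ≤ Φ.pairingIn ℤ k i := by
  by_contra! h
  have hne : Φ.root k ≠ -Φ.root i := by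
    intro h2
    have : k = negIdx Φ i := Φ.root.injective (by rw [h2, root_negIdx])
    have hp := hk.isPos
    rw [this, isPos_negIdx] at hp
    exact hp (RootPairing.Base.isPos_of_mem_support i.2)
  obtain ⟨l, hl⟩ := Φ.root_add_root_mem_of_pairingIn_neg h hne
  have h1 : ∀ j, coef b k j ≤ coef b l j := fun j => by
    rw [coef_eq_add b hl]
    have := coef_nonneg b (RootPairing.Base.isPos_of_mem_support i.2) j
    linarith
  have h2 := hk l h1
  have h3 := coef_eq_add b hl i
  rw [h2, coef_self] at h3
  linarith

theorem pairingIn_eq_sum_coef (k i : ι) :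
    Φ.pairingIn ℤ k i = ∑ j : b.support, coef b k j * Φ.pairingIn ℤ j i := by
  rw [← pair_corootP, pair_eq_sum_coef b]
  simp only [pair_corootP]

/-- Let `q` be the span of the simple roots occurring in k. If α_j does not occur, the pairing of k
with α_j^∨ is a sum of nonpositive terms, yet it is nonnegative by maximality; so all its terms
vanish and s_j fixes `q` pointwise. Thus `q` is stable under W₀ and is everything by irreducibility.
A missing α_i would then be killed by its own fundamental coweight. -/
theorem IsMaxRoot.coef_pos [Φ.IsIrreducible] {k : ι} (hk : IsMaxRoot b k) (i : b.support) :
    0 < coef b k i := by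
  set q : Submodule ℝ M := Submodule.span ℝ (Φ.root '' {j | ∃ h : j ∈ b.support,
    coef b k ⟨j, h⟩ ≠ 0}) with hq
  have hmem : ∀ j : b.support, coef b k j ≠ 0 → Φ.root j ∈ q := fun j hj =>
    Submodule.subset_span ⟨j, ⟨j.2, hj⟩, rfl⟩
  have hinv : ∀ j ∈ b.support, q ∈ Module.End.invtSubmodule (Φ.reflection j) := by
    intro j hj
    rw [Module.End.mem_invtSubmodule]
    intro x hx
    rw [Submodule.mem_comap]
    by_cases hc : coef b k ⟨j, hj⟩ = 0
    · suffices h : ∀ l ∈ {j | ∃ h : j ∈ b.support, coef b k ⟨j, h⟩ ≠ 0},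
          Φ.reflection j (Φ.root l) ∈ q by
        rw [hq] at hx
        induction hx using Submodule.span_induction with
        | mem y hy => obtain ⟨l, hl, rfl⟩ := hy; exact h l hl
        | zero => simp
        | add y z _ _ hy hz => rw [map_add]; exact add_mem hy hz
        | smul a y _ hy => rw [map_smul]; exact Submodule.smul_mem _ _ hy
      rintro l ⟨hl, hl'⟩
      have h0 := hk.pairingIn_nonneg b ⟨j, hj⟩
      rw [pairingIn_eq_sum_coef b] at h0
      have hle : ∀ m ∈ Finset.univ, coef b k m * Φ.pairingIn ℤ m j ≤ 0 := by
        intro m _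
        by_cases hm : m = ⟨j, hj⟩
        · rw [hm, hc, zero_mul]
        · exact mul_nonpos_of_nonneg_of_nonpos (coef_nonneg b hk.isPos m)
            (b.pairingIn_le_zero_of_ne (fun h => hm (Subtype.ext h)) m.2 hj)
      have h1 := (Finset.sum_eq_zero_iff_of_nonpos hle).1
        (le_antisymm (Finset.sum_nonpos hle) h0) ⟨l, hl⟩ (Finset.mem_univ _)
      have h2 : Φ.pairingIn ℤ l j = 0 := (mul_eq_zero.1 h1).resolve_left hl'
      have h3 : Φ.pairing l j = 0 := by
        rw [← Φ.algebraMap_pairingIn ℤ, h2]; simp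
      rw [Φ.reflection_apply_root, h3, zero_smul, sub_zero]
      exact Submodule.subset_span ⟨l, ⟨hl, hl'⟩, rfl⟩
    · rw [LinearEquiv.coe_coe, Φ.reflection_apply]
      exact sub_mem hx (Submodule.smul_mem _ _ (hmem ⟨j, hj⟩ hc))
  have hne : q ≠ ⊥ := by
    have hroot : Φ.root k ∈ q := by
      rw [root_eq_sum_coef b k]
      refine sum_mem fun j _ => ?_
      by_cases hj : coef b k j = 0
      · rw [hj, zero_smul]; exact zero_mem _
      · exact zsmul_mem (hmem j hj) _
    intro h
    rw [h, Submodule.mem_bot] at hroot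
    exact Φ.ne_zero k hroot
  have htop := RootPairing.IsIrreducible.eq_top_of_invtSubmodule_reflection (P := Φ) q
    ((b.forall_mem_support_invtSubmodule_iff q).1 hinv) hne
  refine lt_of_le_of_ne (coef_nonneg b hk.isPos i) fun h0 => ?_
  have hi : Φ.root i ∈ q := htop ▸ Submodule.mem_top
  have hker : q ≤ LinearMap.ker (Φ.toLinearMap.flip (fundCoweight b i : N)) := by
    rw [hq, Submodule.span_le]
    rintro _ ⟨j, ⟨hj, hj'⟩, rfl⟩
    have hji : (⟨j, hj⟩ : b.support) ≠ i := fun h => hj' (by rw [h, ← h0])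
    have h1 := pair_spec Φ j (fundCoweight b i)
    rw [pair_fundCoweight_ne b hji, Int.cast_zero] at h1
    exact h1.symm
  have h1 : Φ.root' i (fundCoweight b i : N) = 0 := hker hi
  rw [← pair_spec, pair_fundCoweight_self] at h1
  simp at h1

/-- Expanding k in simple roots, all coefficients are positive and all pairings of simple roots with
the coroot of l are nonnegative; one of them is positive because l is a positive root. -/
theorem IsMaxRoot.pairingIn_pos [Φ.IsIrreducible] {k l : ι} (hk : IsMaxRoot b k)
    (hl : IsMaxRoot b l) : 0 < Φ.pairingIn ℤ k l := by
  have h0 : ∀ j : b.support, 0 ≤ Φ.pairingIn ℤ j l := fun j => by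
    have := hl.pairingIn_nonneg b j
    rcases this.lt_or_eq with h | h
    · exact ((Φ.zero_lt_pairingIn_iff' ℤ).1 h).le
    · exact ((Φ.pairingIn_eq_zero_iff (S := ℤ)).1 h.symm).ge
  obtain ⟨j, hj, hj'⟩ := hl.isPos.exists_mem_support_pos_pairingIn
  rw [pairingIn_eq_sum_coef b]
  exact Finset.sum_pos' (fun i _ => mul_nonneg (hk.coef_pos b i).le (h0 i))
    ⟨⟨j, hj⟩, Finset.mem_univ _, mul_pos (hk.coef_pos b ⟨j, hj⟩) hj'⟩

/-- The positive pairing makes the difference of two distinct maximal roots a root; according to its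
sign, one of the two dominates the other. -/
theorem IsMaxRoot.unique [Φ.IsIrreducible] {k l : ι} (hk : IsMaxRoot b k) (hl : IsMaxRoot b l) :
    k = l := by
  by_contra hne
  obtain ⟨m, hm⟩ := Φ.root_sub_root_mem_of_pairingIn_pos (hk.pairingIn_pos b hl) hne
  have h1 : Φ.root k = Φ.root l + Φ.root m := by rw [hm]; abel
  by_cases hp : b.IsPos m
  · exact hne (hl k fun j => by
      rw [coef_eq_add b h1]; linarith [coef_nonneg b hp j])
  · rw [← isPos_negIdx] at hp
    refine hne (hk l fun j => ?_).symm
    have := coef_nonneg b hp j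
    rw [coef_negIdx] at this
    rw [coef_eq_add b h1]; linarith

theorem exists_isMaxRoot_ge (k : ι) : ∃ l, IsMaxRoot b l ∧ ∀ j, coef b k j ≤ coef b l j := by
  obtain ⟨l, hl, hmax⟩ := Set.exists_max_image {l | ∀ j, coef b k j ≤ coef b l j} b.height
    (Set.toFinite _) ⟨k, fun j => le_rfl⟩
  refine ⟨l, fun m hm => ?_, hl⟩
  have h1 := hmax m fun j => (hl j).trans (hm j)
  rw [height_eq_sum_coef, height_eq_sum_coef] at h1
  refine root_ext_coef b fun j => ?_
  exact ((Finset.sum_eq_sum_iff_of_le fun j _ => hm j).1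
    (le_antisymm (Finset.sum_le_sum fun j _ => hm j) h1) j (Finset.mem_univ _)).symm

variable [Nonempty ι]

theorem isMaxRoot_highestRoot : IsMaxRoot b (highestRoot b) := fun m hm => by
  have h1 := (Finite.exists_max b.height).choose_spec m
  change b.height m ≤ b.height (highestRoot b) at h1
  rw [height_eq_sum_coef, height_eq_sum_coef] at h1
  refine root_ext_coef b fun j => ?_
  exact ((Finset.sum_eq_sum_iff_of_le fun j _ => hm j).1
    (le_antisymm (Finset.sum_le_sum fun j _ => hm j) h1) j (Finset.mem_univ _)).symm

theorem isPos_highestRoot : b.IsPos (highestRoot b) := (isMaxRoot_highestRoot b).isPos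

variable [Φ.IsIrreducible]

theorem coef_le_highestRoot (k : ι) (j : b.support) : coef b k j ≤ coef b (highestRoot b) j := by
  obtain ⟨l, hl, h⟩ := exists_isMaxRoot_ge b k
  rw [(isMaxRoot_highestRoot b).unique b hl]
  exact h j

theorem coef_highestRoot_pos (j : b.support) : 0 < coef b (highestRoot b) j :=
  (isMaxRoot_highestRoot b).coef_pos b j

theorem pair_corootP_highestRoot_nonneg {k : ι} (hk : b.IsPos k) :
    0 ≤ pair Φ k (corootP Φ (highestRoot b)) := by
  refine pair_nonneg_of_isPos b hk ((isDominant_iff b).2 fun j => ?_)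
  rw [pair_corootP]
  have := (isMaxRoot_highestRoot b).pairingIn_nonneg b j
  rcases this.lt_or_eq with h | h
  · exact ((Φ.zero_lt_pairingIn_iff' ℤ).1 h).le
  · exact ((Φ.pairingIn_eq_zero_iff (S := ℤ)).1 h.symm).ge

theorem coef_reflection (i k : ι) (j : b.support) :
    coef b (weylReflection Φ i • k) j = coef b k j - pair Φ k (corootP Φ i) * coef b i j := by
  rw [weylReflection_smul, coef, pair_eq_iff, RootPairing.root', Φ.root_reflectionPerm,
    Φ.reflection_apply_root, map_sub, map_smul, LinearMap.sub_apply, LinearMap.smul_apply]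
  push_cast
  rw [pair_corootP, coef, coef, pair_spec, pair_spec]
  have : ((Φ.pairingIn ℤ k i : ℤ) : ℝ) = Φ.pairing k i := Φ.algebraMap_pairingIn ℤ k i
  rw [this]; rfl

/-- If the pairing p is at least 2, the root -s_φ(k) = pφ - k is dominated by φ. This gives φ ≤ k
coefficientwise, so k = φ. -/
theorem pair_corootP_highestRoot_le_one {k : ι} (hne : k ≠ highestRoot b) :
    pair Φ k (corootP Φ (highestRoot b)) ≤ 1 := by
  by_contra! h
  refine hne (isMaxRoot_highestRoot b |>.unique b ?_).symm
  have hle := fun j => coef_le_highestRoot b (negIdx Φ (weylReflection Φ (highestRoot b) • k)) j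
  simp only [coef_negIdx, coef_reflection] at hle
  have heq : highestRoot b = k := by
    refine root_ext_coef b fun j => ?_
    have h1 := hle j
    have h2 := coef_le_highestRoot b k j
    have h3 := coef_highestRoot_pos b j
    nlinarith
  rw [← heq]; exact isMaxRoot_highestRoot b

end HighestRoot

/-! ### The fundamental alcove and positive coroots. -/

section Chamber

variable [Finite ι] [Nonempty ι] {Φ : RootPairing ι ℝ M N} (b : Φ.Base)
  [Φ.IsCrystallographic] [Φ.IsReduced] [Φ.IsIrreducible]

theorem root'_pos_of_mem_chamber {x : N} (hx : x ∈ fundamentalChamber b) {k : ι}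
    (hk : b.IsPos k) : 0 < Φ.root' k x := by
  rw [root'_eq_sum_coef b]
  have hne : ∃ j, 0 < coef b k j := by
    by_contra! h
    rw [RootPairing.Base.isPos_iff, height_eq_sum_coef] at hk
    exact absurd hk (not_lt.2 (Finset.sum_nonpos fun j _ => h j))
  obtain ⟨j, hj⟩ := hne
  exact Finset.sum_pos' (fun i _ => mul_nonneg (by exact_mod_cast coef_nonneg b hk i)
    (hx.1 i i.2).le) ⟨j, Finset.mem_univ _, mul_pos (by exact_mod_cast hj) (hx.1 j j.2)⟩

theorem root'_lt_one_of_mem_chamber {x : N} (hx : x ∈ fundamentalChamber b) (k : ι) :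
    Φ.root' k x < 1 := by
  have h1 : Φ.root' k x ≤ Φ.root' (highestRoot b) x := by
    rw [root'_eq_sum_coef b, root'_eq_sum_coef b (highestRoot b)]
    exact Finset.sum_le_sum fun j _ => mul_le_mul_of_nonneg_right
      (by exact_mod_cast coef_le_highestRoot b k j) (hx.1 j j.2).le
  linarith [hx.2]

theorem fundamentalChamber_nonempty : (fundamentalChamber b).Nonempty := by
  set S : N := ∑ j : b.support, (fundCoweight b j : N) with hS
  have hsimple : ∀ i : b.support, Φ.root' i S = 1 := by
    intro i
    rw [hS, map_sum, Finset.sum_eq_single i]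
    · rw [← pair_spec, pair_fundCoweight_self]; simp
    · intro j _ hj; rw [← pair_spec, pair_fundCoweight_ne b hj.symm]; simp
    · simp
  set h := Φ.root' (highestRoot b) S with hh
  have hpos : 0 ≤ h := by
    rw [hh, root'_eq_sum_coef b]
    exact Finset.sum_nonneg fun j _ => by
      rw [hsimple]; have := (coef_highestRoot_pos b j).le; simpa using this
  -- Every simple root is 1 at `S` and the highest root is `h`; after rescaling, the highest root
  -- takes the value h/(h + 1) < 1.
  refine ⟨(h + 1)⁻¹ • S, fun i hi => ?_, ?_⟩
  · rw [map_smul, hsimple ⟨i, hi⟩]; simp; positivity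
  · rw [map_smul, ← hh, smul_eq_mul]
    have : (h + 1)⁻¹ * h < 1 := by
      rw [inv_mul_lt_iff₀ (by positivity)]; linarith
    linarith


/-- Positive roots have positive coroots: every root is reached from simple ones by negation and
simple reflections, and s_j preserves positivity away from ±α_j for the base and for its dual alike.
It is needed to expand positive coroots in simple coroots. -/
theorem isPos_flip_iff (i : ι) : b.flip.IsPos i ↔ b.IsPos i := by
  have hneg : ∀ k, b.flip.IsPos (Φ.reflectionPerm k k) ↔ ¬ b.flip.IsPos k := fun k =>
    RootPairing.Base.IsPos.neg_iff_not b.flip k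
  have hneg' : ∀ k, b.IsPos (Φ.reflectionPerm k k) ↔ ¬ b.IsPos k := fun k =>
    RootPairing.Base.IsPos.neg_iff_not b k
  refine RootPairing.Base.induction_reflect (b := b) i (p := fun i => b.flip.IsPos i ↔ b.IsPos i)
    (fun i h => ?_) (fun i h => ?_) (fun i j h hj => ?_)
  · rw [hneg, hneg', h]
  · exact iff_of_true (RootPairing.Base.isPos_of_mem_support (b := b.flip) h)
      (RootPairing.Base.isPos_of_mem_support h)
  · by_cases h1 : i = j
    · subst h1; rw [hneg, hneg', h]
    · by_cases hp : b.IsPos i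
      · exact iff_of_true (RootPairing.Base.IsPos.reflectionPerm (b := b.flip) (h.2 hp) hj h1)
          (RootPairing.Base.IsPos.reflectionPerm hp hj h1)
      · by_cases h2 : i = negIdx Φ j
        · subst h2
          have : Φ.reflectionPerm j (negIdx Φ j) = j := by simp [negIdx]
          rw [this]
          exact iff_of_true (RootPairing.Base.isPos_of_mem_support (b := b.flip) hj)
            (RootPairing.Base.isPos_of_mem_support hj)
        · have h3 : negIdx Φ i ≠ j := fun h => h2 (by rw [← h, negIdx_negIdx])
          have hp1 : b.IsPos (negIdx Φ i) := (isPos_negIdx b i).2 hp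
          have hp2 : b.flip.IsPos (negIdx Φ i) := (hneg i).2 fun hh => hp (h.1 hh)
          have e : Φ.reflectionPerm j (negIdx Φ i) = negIdx Φ (Φ.reflectionPerm j i) := by
            rw [← weylReflection_smul, smul_negIdx, weylReflection_smul]
          have q1 := RootPairing.Base.IsPos.reflectionPerm hp1 hj h3
          have q2 := RootPairing.Base.IsPos.reflectionPerm (b := b.flip) hp2 hj h3
          change b.flip.IsPos (Φ.reflectionPerm j (negIdx Φ i)) at q2
          rw [e] at q1 q2
          exact iff_of_false ((hneg _).1 q2) ((hneg' _).1 q1)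

/-- The coroot of a positive root is a nonnegative combination of simple coroots. -/
theorem exists_corootP_eq_sum {k : ι} (hk : b.IsPos k) :
    ∃ c : b.support → ℕ, corootP Φ k = ∑ j, c j • corootP Φ j := by
  rw [← isPos_flip_iff] at hk
  obtain ⟨f, -, hf', hf⟩ := b.flip.exists_root_eq_sum_int k
  rcases hf' with h | h
  · refine ⟨fun j => (f j).toNat, Subtype.ext ?_⟩
    change Φ.coroot k = _
    refine Eq.trans hf ?_
    rw [AddSubgroup.val_finsetSum]
    refine (Finset.sum_coe_sort b.support (fun j => f j • Φ.coroot j)).symm.trans ?_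
    refine Finset.sum_congr rfl fun j _ => ?_
    rw [AddSubgroup.coe_nsmul, ← natCast_zsmul, Int.toNat_of_nonneg (h.le j)]; rfl
  · rw [RootPairing.Base.isPos_iff, RootPairing.Base.height_eq_sum hf] at hk
    exact absurd hk (not_lt.2 (Finset.sum_nonpos fun i _ => h.le i))

end Chamber

/-! ### Affine roots and the action of the extended affine Weyl group. -/

section AffineRoots

variable (Φ : RootPairing ι ℝ M N) [Φ.IsCrystallographic]

/-- The translation part of an element of the extended affine Weyl group. -/
def transPart (g : ExtAffineWeyl Φ) : coweightLattice Φ := Multiplicative.toAdd g.left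

/-- The action of the extended affine Weyl group on affine roots `α + k`. -/
def act (g : ExtAffineWeyl Φ) (a : ι × ℤ) : ι × ℤ :=
  (g.right • a.1, a.2 - pair Φ (g.right • a.1) (transPart Φ g))

/-- The negative of an affine root. -/
def affNeg (a : ι × ℤ) : ι × ℤ := (negIdx Φ a.1, -a.2)

@[simp] theorem affNeg_affNeg (a : ι × ℤ) : affNeg Φ (affNeg Φ a) = a := by simp [affNeg]

@[simp] theorem act_affNeg (g : ExtAffineWeyl Φ) (a : ι × ℤ) :
    act Φ g (affNeg Φ a) = affNeg Φ (act Φ g a) := by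
  simp [act, affNeg]; ring

@[simp] theorem act_one (a : ι × ℤ) : act Φ 1 a = a := by
  simp [act, transPart]

theorem transPart_mul (g h : ExtAffineWeyl Φ) :
    transPart Φ (g * h) = transPart Φ g + weylAct Φ g.right (transPart Φ h) := rfl

theorem act_mul (g h : ExtAffineWeyl Φ) (a : ι × ℤ) : act Φ (g * h) a = act Φ g (act Φ h a) := by
  simp only [act, transPart_mul, SemidirectProduct.mul_right, mul_smul, map_add, pair_smul]
  congr 1; ring

@[simp] theorem act_inv_act (g : ExtAffineWeyl Φ) (a : ι × ℤ) : act Φ g⁻¹ (act Φ g a) = a := by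
  rw [← act_mul, inv_mul_cancel, act_one]

@[simp] theorem act_act_inv (g : ExtAffineWeyl Φ) (a : ι × ℤ) : act Φ g (act Φ g⁻¹ a) = a := by
  rw [← act_mul, mul_inv_cancel, act_one]

theorem act_injective (g : ExtAffineWeyl Φ) : Function.Injective (act Φ g) :=
  Function.LeftInverse.injective (act_inv_act Φ g)

/-- This explains the sign in `act`: the affine function of `act Φ g a` is that of `a` composed with
g⁻¹. -/
theorem root'_act (g : ExtAffineWeyl Φ) (a : ι × ℤ) (x : N) :
    Φ.root' (act Φ g a).1 (affAct Φ g x) + (act Φ g a).2 = Φ.root' a.1 x + a.2 := by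
  simp only [act, affAct, map_add, root'_smul, Int.cast_sub, pair_spec, transPart]
  ring

@[simp] theorem act_translation (μ : coweightLattice Φ) (a : ι × ℤ) :
    act Φ (translation Φ μ) a = (a.1, a.2 - pair Φ a.1 μ) := by
  simp [act, translation, mkAff, transPart]

@[simp] theorem act_mkAff_zero (w : weylGroup Φ) (a : ι × ℤ) :
    act Φ (mkAff Φ 0 w) a = (w • a.1, a.2) := by
  simp [act, mkAff, transPart]

theorem mkAff_mul (μ ν : coweightLattice Φ) (w v : weylGroup Φ) :
    mkAff Φ μ w * mkAff Φ ν v = mkAff Φ (μ + weylAct Φ w ν) (w * v) := rfl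

theorem mkAff_ext {g : ExtAffineWeyl Φ} : g = mkAff Φ (transPart Φ g) g.right := rfl

theorem mkAff_inj {μ ν : coweightLattice Φ} {w v : weylGroup Φ} :
    mkAff Φ μ w = mkAff Φ ν v ↔ μ = ν ∧ w = v := by
  refine ⟨fun h => ⟨congrArg (transPart Φ) h, congrArg SemidirectProduct.right h⟩, ?_⟩
  rintro ⟨rfl, rfl⟩; rfl

/-- The inclusion of the finite Weyl group. -/
def finWeyl : weylGroup Φ →* ExtAffineWeyl Φ where
  toFun := mkAff Φ 0
  map_one' := rfl
  map_mul' w v := by rw [mkAff_mul, map_zero, add_zero]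

theorem finWeyl_apply (w : weylGroup Φ) : finWeyl Φ w = mkAff Φ 0 w := rfl

@[simp] theorem act_finWeyl (w : weylGroup Φ) (a : ι × ℤ) :
    act Φ (finWeyl Φ w) a = (w • a.1, a.2) := act_mkAff_zero Φ w a

theorem mkAff_eq (μ : coweightLattice Φ) (w : weylGroup Φ) :
    mkAff Φ μ w = translation Φ μ * finWeyl Φ w := by
  simp [translation, finWeyl_apply, mkAff_mul]

theorem translation_add (μ ν : coweightLattice Φ) :
    translation Φ (μ + ν) = translation Φ μ * translation Φ ν := by
  simp [translation, mkAff_mul]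

@[simp] theorem translation_zero : translation Φ 0 = 1 := rfl

theorem finWeyl_mul_translation (w : weylGroup Φ) (μ : coweightLattice Φ) :
    finWeyl Φ w * translation Φ μ = translation Φ (weylAct Φ w μ) * finWeyl Φ w := by
  simp [translation, finWeyl_apply, mkAff_mul]

theorem affineReflection_mul_self (i : ι) (k : ℤ) :
    affineReflection Φ i k * affineReflection Φ i k = 1 := by
  rw [affineReflection, mkAff_mul, weylReflection_mul_self, weylAct_weylReflection]
  have : -(k • corootP Φ i) + (-(k • corootP Φ i) - (pair Φ i) (-(k • corootP Φ i)) • corootP Φ i)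
      = 0 := by
    rw [map_neg, map_zsmul, pair_corootP_same, neg_smul, smul_eq_mul, mul_smul, two_smul, smul_add]
    abel
  rw [this]; rfl

theorem affineReflection_zero (i : ι) :
    affineReflection Φ i 0 = finWeyl Φ (weylReflection Φ i) := by
  simp [affineReflection, finWeyl_apply]

theorem act_affineReflection (i : ι) (k : ℤ) (a : ι × ℤ) :
    act Φ (affineReflection Φ i k) a =
      (weylReflection Φ i • a.1, a.2 - k * pair Φ a.1 (corootP Φ i)) := by
  have h : pair Φ (weylReflection Φ i • a.1) (corootP Φ i) = - pair Φ a.1 (corootP Φ i) := by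
    rw [← pair_smul Φ (weylReflection Φ i) a.1 (corootP Φ i), weylAct_corootP]
    have : corootP Φ (weylReflection Φ i • i) = - corootP Φ i := by
      rw [weylReflection_smul]; exact corootP_negIdx Φ i
    rw [this, map_neg, neg_neg]
  simp only [act, affineReflection, mkAff, transPart, toAdd_ofAdd, map_neg, map_zsmul, h]
  congr 1; simp

theorem conj_affineReflection (g : ExtAffineWeyl Φ) (i : ι) (k : ℤ) :
    g * affineReflection Φ i k * g⁻¹ =
      affineReflection Φ (act Φ g (i, k)).1 (act Φ g (i, k)).2 := by
  rw [mul_inv_eq_iff_eq_mul, mkAff_ext Φ (g := g)]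
  simp only [affineReflection, mkAff_mul, mkAff_inj]
  set μ := transPart Φ g
  set w := g.right
  have h2 : weylReflection Φ (w • i) * w = w * weylReflection Φ i := by
    rw [coreflection_smul]; group
  refine ⟨?_, h2.symm⟩
  simp only [act, transPart, mkAff, toAdd_ofAdd]
  rw [weylAct_weylReflection, map_neg, map_zsmul, weylAct_corootP, sub_smul]
  abel

theorem affineReflection_affNeg (a : ι × ℤ) :
    affineReflection Φ (affNeg Φ a).1 (affNeg Φ a).2 = affineReflection Φ a.1 a.2 := by
  rw [affineReflection, affineReflection, mkAff_inj]
  refine ⟨by simp [affNeg], ?_⟩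
  have : negIdx Φ a.1 = weylReflection Φ a.1 • a.1 := by rw [weylReflection_smul]; rfl
  change weylReflection Φ (negIdx Φ a.1) = _
  rw [this, coreflection_smul]; group

end AffineRoots

/-! ### Length as the number of inversions. -/

section Length

variable [Finite ι] [Nonempty ι] {Φ : RootPairing ι ℝ M N} (b : Φ.Base) [Φ.IsCrystallographic]

/-- Positivity of affine roots. -/
def AffPos (a : ι × ℤ) : Prop := 0 < a.2 ∨ (a.2 = 0 ∧ b.IsPos a.1)

theorem affPos_affNeg (a : ι × ℤ) : AffPos b (affNeg Φ a) ↔ ¬ AffPos b a := by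
  simp only [AffPos, affNeg, isPos_negIdx]
  rcases lt_trichotomy a.2 0 with h | h | h
  · exact iff_of_true (Or.inl (by linarith)) (by rintro (h' | ⟨h', -⟩) <;> linarith)
  · simp [h]
  · exact iff_of_false (by rintro (h' | ⟨h', -⟩) <;> linarith) (by simp [h])

/-- The simple affine roots. -/
def simpleRoot : Option b.support → ι × ℤ
  | none => (negIdx Φ (highestRoot b), 1)
  | some i => (i, 0)

theorem affPos_simpleRoot (j : Option b.support) : AffPos b (simpleRoot b j) := by
  cases j with
  | none => exact Or.inl one_pos
  | some i => exact Or.inr ⟨rfl, RootPairing.Base.isPos_of_mem_support i.2⟩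

theorem simpleReflection_eq (j : Option b.support) : simpleReflection b j =
    affineReflection Φ (simpleRoot b j).1 (simpleRoot b j).2 := by
  cases j with
  | none => exact (affineReflection_affNeg Φ (highestRoot b, -1)).symm
  | some i => rfl

theorem simpleReflection_mul_self (j : Option b.support) :
    simpleReflection b j * simpleReflection b j = 1 := by
  rw [simpleReflection_eq, affineReflection_mul_self]

theorem simpleReflection_inv (j : Option b.support) :
    (simpleReflection b j)⁻¹ = simpleReflection b j :=
  inv_eq_of_mul_eq_one_left (simpleReflection_mul_self b j)

theorem act_simpleReflection_self (j : Option b.support) :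
    act Φ (simpleReflection b j) (simpleRoot b j) = affNeg Φ (simpleRoot b j) := by
  rw [simpleReflection_eq, act_affineReflection, affNeg, weylReflection_smul, pair_corootP_same]
  congr 1; ring

theorem mul_simpleReflection_eq {g : ExtAffineWeyl Φ} {i j : Option b.support}
    (h : act Φ g (simpleRoot b j) = simpleRoot b i ∨
      act Φ g (simpleRoot b j) = affNeg Φ (simpleRoot b i)) :
    g * simpleReflection b j = simpleReflection b i * g := by
  rw [← mul_inv_eq_iff_eq_mul, simpleReflection_eq, conj_affineReflection, simpleReflection_eq]
  rcases h with h | h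
  · rw [← h]
  · rw [← affineReflection_affNeg Φ (simpleRoot b i), ← h]

variable [Φ.IsReduced] [Φ.IsIrreducible]

/-- For s_0 the constant k becomes k + m, where m is the pairing of the gradient with φ^∨. Nothing
can go wrong for m ≥ 0. Otherwise m = -1, except that m = -2 for the gradient -φ. If m = -1 and k =
1, the new gradient is i + φ, positive because φ dominates -i. For -φ, the excluded case k = 1 is
the simple root itself; k = 2 gives (φ, 0), and larger k stays positive. -/
theorem affPos_act_simpleReflection {a : ι × ℤ} {j : Option b.support} (ha : AffPos b a)
    (hne : a ≠ simpleRoot b j) : AffPos b (act Φ (simpleReflection b j) a) := by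
  obtain ⟨i, k⟩ := a
  cases j with
  | some j =>
    rw [simpleReflection, affineReflection_zero, act_finWeyl]
    rcases ha with h | ⟨h, hi⟩
    · exact Or.inl h
    · refine Or.inr ⟨h, isPos_reflection b hi j fun hij => hne ?_⟩
      simp only at h hij
      rw [h, hij]; rfl
  | none =>
    rw [simpleReflection, act_affineReflection]
    simp only [AffPos] at ha ⊢
    set φ := highestRoot b with hφ
    set m := pair Φ i (corootP Φ φ) with hm
    have hcoef := fun j => coef_reflection b φ i j
    by_cases hp : b.IsPos i
    · have h0 : 0 ≤ k := by rcases ha with h | ⟨h, -⟩ <;> linarith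
      have hm0 : 0 ≤ m := pair_corootP_highestRoot_nonneg b hp
      rcases hm0.lt_or_eq with h1 | h1
      · left; linarith
      · have : weylReflection Φ φ • i = i := root_ext_coef b fun j => by
          rw [hcoef, ← hm, ← h1]; ring
        rw [this]
        rcases h0.lt_or_eq with h2 | h2
        · left; linarith
        · right; exact ⟨by linarith, hp⟩
    · have hk : 0 < k := ha.resolve_right fun h => hp h.2
      have hn : b.IsPos (negIdx Φ i) := (isPos_negIdx b i).2 hp
      by_cases hi : i = negIdx Φ φ
      · have hk1 : k ≠ 1 := fun h => hne (by rw [h, hi]; rfl)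
        have : m = -2 := by rw [hm, hi, pair_negIdx, pair_corootP_same]
        rcases (show 2 ≤ k by omega).lt_or_eq with h | h
        · left; rw [this]; linarith
        · refine Or.inr ⟨by rw [this, ← h]; ring, ?_⟩
          rw [hi, smul_negIdx, weylReflection_smul]
          change b.IsPos (negIdx Φ (negIdx Φ φ))
          rw [negIdx_negIdx]
          exact isPos_highestRoot b
      · have h1 := pair_corootP_highestRoot_le_one b (k := negIdx Φ i)
          fun h => hi (by rw [← negIdx_negIdx Φ i, h])
        have h2 := pair_corootP_highestRoot_nonneg b hn
        rw [pair_negIdx, ← hφ, ← hm] at h1 h2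
        have h3 : m = 0 ∨ m = -1 := by omega
        rcases h3 with h3 | h3
        · left; rw [h3]; linarith
        · rcases (show 1 ≤ k from hk).lt_or_eq with h4 | h4
          · left; rw [h3]; linarith
          · right
            refine ⟨by rw [h3, ← h4]; ring, isPos_of_coef b fun j => ?_⟩
            rw [hcoef, ← hm, h3]
            have := coef_le_highestRoot b (negIdx Φ i) j
            rw [coef_negIdx] at this
            linarith

theorem affPos_act_simpleReflection_iff {a : ι × ℤ} {j : Option b.support}
    (hne : a ≠ simpleRoot b j) (hne' : a ≠ affNeg Φ (simpleRoot b j)) :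
    AffPos b (act Φ (simpleReflection b j) a) ↔ AffPos b a := by
  refine ⟨fun h => ?_, fun h => affPos_act_simpleReflection b h hne⟩
  by_contra ha
  rw [← affPos_affNeg] at ha
  have := affPos_act_simpleReflection b (j := j) ha fun h => hne' (by rw [← h, affNeg_affNeg])
  rw [act_affNeg, affPos_affNeg] at this
  exact this h

/-- Roots take values strictly between -1 and 1 on the alcove, so the sign is that of the constant,
or of the gradient when the constant is 0. -/
theorem pos_of_affPos {a : ι × ℤ} (ha : AffPos b a) {x : N} (hx : x ∈ fundamentalChamber b) :
    0 < Φ.root' a.1 x + a.2 := by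
  rcases ha with h | ⟨h, hp⟩
  · have h1 : (1 : ℝ) ≤ a.2 := by exact_mod_cast h
    have := root'_lt_one_of_mem_chamber b hx (negIdx Φ a.1)
    rw [root'_negIdx, LinearMap.neg_apply] at this
    linarith
  · rw [h]; simpa using root'_pos_of_mem_chamber b hx hp

theorem neg_of_not_affPos {a : ι × ℤ} (ha : ¬ AffPos b a) {x : N}
    (hx : x ∈ fundamentalChamber b) : Φ.root' a.1 x + a.2 < 0 := by
  rw [← affPos_affNeg] at ha
  have := pos_of_affPos b ha hx
  simp only [affNeg, root'_negIdx, LinearMap.neg_apply, Int.cast_neg] at this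
  linarith

/-- The positive affine roots made negative by `g`. -/
def inversions (g : ExtAffineWeyl Φ) : Set (ι × ℤ) := {a | AffPos b a ∧ ¬ AffPos b (act Φ g a)}

theorem inversions_finite (g : ExtAffineWeyl Φ) : (inversions b g).Finite := by
  refine (Set.finite_iUnion fun i : ι => (Set.finite_Icc (0 : ℤ)
    (pair Φ (g.right • i) (transPart Φ g))).image (Prod.mk i)).subset ?_
  rintro ⟨i, k⟩ ⟨h1, h2⟩
  refine Set.mem_iUnion.2 ⟨i, k, ⟨?_, ?_⟩, rfl⟩
  · rcases h1 with h | ⟨h, -⟩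
    · exact h.le
    · exact h.ge
  · by_contra! h
    exact h2 (Or.inl (by simp only [act]; linarith))

/-- The bijection is a ↦ -g⁻¹a. -/
theorem ncard_inversions_inv (g : ExtAffineWeyl Φ) :
    (inversions b g⁻¹).ncard = (inversions b g).ncard := by
  refine Set.ncard_congr (fun a _ => affNeg Φ (act Φ g⁻¹ a)) ?_ ?_ ?_
  · rintro a ⟨h1, h2⟩
    refine ⟨(affPos_affNeg b _).2 h2, ?_⟩
    rw [act_affNeg, act_act_inv, affPos_affNeg]
    exact not_not.2 h1
  · intro a c _ _ h
    have := congrArg (affNeg Φ) h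
    rw [affNeg_affNeg, affNeg_affNeg] at this
    exact act_injective Φ _ this
  · rintro a ⟨h1, h2⟩
    refine ⟨affNeg Φ (act Φ g a), ⟨(affPos_affNeg b _).2 h2, ?_⟩, by simp⟩
    rw [act_affNeg, act_inv_act, affPos_affNeg]
    exact not_not.2 h1

/-- No affine root changes sign on c₀, and the sign of an affine root on g c₀ is the sign of its
translate by g⁻¹ on c₀. -/
theorem separates_iff (g : ExtAffineWeyl Φ) (i : ι) (k : ℤ) :
    Separates Φ i k (fundamentalChamber b) (affAct Φ g '' fundamentalChamber b) ↔
      (AffPos b (i, k) ↔ ¬ AffPos b (act Φ g⁻¹ (i, k))) := by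
  obtain ⟨x, hx⟩ := fundamentalChamber_nonempty b
  have key : ∀ y, Φ.root' i (affAct Φ g y) + k =
      Φ.root' (act Φ g⁻¹ (i, k)).1 y + (act Φ g⁻¹ (i, k)).2 := fun y => by
    rw [← root'_act Φ g (act Φ g⁻¹ (i, k)), act_act_inv]
  simp only [Separates, Set.forall_mem_image, key]
  by_cases h1 : AffPos b (i, k) <;> by_cases h2 : AffPos b (act Φ g⁻¹ (i, k))
  · refine iff_of_false ?_ (by tauto)
    rintro (⟨-, h⟩ | ⟨h, -⟩)
    · exact absurd (h hx) (pos_of_affPos b h2 hx).not_gt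
    · exact absurd (h x hx) (pos_of_affPos b h1 hx).not_gt
  · exact iff_of_true (Or.inl ⟨fun y hy => pos_of_affPos b h1 hy,
      fun y hy => neg_of_not_affPos b h2 hy⟩) (iff_of_true h1 h2)
  · exact iff_of_true (Or.inr ⟨fun y hy => neg_of_not_affPos b h1 hy,
      fun y hy => pos_of_affPos b h2 hy⟩) (iff_of_false h1 (not_not.2 h2))
  · refine iff_of_false ?_ (by tauto)
    rintro (⟨h, -⟩ | ⟨-, h⟩)
    · exact absurd (h x hx) (neg_of_not_affPos b h1 hx).not_gt
    · exact absurd (h hx) (neg_of_not_affPos b h2 hx).not_gt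

/-- A hyperplane is recorded in `length` by its equation with positive gradient and in `inversions`
by its positive equation; the bijection changes the sign where necessary. Separation tests g⁻¹,
hence the passage to the inverse. -/
theorem length_eq (g : ExtAffineWeyl Φ) : length b g = (inversions b g).ncard := by
  classical
  rw [← ncard_inversions_inv]
  refine Set.ncard_congr (fun a _ => if AffPos b a then a else affNeg Φ a) ?_ ?_ ?_
  · rintro ⟨i, k⟩ ⟨h1, h2⟩
    rw [separates_iff] at h2
    by_cases h : AffPos b (i, k)
    · simp only [h, if_true]; exact ⟨h, h2.1 h⟩
    · simp only [h, if_false]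
      refine ⟨(affPos_affNeg b _).2 h, ?_⟩
      rw [act_affNeg, affPos_affNeg]; tauto
  · rintro ⟨i, k⟩ ⟨j, l⟩ ⟨h1, -⟩ ⟨h2, -⟩ h
    have hn : ∀ {i' : ι} {k' : ℤ} {j' : ι} {l' : ℤ}, b.IsPos i' → b.IsPos j' →
        (i', k') ≠ affNeg Φ (j', l') := fun hi hj h => by
      obtain ⟨rfl, -⟩ := Prod.ext_iff.1 h
      exact (isPos_negIdx b _).1 hi hj
    split_ifs at h
    · exact h
    · exact absurd h (hn h1 h2)
    · exact absurd h.symm (hn h2 h1)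
    · rw [← affNeg_affNeg Φ (i, k), h, affNeg_affNeg]
  · rintro ⟨i, k⟩ ⟨h1, h2⟩
    by_cases h : b.IsPos i
    · refine ⟨(i, k), ⟨h, (separates_iff b g i k).2 (iff_of_true h1 h2)⟩, by simp [h1]⟩
    · have h3 : ¬ AffPos b (affNeg Φ (i, k)) := by rw [affPos_affNeg]; exact not_not.2 h1
      refine ⟨affNeg Φ (i, k), ⟨(isPos_negIdx b i).2 h, ?_⟩, ?_⟩
      · refine (separates_iff b g _ _).2 (iff_of_false h3 ?_)
        change ¬ ¬ AffPos b (act Φ g⁻¹ (affNeg Φ (i, k)))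
        rw [act_affNeg, affPos_affNeg]; tauto
      · simp only [h3, if_false, affNeg_affNeg]

theorem length_inv (g : ExtAffineWeyl Φ) : length b g⁻¹ = length b g := by
  rw [length_eq, length_eq, ncard_inversions_inv]

/-- If u repairs no inversion of v, the inversions of uv are the disjoint union of those of v and
the v⁻¹-translates of those of u. All additivity of lengths below comes from this criterion. -/
theorem length_mul_of_forall {u v : ExtAffineWeyl Φ}
    (h : ∀ a, AffPos b a → ¬ AffPos b (act Φ v a) → ¬ AffPos b (act Φ u (act Φ v a))) :
    length b (u * v) = length b u + length b v := by
  have h1 : inversions b (u * v) = act Φ v⁻¹ '' inversions b u ∪ inversions b v := by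
    ext a
    simp only [inversions, Set.mem_union, Set.mem_image, Set.mem_ofPred_eq, act_mul]
    constructor
    · rintro ⟨h1, h2⟩
      by_cases h3 : AffPos b (act Φ v a)
      · exact Or.inl ⟨_, ⟨h3, h2⟩, by simp⟩
      · exact Or.inr ⟨h1, h3⟩
    · rintro (⟨c, ⟨h1, h2⟩, rfl⟩ | ⟨h1, h2⟩)
      · rw [act_act_inv]
        refine ⟨?_, h2⟩
        by_contra h3
        have h4 := h (affNeg Φ (act Φ v⁻¹ c)) ((affPos_affNeg b _).2 h3)
        simp only [act_affNeg, act_act_inv, affPos_affNeg, not_not] at h4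
        exact h2 (h4 h1)
      · exact ⟨h1, h a h1 h2⟩
  have h2 : Disjoint (act Φ v⁻¹ '' inversions b u) (inversions b v) := by
    rw [Set.disjoint_left]
    rintro _ ⟨c, ⟨h1, -⟩, rfl⟩ ⟨-, h2⟩
    rw [act_act_inv] at h2
    exact h2 h1
  rw [length_eq, length_eq, length_eq, h1, Set.ncard_union_eq h2
    ((inversions_finite b u).image _) (inversions_finite b v),
    Set.ncard_image_of_injective _ (act_injective Φ _)]

theorem length_simpleReflection (j : Option b.support) : length b (simpleReflection b j) = 1 := by
  rw [length_eq, Set.ncard_eq_one]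
  refine ⟨simpleRoot b j, Set.ext fun a => ⟨fun ⟨h1, h2⟩ => ?_, ?_⟩⟩
  · by_contra h
    exact h2 (affPos_act_simpleReflection b h1 h)
  · rintro rfl
    refine ⟨affPos_simpleRoot b j, ?_⟩
    rw [act_simpleReflection_self, affPos_affNeg, not_not]
    exact affPos_simpleRoot b j

theorem length_mul_simpleReflection {g : ExtAffineWeyl Φ} {j : Option b.support}
    (h : AffPos b (act Φ g (simpleRoot b j))) :
    length b (g * simpleReflection b j) = length b g + 1 := by
  rw [length_mul_of_forall, length_simpleReflection]
  intro a h1 h2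
  have : a = simpleRoot b j := by
    by_contra h3
    exact h2 (affPos_act_simpleReflection b h1 h3)
  subst this
  rw [act_simpleReflection_self, act_affNeg, affPos_affNeg]
  exact not_not.2 h

theorem length_mul_simpleReflection' {g : ExtAffineWeyl Φ} {j : Option b.support}
    (h : ¬ AffPos b (act Φ g (simpleRoot b j))) :
    length b (g * simpleReflection b j) + 1 = length b g := by
  have := length_mul_simpleReflection b (g := g * simpleReflection b j) (j := j) (by
    rwa [act_mul, act_simpleReflection_self, act_affNeg, affPos_affNeg])
  rw [← this, mul_assoc, simpleReflection_mul_self, mul_one]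

theorem length_simpleReflection_mul {g : ExtAffineWeyl Φ} {j : Option b.support}
    (h : AffPos b (act Φ g⁻¹ (simpleRoot b j))) :
    length b (simpleReflection b j * g) = length b g + 1 := by
  rw [← length_inv, mul_inv_rev, simpleReflection_inv, length_mul_simpleReflection b h, length_inv]

theorem length_simpleReflection_mul' {g : ExtAffineWeyl Φ} {j : Option b.support}
    (h : ¬ AffPos b (act Φ g⁻¹ (simpleRoot b j))) :
    length b (simpleReflection b j * g) + 1 = length b g := by
  rw [← length_inv, mul_inv_rev, simpleReflection_inv, length_mul_simpleReflection' b h, length_inv]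

/-- For x in the alcove, the hypothesis gives g⁻¹x exactly the defining inequalities of the alcove.
Every positive affine root is then positive at g⁻¹x, so its image under g is positive at x. -/
theorem affPos_of_forall_simple {g : ExtAffineWeyl Φ}
    (h : ∀ j, AffPos b (act Φ g (simpleRoot b j))) {a : ι × ℤ} (ha : AffPos b a) :
    AffPos b (act Φ g a) := by
  obtain ⟨x, hx⟩ := fundamentalChamber_nonempty b
  by_contra hn
  have h1 := neg_of_not_affPos b hn hx
  set y := affAct Φ g⁻¹ x with hy
  have hxy : affAct Φ g y = x := by
    rw [hy]
    have := congrArg (fun μ : coweightLattice Φ => (μ : N))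
      (show transPart Φ (g * g⁻¹) = 0 by rw [mul_inv_cancel]; rfl)
    rw [transPart_mul] at this
    simp only [affAct, map_add]
    rw [← add_assoc]
    have h2 : (g.right : N ≃ₗ[ℝ] N) ((g⁻¹.right : N ≃ₗ[ℝ] N) x) = x := by
      have : g.right * g⁻¹.right = 1 := by
        rw [← SemidirectProduct.mul_right, mul_inv_cancel]; rfl
      exact congrArg (fun w : weylGroup Φ => (w : N ≃ₗ[ℝ] N) x) this
    rw [h2]
    change _ + _ + x = x
    have h3 : (transPart Φ g : N) + (g.right : N ≃ₗ[ℝ] N) (transPart Φ g⁻¹ : N) = 0 := this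
    change (transPart Φ g : N) + (g.right : N ≃ₗ[ℝ] N) (transPart Φ g⁻¹ : N) + x = x
    rw [h3, zero_add]
  have hyc : y ∈ fundamentalChamber b := by
    refine ⟨fun i hi => ?_, ?_⟩
    · have := pos_of_affPos b (h (some ⟨i, hi⟩)) hx
      rw [← hxy, root'_act] at this
      simpa [simpleRoot] using this
    · have := pos_of_affPos b (h none) hx
      rw [← hxy, root'_act] at this
      simpa [simpleRoot] using this
  rw [← hxy, root'_act] at h1
  exact absurd (pos_of_affPos b ha hyc) h1.not_gt

theorem length_eq_zero_iff {g : ExtAffineWeyl Φ} :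
    length b g = 0 ↔ ∀ a, AffPos b (act Φ g a) ↔ AffPos b a := by
  rw [length_eq, Set.ncard_eq_zero (inversions_finite b g)]
  refine ⟨fun h a => ?_, fun h => Set.eq_empty_of_forall_notMem fun a ⟨h1, h2⟩ => h2 ((h a).2 h1)⟩
  have key : ∀ a, AffPos b a → AffPos b (act Φ g a) := fun a ha => by
    by_contra h'
    exact (Set.mem_empty_iff_false a).1 (h ▸ ⟨ha, h'⟩)
  refine ⟨fun ha => ?_, key a⟩
  by_contra h'
  have := key _ ((affPos_affNeg b a).2 h')
  rw [act_affNeg, affPos_affNeg] at this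
  exact this ha

theorem exists_simple_of_length_ne_zero {g : ExtAffineWeyl Φ} (h : length b g ≠ 0) :
    ∃ j, ¬ AffPos b (act Φ g (simpleRoot b j)) := by
  by_contra! h'
  refine h ?_
  rw [length_eq, Set.ncard_eq_zero (inversions_finite b g)]
  exact Set.eq_empty_of_forall_notMem fun a ⟨h1, h2⟩ => h2 (affPos_of_forall_simple b h' h1)

theorem length_mul_of_length_eq_zero {u v : ExtAffineWeyl Φ} (hu : length b u = 0) :
    length b (u * v) = length b u + length b v :=
  length_mul_of_forall b fun a _ h2 => by rwa [(length_eq_zero_iff b).1 hu]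

theorem length_mul_of_length_eq_zero' {u v : ExtAffineWeyl Φ} (hv : length b v = 0) :
    length b (u * v) = length b u + length b v :=
  length_mul_of_forall b fun a h1 h2 => absurd (((length_eq_zero_iff b).1 hv a).2 h1) h2

end Length

/-! ### Words in W₀, and equality of parameters. -/

section WeylWords

variable [Finite ι] [Nonempty ι] {Φ : RootPairing ι ℝ M N} (b : Φ.Base) [Φ.IsCrystallographic]
  [Φ.IsReduced] [Φ.IsIrreducible]

/-- The simple reflections of the finite Weyl group. -/
def finSimple (i : b.support) : weylGroup Φ := weylReflection Φ i

theorem finSimple_mul_self (i : b.support) : finSimple b i * finSimple b i = 1 :=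
  weylReflection_mul_self Φ i

theorem finSimple_inv (i : b.support) : (finSimple b i)⁻¹ = finSimple b i :=
  inv_eq_of_mul_eq_one_left (finSimple_mul_self b i)

theorem simpleReflection_some (i : b.support) :
    simpleReflection b (some i) = finWeyl Φ (finSimple b i) := affineReflection_zero Φ i

theorem weylReflection_negIdx (i : ι) : weylReflection Φ (negIdx Φ i) = weylReflection Φ i := by
  have : negIdx Φ i = weylReflection Φ i • i := by rw [weylReflection_smul]; rfl
  rw [this, coreflection_smul]; group

theorem finSimple_smul_self (i : b.support) : finSimple b i • (i : ι) = negIdx Φ i := by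
  rw [finSimple, weylReflection_smul]; rfl

theorem weylReflection_mem_closure_simple (k : ι) :
    weylReflection Φ k ∈ Subgroup.closure (Set.range (finSimple b)) := by
  refine RootPairing.Base.induction_reflect (b := b) k
    (p := fun k => weylReflection Φ k ∈ Subgroup.closure (Set.range (finSimple b)))
    (fun i h => ?_) (fun i h => Subgroup.subset_closure ⟨⟨i, h⟩, rfl⟩) (fun i j h hj => ?_)
  · change weylReflection Φ (negIdx Φ i) ∈ _
    rwa [weylReflection_negIdx]
  · rw [← weylReflection_smul, coreflection_smul]
    have hj' : weylReflection Φ j ∈ Subgroup.closure (Set.range (finSimple b)) :=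
      Subgroup.subset_closure ⟨⟨j, hj⟩, rfl⟩
    exact mul_mem (mul_mem hj' h) (inv_mem hj')

theorem closure_finSimple : Subgroup.closure (Set.range (finSimple b)) = ⊤ := by
  rw [eq_top_iff]
  rintro ⟨w, hw⟩ -
  induction hw using Subgroup.closure_induction with
  | mem x hx =>
    obtain ⟨k, rfl⟩ := hx
    exact weylReflection_mem_closure_simple b k
  | one => exact one_mem _
  | mul x y hx hy h1 h2 => exact mul_mem h1 h2
  | inv x hx h1 => exact inv_mem h1

theorem exists_word (w : weylGroup Φ) : ∃ l : List b.support, (l.map (finSimple b)).prod = w := by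
  have hw : w ∈ Subgroup.closure (Set.range (finSimple b)) := by
    rw [closure_finSimple]; exact Subgroup.mem_top w
  induction hw using Subgroup.closure_induction with
  | mem x hx => obtain ⟨i, rfl⟩ := hx; exact ⟨[i], by simp⟩
  | one => exact ⟨[], rfl⟩
  | mul x y hx hy h1 h2 =>
    obtain ⟨l1, rfl⟩ := h1
    obtain ⟨l2, rfl⟩ := h2
    exact ⟨l1 ++ l2, by simp⟩
  | inv x hx h1 =>
    obtain ⟨l, rfl⟩ := h1
    refine ⟨l.reverse, ?_⟩
    rw [List.prod_inv_reverse, List.map_map, List.map_reverse]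
    congr 2

/-- The exchange property. -/
theorem exchange (l : List b.support) (j : b.support)
    (h : ¬ b.IsPos ((l.map (finSimple b)).prod • (j : ι))) :
    ∃ l' : List b.support, l'.length + 1 = l.length ∧
      (l'.map (finSimple b)).prod = (l.map (finSimple b)).prod * finSimple b j := by
  induction l with
  | nil => exact absurd (isPos_simple b j) (by simpa using h)
  | cons i l ih =>
    set w := (l.map (finSimple b)).prod with hw
    rw [List.map_cons, List.prod_cons] at h ⊢
    -- A positive wα_j made negative by s_i must be α_i. Then s_i w = w s_j, and the exchange
    -- deletes the first letter; otherwise it happens further inside the word.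
    by_cases hp : b.IsPos (w • (j : ι))
    · refine ⟨l, rfl, ?_⟩
      rw [mul_smul] at h
      have h1 : w • (j : ι) = i := by
        by_contra hne
        exact h (isPos_reflection b hp i hne)
      have h2 : finSimple b i = w * finSimple b j * w⁻¹ := by
        rw [finSimple, ← h1, coreflection_smul]; rfl
      rw [← hw, h2, inv_mul_cancel_right, mul_assoc, finSimple_mul_self, mul_one]
    · obtain ⟨l', hl, h'⟩ := ih hp
      exact ⟨i :: l', by simp [hl], by rw [List.map_cons, List.prod_cons, h', mul_assoc]⟩

/-- Let j be the last letter of a shortest word for w. If wα_j were positive, the word without j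
would send α_j to a negative root, and the exchange property would produce a shorter word for w. -/
theorem exists_simple_not_isPos {w : weylGroup Φ} (hw : w ≠ 1) :
    ∃ i : b.support, ¬ b.IsPos (w • (i : ι)) := by
  classical
  have hex : ∃ n, ∃ l : List b.support, l.length = n ∧ (l.map (finSimple b)).prod = w := by
    obtain ⟨l, hl⟩ := exists_word b w
    exact ⟨_, l, rfl, hl⟩
  obtain ⟨l, hl, hlw⟩ := Nat.find_spec hex
  rcases List.eq_nil_or_concat' l with rfl | ⟨l1, j, rfl⟩
  · exact absurd hlw.symm hw
  · refine ⟨j, fun hp => ?_⟩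
    have h1 : (l1.map (finSimple b)).prod = w * finSimple b j := by
      rw [← hlw]; simp [mul_assoc, finSimple_mul_self]
    have h2 : ¬ b.IsPos ((l1.map (finSimple b)).prod • (j : ι)) := by
      rw [h1, mul_smul, finSimple_smul_self, smul_negIdx, isPos_negIdx]
      exact not_not.2 hp
    obtain ⟨l', hl', h'⟩ := exchange b l1 j h2
    rw [h1, mul_assoc, finSimple_mul_self, mul_one] at h'
    refine Nat.find_min hex (m := l'.length) ?_ ⟨l', rfl, h'⟩
    rw [← hl, List.length_append, ← hl']; simp

theorem affPos_zero {i : ι} : AffPos b (i, 0) ↔ b.IsPos i := by simp [AffPos]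

theorem affPos_smul_simple (w : weylGroup Φ) (i : b.support) :
    AffPos b (act Φ (finWeyl Φ w) (simpleRoot b (some i))) ↔ b.IsPos (w • (i : ι)) := by
  rw [simpleRoot, act_finWeyl, affPos_zero]

theorem length_finSimple_mul {w : weylGroup Φ} {i : b.support} (h : b.IsPos (w⁻¹ • (i : ι))) :
    length b (finWeyl Φ (finSimple b i * w)) = length b (finWeyl Φ w) + 1 := by
  rw [map_mul, ← simpleReflection_some, length_simpleReflection_mul]
  rwa [← map_inv, affPos_smul_simple]

theorem length_finSimple_mul' {w : weylGroup Φ} {i : b.support} (h : ¬ b.IsPos (w⁻¹ • (i : ι))) :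
    length b (finWeyl Φ (finSimple b i * w)) + 1 = length b (finWeyl Φ w) := by
  rw [map_mul, ← simpleReflection_some, length_simpleReflection_mul']
  rwa [← map_inv, affPos_smul_simple]

/-- Induction on the length of a Weyl group element, by left multiplication with simple
reflections. -/
theorem weyl_induction {p : weylGroup Φ → Prop} (h1 : p 1)
    (hs : ∀ (w : weylGroup Φ) (i : b.support), b.IsPos (w⁻¹ • (i : ι)) → p w →
      p (finSimple b i * w)) (w : weylGroup Φ) : p w := by
  induction hn : length b (finWeyl Φ w) using Nat.strong_induction_on generalizing w with
  | _ n ih =>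
    by_cases hw : w = 1
    · rwa [hw]
    · obtain ⟨i, hi⟩ := exists_simple_not_isPos b (inv_ne_one.2 hw)
      have h2 := length_finSimple_mul' b hi
      have h3 := ih _ (by omega) (finSimple b i * w) rfl
      have h4 := hs (finSimple b i * w) i (by
        rw [mul_inv_rev, finSimple_inv, mul_smul, finSimple_smul_self, smul_negIdx, isPos_negIdx]
        exact hi) h3
      rwa [← mul_assoc, finSimple_mul_self, one_mul] at h4

theorem finWeyl_mem_affineWeylGroup (b : Φ.Base) (w : weylGroup Φ) : finWeyl Φ w ∈ affineWeylGroup Φ := by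
  induction w using weyl_induction b with
  | h1 => rw [map_one]; exact one_mem _
  | hs w i _ h =>
    rw [map_mul]
    refine mul_mem (Subgroup.subset_closure ⟨i, 0, ?_⟩) h
    rw [affineReflection_zero]; rfl

variable {b} {q : Option b.support → ℝ}

/-- Only the gradients matter. Two finite simple reflections with W₀-related roots are conjugate in
W, while a relation with α₀ puts a simple coroot in the W₀-orbit of φ^∨, which is the case covered
by `reduced`. -/
theorem IsReducedParameterSystem.eq_of_act (hq : IsReducedParameterSystem b q)
    {g : ExtAffineWeyl Φ} {i j : Option b.support}
    (h : act Φ g (simpleRoot b j) = simpleRoot b i ∨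
      act Φ g (simpleRoot b j) = affNeg Φ (simpleRoot b i)) : q i = q j := by
  have h1 : ∃ w : weylGroup Φ, w • (simpleRoot b j).1 = (simpleRoot b i).1 := by
    rcases h with h | h
    · exact ⟨g.right, congrArg Prod.fst h⟩
    · refine ⟨weylReflection Φ (simpleRoot b i).1 * g.right, ?_⟩
      have : g.right • (simpleRoot b j).1 = negIdx Φ (simpleRoot b i).1 := congrArg Prod.fst h
      rw [mul_smul, this, smul_negIdx, weylReflection_smul]
      exact negIdx_negIdx Φ _
  obtain ⟨w, hw⟩ := h1
  cases i with
  | none => cases j with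
    | none => rfl
    | some j =>
      refine hq.reduced j ⟨(weylReflection Φ j) * w⁻¹, ?_⟩
      have h2 : w⁻¹ • highestRoot b = negIdx Φ j := by
        rw [inv_smul_eq_iff, smul_negIdx]
        change _ = negIdx Φ (w • (simpleRoot b (some j)).1)
        rw [hw]; exact (negIdx_negIdx Φ _).symm
      rw [← coroot_smul, mul_smul, h2, smul_negIdx, weylReflection_smul]
      exact congrArg _ (negIdx_negIdx Φ _)
  | some i => cases j with
    | none =>
      refine (hq.reduced i ⟨weylReflection Φ i * w, ?_⟩).symm
      have h2 : w • highestRoot b = negIdx Φ i := by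
        rw [← negIdx_negIdx Φ (highestRoot b), smul_negIdx]
        exact congrArg _ hw
      rw [← coroot_smul, mul_smul, h2, smul_negIdx, weylReflection_smul]
      exact congrArg _ (negIdx_negIdx Φ _)
    | some j =>
      refine (hq.conj (some j) (some i) ⟨finWeyl Φ w, finWeyl_mem_affineWeylGroup b w, ?_⟩).symm
      rw [simpleReflection_some, simpleReflection_some, ← map_inv, ← map_mul, ← map_mul]
      have : w • (j : ι) = i := hw
      rw [finSimple, finSimple, ← this, coreflection_smul]

end WeylWords

/-! ### The ℓ¹-norm and bounded operators. -/

section SumNorm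

variable {G : Type*}

/-- The `ℓ¹`-norm of a finitely supported function. -/
def sumNorm (e : G →₀ ℂ) : ℝ := e.sum fun _ c => ‖c‖

theorem sumNorm_nonneg (e : G →₀ ℂ) : 0 ≤ sumNorm e :=
  Finset.sum_nonneg fun _ _ => norm_nonneg _

theorem sumNorm_add_le (e f : G →₀ ℂ) : sumNorm (e + f) ≤ sumNorm e + sumNorm f := by
  classical
  have h : ∀ a : G →₀ ℂ, a.support ⊆ e.support ∪ f.support →
      sumNorm a = ∑ g ∈ e.support ∪ f.support, ‖a g‖ := fun a ha =>
    Finsupp.sum_of_support_subset a ha _ (by simp)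
  rw [h e Finset.subset_union_left, h f Finset.subset_union_right, h (e + f) Finsupp.support_add,
    ← Finset.sum_add_distrib]
  exact Finset.sum_le_sum fun g _ => norm_add_le _ _

theorem sumNorm_smul (c : ℂ) (e : G →₀ ℂ) : sumNorm (c • e) = ‖c‖ * sumNorm e := by
  rw [sumNorm, Finsupp.sum_smul_index fun _ => norm_zero, sumNorm, Finsupp.mul_sum]
  simp only [norm_mul]

theorem sumNorm_single (g : G) (c : ℂ) : sumNorm (Finsupp.single g c) = ‖c‖ :=
  Finsupp.sum_single_index norm_zero

theorem norm_apply_le_sumNorm (e : G →₀ ℂ) (g : G) : ‖e g‖ ≤ sumNorm e := by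
  by_cases h : g ∈ e.support
  · exact Finset.single_le_sum (f := fun g => ‖e g‖) (fun _ _ => norm_nonneg _) h
  · rw [Finsupp.notMem_support_iff.1 h, norm_zero]; exact sumNorm_nonneg e

/-- Boundedness of an operator for the `ℓ¹`-norm. -/
def IsSumBounded (A : Module.End ℂ (G →₀ ℂ)) : Prop := ∃ C, ∀ e, sumNorm (A e) ≤ C * sumNorm e

theorem isSumBounded_of_single {A : Module.End ℂ (G →₀ ℂ)} {C : ℝ}
    (h : ∀ g, sumNorm (A (Finsupp.single g 1)) ≤ C) : IsSumBounded A := by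
  refine ⟨C, fun e => ?_⟩
  have hC : ∀ e : G →₀ ℂ, ∀ s : Finset G, sumNorm (A (∑ g ∈ s, Finsupp.single g (e g))) ≤
      C * ∑ g ∈ s, ‖e g‖ := by
    intro e s
    classical
    induction s using Finset.induction_on with
    | empty => simp [sumNorm]
    | insert g s hg ih =>
      rw [Finset.sum_insert hg, Finset.sum_insert hg, map_add, mul_add]
      refine (sumNorm_add_le _ _).trans (add_le_add ?_ ih)
      rw [← mul_one (e g), ← smul_eq_mul, ← Finsupp.smul_single, map_smul, sumNorm_smul, smul_eq_mul,
        mul_one, mul_comm]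
      exact mul_le_mul_of_nonneg_right (h g) (norm_nonneg _)
  have h1 := hC e e.support
  have h2 : ∑ g ∈ e.support, Finsupp.single g (e g) = e := Finsupp.sum_single e
  rwa [h2] at h1

theorem IsSumBounded.mul {A B : Module.End ℂ (G →₀ ℂ)} (hA : IsSumBounded A)
    (hB : IsSumBounded B) : IsSumBounded (A * B) := by
  obtain ⟨C, hC⟩ := hA
  obtain ⟨D, hD⟩ := hB
  refine ⟨|C| * |D|, fun e => ?_⟩
  calc sumNorm (A (B e)) ≤ C * sumNorm (B e) := hC _
    _ ≤ |C| * sumNorm (B e) := mul_le_mul_of_nonneg_right (le_abs_self C) (sumNorm_nonneg _)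
    _ ≤ |C| * (|D| * sumNorm e) := mul_le_mul_of_nonneg_left ((hD e).trans
        (mul_le_mul_of_nonneg_right (le_abs_self D) (sumNorm_nonneg _))) (abs_nonneg C)
    _ = _ := by ring

theorem IsSumBounded.add {A B : Module.End ℂ (G →₀ ℂ)} (hA : IsSumBounded A)
    (hB : IsSumBounded B) : IsSumBounded (A + B) := by
  obtain ⟨C, hC⟩ := hA
  obtain ⟨D, hD⟩ := hB
  refine ⟨C + D, fun e => ?_⟩
  rw [add_mul]
  exact (sumNorm_add_le _ _).trans (add_le_add (hC e) (hD e))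

theorem isSumBounded_algebraMap (c : ℂ) :
    IsSumBounded (algebraMap ℂ (Module.End ℂ (G →₀ ℂ)) c) :=
  ⟨‖c‖, fun e => by rw [Module.algebraMap_end_apply, sumNorm_smul]⟩

end SumNorm

/-! ### Commuting left and right operators on the regular representation. -/

section RegularRepresentation

variable [Finite ι] [Nonempty ι] {Φ : RootPairing ι ℝ M N} (b : Φ.Base) [Φ.IsCrystallographic]
  [Φ.IsReduced] [Φ.IsIrreducible]

/-- Induction on the length, multiplying with simple reflections on the right. -/
theorem right_induction {p : ExtAffineWeyl Φ → Prop} (h0 : ∀ g, length b g = 0 → p g)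
    (hs : ∀ g j, AffPos b (act Φ g (simpleRoot b j)) → p g → p (g * simpleReflection b j))
    (g : ExtAffineWeyl Φ) : p g := by
  induction hn : length b g using Nat.strong_induction_on generalizing g with
  | _ n ih =>
    by_cases hg : length b g = 0
    · exact h0 g hg
    · obtain ⟨j, hj⟩ := exists_simple_of_length_ne_zero b hg
      have h1 := length_mul_simpleReflection' b hj
      have h2 := hs (g * simpleReflection b j) j (by
        rwa [act_mul, act_simpleReflection_self, act_affNeg, affPos_affNeg])
        (ih _ (by omega) _ rfl)
      rwa [mul_assoc, simpleReflection_mul_self, mul_one] at h2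

/-- Induction on the length, multiplying with simple reflections on the left. -/
theorem left_induction {p : ExtAffineWeyl Φ → Prop} (h0 : ∀ g, length b g = 0 → p g)
    (hs : ∀ g j, AffPos b (act Φ g⁻¹ (simpleRoot b j)) → p g → p (simpleReflection b j * g))
    (g : ExtAffineWeyl Φ) : p g := by
  rw [← inv_inv g]
  refine right_induction b (p := fun g => p g⁻¹) (fun g hg => h0 _ (by rwa [length_inv]))
    (fun g j hj h => ?_) g⁻¹
  rw [mul_inv_rev, simpleReflection_inv]
  exact hs _ _ (by rwa [inv_inv]) h

theorem length_mul_simpleReflection_le (g : ExtAffineWeyl Φ) (j : Option b.support) :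
    length b (g * simpleReflection b j) ≤ length b g + 1 := by
  by_cases h : AffPos b (act Φ g (simpleRoot b j))
  · rw [length_mul_simpleReflection b h]
  · have := length_mul_simpleReflection' b h
    omega

theorem length_mul_le (u v : ExtAffineWeyl Φ) : length b (u * v) ≤ length b u + length b v := by
  induction v using right_induction b with
  | h0 v hv => rw [length_mul_of_length_eq_zero' b hv]
  | hs v j hj ih =>
    rw [← mul_assoc, length_mul_simpleReflection b hj]
    exact (length_mul_simpleReflection_le b _ j).trans (by omega)

variable (q : Option b.support → ℝ)

/-- The structure constant `q^{1/2} - q^{-1/2}` of the quadratic relations. -/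
def kappa (j : Option b.support) : ℂ := ((√(q j) - (√(q j))⁻¹ : ℝ) : ℂ)

open Classical in
/-- Left multiplication by `T_{s_j}` on the regular representation. -/
def leftOp (j : Option b.support) : Module.End ℂ (ExtAffineWeyl Φ →₀ ℂ) :=
  Finsupp.linearCombination ℂ fun g => Finsupp.single (simpleReflection b j * g) 1 +
    if AffPos b (act Φ g⁻¹ (simpleRoot b j)) then 0 else kappa b q j • Finsupp.single g 1

open Classical in
/-- Right multiplication by `T_{s_j}` on the regular representation. -/
def rightOp (j : Option b.support) : Module.End ℂ (ExtAffineWeyl Φ →₀ ℂ) :=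
  Finsupp.linearCombination ℂ fun g => Finsupp.single (g * simpleReflection b j) 1 +
    if AffPos b (act Φ g (simpleRoot b j)) then 0 else kappa b q j • Finsupp.single g 1

/-- Left translation. -/
def leftShift (u : ExtAffineWeyl Φ) : Module.End ℂ (ExtAffineWeyl Φ →₀ ℂ) :=
  Finsupp.linearCombination ℂ fun g => Finsupp.single (u * g) 1

/-- Right translation. -/
def rightShift (u : ExtAffineWeyl Φ) : Module.End ℂ (ExtAffineWeyl Φ →₀ ℂ) :=
  Finsupp.linearCombination ℂ fun g => Finsupp.single (g * u) 1

theorem leftOp_pos {j : Option b.support} {g : ExtAffineWeyl Φ}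
    (h : AffPos b (act Φ g⁻¹ (simpleRoot b j))) :
    leftOp b q j (Finsupp.single g 1) = Finsupp.single (simpleReflection b j * g) 1 := by
  simp [leftOp, h]

theorem leftOp_neg {j : Option b.support} {g : ExtAffineWeyl Φ}
    (h : ¬ AffPos b (act Φ g⁻¹ (simpleRoot b j))) :
    leftOp b q j (Finsupp.single g 1) = Finsupp.single (simpleReflection b j * g) 1 +
      kappa b q j • Finsupp.single g 1 := by
  simp only [leftOp, Finsupp.linearCombination_single, h, if_false, one_smul]

theorem rightOp_pos {j : Option b.support} {g : ExtAffineWeyl Φ}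
    (h : AffPos b (act Φ g (simpleRoot b j))) :
    rightOp b q j (Finsupp.single g 1) = Finsupp.single (g * simpleReflection b j) 1 := by
  simp [rightOp, h]

theorem rightOp_neg {j : Option b.support} {g : ExtAffineWeyl Φ}
    (h : ¬ AffPos b (act Φ g (simpleRoot b j))) :
    rightOp b q j (Finsupp.single g 1) = Finsupp.single (g * simpleReflection b j) 1 +
      kappa b q j • Finsupp.single g 1 := by
  simp only [rightOp, Finsupp.linearCombination_single, h, if_false, one_smul]

@[simp] theorem leftShift_single (u g : ExtAffineWeyl Φ) :
    leftShift u (Finsupp.single g 1) = Finsupp.single (u * g) 1 := by simp [leftShift]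

@[simp] theorem rightShift_single (u g : ExtAffineWeyl Φ) :
    rightShift u (Finsupp.single g 1) = Finsupp.single (g * u) 1 := by simp [rightShift]

theorem end_ext {G : Type*} {A B : Module.End ℂ (G →₀ ℂ)}
    (h : ∀ g, A (Finsupp.single g 1) = B (Finsupp.single g 1)) : A = B :=
  Finsupp.lhom_ext' fun g => LinearMap.ext_ring (h g)

theorem commute_leftShift_rightOp {u : ExtAffineWeyl Φ} (hu : length b u = 0)
    (j : Option b.support) : Commute (leftShift u) (rightOp b q j) := by
  refine end_ext fun g => ?_
  simp only [Module.End.mul_apply]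
  have h0 : AffPos b (act Φ (u * g) (simpleRoot b j)) ↔ AffPos b (act Φ g (simpleRoot b j)) := by
    rw [act_mul, (length_eq_zero_iff b).1 hu]
  by_cases h : AffPos b (act Φ g (simpleRoot b j))
  · rw [rightOp_pos b q h, leftShift_single, leftShift_single, rightOp_pos b q (h0.2 h), mul_assoc]
  · rw [rightOp_neg b q h, map_add, map_smul, leftShift_single, leftShift_single,
      rightOp_neg b q (mt h0.1 h), mul_assoc]

theorem commute_leftOp_rightShift {u : ExtAffineWeyl Φ} (hu : length b u = 0)
    (j : Option b.support) : Commute (leftOp b q j) (rightShift u) := by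
  refine end_ext fun g => ?_
  simp only [Module.End.mul_apply]
  have hu' : length b u⁻¹ = 0 := by rwa [length_inv]
  have h0 : AffPos b (act Φ (g * u)⁻¹ (simpleRoot b j)) ↔
      AffPos b (act Φ g⁻¹ (simpleRoot b j)) := by
    rw [mul_inv_rev, act_mul, (length_eq_zero_iff b).1 hu']
  by_cases h : AffPos b (act Φ g⁻¹ (simpleRoot b j))
  · rw [leftOp_pos b q h, rightShift_single, rightShift_single, leftOp_pos b q (h0.2 h), mul_assoc]
  · rw [leftOp_neg b q h, map_add, map_smul, rightShift_single, rightShift_single,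
      leftOp_neg b q (mt h0.1 h), mul_assoc]

theorem commute_leftShift_rightShift (u v : ExtAffineWeyl Φ) :
    Commute (leftShift u) (rightShift v) := by
  refine end_ext fun g => ?_
  simp [mul_assoc]

theorem act_eq_iff {g : ExtAffineWeyl Φ} {a c : ι × ℤ} : act Φ g⁻¹ a = c ↔ a = act Φ g c :=
  ⟨fun h => by rw [← h, act_act_inv], fun h => by rw [h, act_inv_act]⟩

-- This is the associativity of the multiplication to be constructed. If gα_j = ±α_i, then s_i g = g
-- s_j, and the left and right operators agree on the basis vectors of g and g s_j; for the negative
-- sign this needs q_i = q_j. Otherwise s_i does not change the sign of gα_j, nor s_j that of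
-- g⁻¹α_i, and the two orders agree in each of the four sign cases.
variable {q} in
theorem commute_leftOp_rightOp (hq : IsReducedParameterSystem b q) (i j : Option b.support) :
    Commute (leftOp b q i) (rightOp b q j) := by
  refine end_ext fun g => ?_
  simp only [Module.End.mul_apply]
  by_cases hs : act Φ g (simpleRoot b j) = simpleRoot b i ∨
      act Φ g (simpleRoot b j) = affNeg Φ (simpleRoot b i)
  · have hk : kappa b q i = kappa b q j := by rw [kappa, kappa, hq.eq_of_act hs]
    have hc := mul_simpleReflection_eq b hs
    have key : ∀ g : ExtAffineWeyl Φ, (act Φ g (simpleRoot b j) = simpleRoot b i ∨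
        act Φ g (simpleRoot b j) = affNeg Φ (simpleRoot b i)) →
        leftOp b q i (Finsupp.single g 1) = rightOp b q j (Finsupp.single g 1) := by
      intro g hs
      have hc := mul_simpleReflection_eq b hs
      rcases hs with hs | hs
      · have h1 : AffPos b (act Φ g (simpleRoot b j)) := by rw [hs]; exact affPos_simpleRoot b i
        have h2 : AffPos b (act Φ g⁻¹ (simpleRoot b i)) := by
          rw [act_eq_iff.2 hs.symm]; exact affPos_simpleRoot b j
        rw [leftOp_pos b q h2, rightOp_pos b q h1, hc]
      · have h1 : ¬ AffPos b (act Φ g (simpleRoot b j)) := by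
          rw [hs, affPos_affNeg, not_not]; exact affPos_simpleRoot b i
        have h2 : ¬ AffPos b (act Φ g⁻¹ (simpleRoot b i)) := by
          have : act Φ g⁻¹ (simpleRoot b i) = affNeg Φ (simpleRoot b j) := by
            rw [act_eq_iff, act_affNeg, hs, affNeg_affNeg]
          rw [this, affPos_affNeg, not_not]; exact affPos_simpleRoot b j
        rw [leftOp_neg b q h2, rightOp_neg b q h1, hc, hk]
    have hs' : act Φ (g * simpleReflection b j) (simpleRoot b j) = simpleRoot b i ∨
        act Φ (g * simpleReflection b j) (simpleRoot b j) = affNeg Φ (simpleRoot b i) := by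
      rw [act_mul, act_simpleReflection_self, act_affNeg]
      rcases hs with hs | hs
      · right; rw [hs]
      · left; rw [hs, affNeg_affNeg]
    have h1 := key g hs
    have h2 := key _ hs'
    rw [h1]
    by_cases hp : AffPos b (act Φ g (simpleRoot b j))
    · rw [rightOp_pos b q hp, h2]
    · rw [rightOp_neg b q hp, map_add, map_add, map_smul, map_smul, h1, h2]
  · push Not at hs
    have h1 : AffPos b (act Φ (simpleReflection b i * g) (simpleRoot b j)) ↔
        AffPos b (act Φ g (simpleRoot b j)) := by
      rw [act_mul]
      exact affPos_act_simpleReflection_iff b hs.1 hs.2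
    have h2 : AffPos b (act Φ (g * simpleReflection b j)⁻¹ (simpleRoot b i)) ↔
        AffPos b (act Φ g⁻¹ (simpleRoot b i)) := by
      rw [mul_inv_rev, simpleReflection_inv, act_mul]
      refine affPos_act_simpleReflection_iff b (fun h => hs.1 (act_eq_iff.1 h).symm) fun h => hs.2 ?_
      have := act_eq_iff.1 h
      rw [this, act_affNeg, affNeg_affNeg]
    by_cases hp : AffPos b (act Φ g (simpleRoot b j)) <;>
      by_cases hp' : AffPos b (act Φ g⁻¹ (simpleRoot b i))
    · rw [rightOp_pos b q hp, leftOp_pos b q hp', leftOp_pos b q (h2.2 hp'),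
        rightOp_pos b q (h1.2 hp), mul_assoc]
    · rw [rightOp_pos b q hp, leftOp_neg b q hp', leftOp_neg b q (mt h2.1 hp'), map_add, map_smul,
        rightOp_pos b q (h1.2 hp), rightOp_pos b q hp, mul_assoc]
    · rw [rightOp_neg b q hp, leftOp_pos b q hp', map_add, map_smul, leftOp_pos b q (h2.2 hp'),
        rightOp_neg b q (mt h1.1 hp), leftOp_pos b q hp', mul_assoc]
    · rw [rightOp_neg b q hp, leftOp_neg b q hp', map_add, map_add, map_smul, map_smul,
        leftOp_neg b q (mt h2.1 hp'), rightOp_neg b q (mt h1.1 hp), leftOp_neg b q hp',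
        rightOp_neg b q hp, mul_assoc, smul_add, smul_add, smul_comm]
      abel

/-- Operators commuting with all right multiplications. -/
def IsLeftOp (A : Module.End ℂ (ExtAffineWeyl Φ →₀ ℂ)) : Prop :=
  (∀ j, Commute A (rightOp b q j)) ∧ ∀ u, length b u = 0 → Commute A (rightShift u)

theorem isSumBounded_leftOp (j : Option b.support) : IsSumBounded (leftOp b q j) := by
  refine isSumBounded_of_single (C := 1 + ‖kappa b q j‖) fun g => ?_
  by_cases h : AffPos b (act Φ g⁻¹ (simpleRoot b j))
  · rw [leftOp_pos b q h, sumNorm_single, norm_one]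
    linarith [norm_nonneg (kappa b q j)]
  · rw [leftOp_neg b q h]
    refine (sumNorm_add_le _ _).trans ?_
    rw [sumNorm_smul, sumNorm_single, sumNorm_single, norm_one, mul_one]

theorem isSumBounded_leftShift (u : ExtAffineWeyl Φ) : IsSumBounded (leftShift u) :=
  isSumBounded_of_single (C := 1) fun g => by
    rw [leftShift_single, sumNorm_single, norm_one]

-- The operator is a product of simple left operators along a reduced expression ending in an
-- element of length zero. Its boundedness is recorded for the convergence of F_t.
variable {q} in
theorem exists_isLeftOp (hq : IsReducedParameterSystem b q) (u : ExtAffineWeyl Φ) :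
    ∃ A, IsLeftOp b q A ∧ IsSumBounded A ∧ A (Finsupp.single 1 1) = Finsupp.single u 1 := by
  induction u using left_induction b with
  | h0 u hu =>
    exact ⟨leftShift u, ⟨fun j => commute_leftShift_rightOp b q hu j,
      fun v _ => commute_leftShift_rightShift u v⟩, isSumBounded_leftShift u, by simp⟩
  | hs u j hj ih =>
    obtain ⟨A, ⟨hA, hA'⟩, hAb, hA1⟩ := ih
    refine ⟨leftOp b q j * A, ⟨fun i => (commute_leftOp_rightOp b hq j i).mul_left (hA i),
      fun v hv => (commute_leftOp_rightShift b q hv j).mul_left (hA' v hv)⟩,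
      (isSumBounded_leftOp b q j).mul hAb, ?_⟩
    rw [Module.End.mul_apply, hA1, leftOp_pos b q hj]

/-- The basis vector of v comes from that of 1 by right operators, which commute with A. Additivity
of the length keeps every intermediate product increasing, so no quadratic term appears. -/
theorem IsLeftOp.apply_single {A : Module.End ℂ (ExtAffineWeyl Φ →₀ ℂ)} (hA : IsLeftOp b q A)
    {u v : ExtAffineWeyl Φ} (h1 : A (Finsupp.single 1 1) = Finsupp.single u 1)
    (h : length b (u * v) = length b u + length b v) :
    A (Finsupp.single v 1) = Finsupp.single (u * v) 1 := by
  induction v using right_induction b with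
  | h0 v hv =>
    have h2 := LinearMap.congr_fun (hA.2 v hv) (Finsupp.single 1 1)
    simpa [h1] using h2
  | hs v j hj ih =>
    rw [length_mul_simpleReflection b hj, ← mul_assoc] at h
    have h3 := length_mul_le b u v
    have h4 := length_mul_simpleReflection_le b (u * v) j
    have h5 := ih (by omega)
    have h6 : AffPos b (act Φ (u * v) (simpleRoot b j)) := by
      by_contra h6
      have := length_mul_simpleReflection' b h6
      omega
    have h2 := LinearMap.congr_fun (hA.1 j) (Finsupp.single v 1)
    simp only [Module.End.mul_apply] at h2
    rw [rightOp_pos b q hj, h5, rightOp_pos b q h6] at h2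
    rw [h2, mul_assoc]

end RegularRepresentation

/-! ### The T_w form a basis of ℋ. -/

section HeckeBasis

variable [Finite ι] [Nonempty ι] {Φ : RootPairing ι ℝ M N} {b : Φ.Base} [Φ.IsCrystallographic]
  [Φ.IsReduced] [Φ.IsIrreducible] {q : Option b.support → ℝ}

theorem T_one : T b q 1 = 1 := by
  rw [T, RingQuot.mkAlgHom_rel ℂ (HeckeRel.one (b := b) (q := q)), map_one]

theorem T_mul {u v : ExtAffineWeyl Φ} (h : length b (u * v) = length b u + length b v) :
    T b q u * T b q v = T b q (u * v) := by
  rw [T, T, T, ← map_mul, RingQuot.mkAlgHom_rel ℂ (HeckeRel.mul u v h)]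

theorem T_mul_simple_pos {w : ExtAffineWeyl Φ} {j : Option b.support}
    (h : AffPos b (act Φ w (simpleRoot b j))) :
    T b q w * T b q (simpleReflection b j) = T b q (w * simpleReflection b j) :=
  T_mul (by rw [length_mul_simpleReflection b h, length_simpleReflection])

theorem T_mul_simple_neg {w : ExtAffineWeyl Φ} {j : Option b.support}
    (h : ¬ AffPos b (act Φ w (simpleRoot b j))) :
    T b q w * T b q (simpleReflection b j) =
      T b q (w * simpleReflection b j) + kappa b q j • T b q w := by
  rw [T, T, T, ← map_mul,
    RingQuot.mkAlgHom_rel ℂ (HeckeRel.quadratic w j (length_mul_simpleReflection' b h)), map_add,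
    map_smul]
  rfl

theorem T_simple_sq (j : Option b.support) :
    T b q (simpleReflection b j) * T b q (simpleReflection b j) =
      1 + kappa b q j • T b q (simpleReflection b j) := by
  rw [T_mul_simple_neg, simpleReflection_mul_self, T_one]
  rw [act_simpleReflection_self, affPos_affNeg, not_not]
  exact affPos_simpleRoot b j

theorem T_simple_mul_pos {w : ExtAffineWeyl Φ} {j : Option b.support}
    (h : AffPos b (act Φ w⁻¹ (simpleRoot b j))) :
    T b q (simpleReflection b j) * T b q w = T b q (simpleReflection b j * w) :=
  T_mul (by rw [length_simpleReflection_mul b h, length_simpleReflection, add_comm])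

/-- The relations give only the right-handed version; this one follows by writing w = s_j (s_j w)
with lengths adding and using the quadratic relation for T_{s_j}. -/
theorem T_simple_mul_neg {w : ExtAffineWeyl Φ} {j : Option b.support}
    (h : ¬ AffPos b (act Φ w⁻¹ (simpleRoot b j))) :
    T b q (simpleReflection b j) * T b q w =
      T b q (simpleReflection b j * w) + kappa b q j • T b q w := by
  have h1 : AffPos b (act Φ (simpleReflection b j * w)⁻¹ (simpleRoot b j)) := by
    rwa [mul_inv_rev, simpleReflection_inv, act_mul, act_simpleReflection_self, act_affNeg,
      affPos_affNeg]
  have h2 := T_simple_mul_pos (q := q) h1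
  rw [← mul_assoc, simpleReflection_mul_self, one_mul] at h2
  rw [← h2, ← mul_assoc, T_simple_sq, add_mul, one_mul, smul_mul_assoc, h2]

theorem T_simple_mul_inv (j : Option b.support) :
    T b q (simpleReflection b j) * (T b q (simpleReflection b j) - algebraMap ℂ _ (kappa b q j)) = 1 := by
  rw [mul_sub, T_simple_sq, ← Algebra.commutes, ← Algebra.smul_def, add_sub_cancel_right]

theorem T_simple_inv_mul (j : Option b.support) :
    (T b q (simpleReflection b j) - algebraMap ℂ _ (kappa b q j)) * T b q (simpleReflection b j) = 1 := by
  rw [sub_mul, T_simple_sq, ← Algebra.smul_def, add_sub_cancel_right]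

theorem isUnit_T (w : ExtAffineWeyl Φ) : IsUnit (T b q w) := by
  induction w using right_induction b with
  | h0 g hg =>
    have hg' : length b g⁻¹ = 0 := by rwa [length_inv]
    refine ⟨⟨T b q g, T b q g⁻¹, ?_, ?_⟩, rfl⟩
    · rw [T_mul (length_mul_of_length_eq_zero b hg), mul_inv_cancel, T_one]
    · rw [T_mul (length_mul_of_length_eq_zero b hg'), inv_mul_cancel, T_one]
  | hs g j hj ih =>
    rw [← T_mul_simple_pos hj]
    exact ih.mul ⟨⟨_, _, T_simple_mul_inv j, T_simple_inv_mul j⟩, rfl⟩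

theorem span_T_mul_T (u v : ExtAffineWeyl Φ) :
    T b q u * T b q v ∈ Submodule.span ℂ (Set.range (T b q)) := by
  have hS : ∀ j, ∀ x ∈ Submodule.span ℂ (Set.range (T b q)),
      x * T b q (simpleReflection b j) ∈ Submodule.span ℂ (Set.range (T b q)) := by
    intro j x hx
    induction hx using Submodule.span_induction with
    | mem y hy =>
      obtain ⟨w, rfl⟩ := hy
      by_cases h : AffPos b (act Φ w (simpleRoot b j))
      · rw [T_mul_simple_pos h]; exact Submodule.subset_span ⟨_, rfl⟩
      · rw [T_mul_simple_neg h]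
        exact add_mem (Submodule.subset_span ⟨_, rfl⟩)
          (Submodule.smul_mem _ _ (Submodule.subset_span ⟨_, rfl⟩))
    | zero => rw [zero_mul]; exact zero_mem _
    | add y z _ _ hy hz => rw [add_mul]; exact add_mem hy hz
    | smul a y _ hy => rw [smul_mul_assoc]; exact Submodule.smul_mem _ _ hy
  induction v using right_induction b with
  | h0 v hv =>
    rw [T_mul (length_mul_of_length_eq_zero' b hv)]; exact Submodule.subset_span ⟨_, rfl⟩
  | hs v j hj ih =>
    rw [← T_mul_simple_pos hj, ← mul_assoc]
    exact hS j _ ih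

theorem mem_span_T (h : Hecke b q) : h ∈ Submodule.span ℂ (Set.range (T b q)) := by
  obtain ⟨x, rfl⟩ := RingQuot.mkAlgHom_surjective ℂ (HeckeRel b q) h
  have key : ∀ s ∈ Submodule.span ℂ (Set.range (T b q)),
      s * RingQuot.mkAlgHom ℂ (HeckeRel b q) x ∈ Submodule.span ℂ (Set.range (T b q)) := by
    induction x using FreeAlgebra.induction with
    | grade0 r =>
      intro s hs
      rw [AlgHom.commutes, ← Algebra.commutes, ← Algebra.smul_def]
      exact Submodule.smul_mem _ _ hs
    | grade1 v =>
      intro s hs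
      induction hs using Submodule.span_induction with
      | mem y hy => obtain ⟨w, rfl⟩ := hy; exact span_T_mul_T w v
      | zero => rw [zero_mul]; exact zero_mem _
      | add y z _ _ hy hz => rw [add_mul]; exact add_mem hy hz
      | smul a y _ hy => rw [smul_mul_assoc]; exact Submodule.smul_mem _ _ hy
    | mul x y hx hy => intro s hs; rw [map_mul, ← mul_assoc]; exact hy _ (hx s hs)
    | add x y hx hy => intro s hs; rw [map_add, mul_add]; exact add_mem (hx s hs) (hy s hs)
  have := key 1 (by rw [← T_one]; exact Submodule.subset_span ⟨1, rfl⟩)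
  rwa [one_mul] at this

theorem hecke_induction {p : Hecke b q → Prop} (hT : ∀ w, p (T b q w)) (hz : p 0)
    (ha : ∀ x y, p x → p y → p (x + y)) (hs : ∀ (c : ℂ) x, p x → p (c • x)) (h : Hecke b q) :
    p h := by
  induction mem_span_T h using Submodule.span_induction with
  | mem y hy => obtain ⟨w, rfl⟩ := hy; exact hT w
  | zero => exact hz
  | add y z _ _ hy hz => exact ha y z hy hz
  | smul a y _ hy => exact hs a y hy

variable (hq : IsReducedParameterSystem b q)

/-- The operator of left multiplication by `T_u` on the regular representation. -/
def regOp (u : ExtAffineWeyl Φ) : Module.End ℂ (ExtAffineWeyl Φ →₀ ℂ) :=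
  (exists_isLeftOp b hq u).choose

theorem isLeftOp_regOp (u : ExtAffineWeyl Φ) : IsLeftOp b q (regOp hq u) :=
  (exists_isLeftOp b hq u).choose_spec.1

theorem isSumBounded_regOp (u : ExtAffineWeyl Φ) : IsSumBounded (regOp hq u) :=
  (exists_isLeftOp b hq u).choose_spec.2.1

theorem regOp_one (u : ExtAffineWeyl Φ) :
    regOp hq u (Finsupp.single 1 1) = Finsupp.single u 1 :=
  (exists_isLeftOp b hq u).choose_spec.2.2

/-- All basis vectors arise from that of 1 by right operators. Hence the Hecke relations for left
multiplications need to be checked on one vector only. -/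
theorem IsLeftOp.ext {A B : Module.End ℂ (ExtAffineWeyl Φ →₀ ℂ)} (hA : IsLeftOp b q A)
    (hB : IsLeftOp b q B) (h : A (Finsupp.single 1 1) = B (Finsupp.single 1 1)) : A = B := by
  refine end_ext fun g => ?_
  induction g using right_induction b with
  | h0 v hv =>
    have h1 := LinearMap.congr_fun (hA.2 v hv) (Finsupp.single 1 1)
    have h2 := LinearMap.congr_fun (hB.2 v hv) (Finsupp.single 1 1)
    simp only [Module.End.mul_apply, rightShift_single, one_mul] at h1 h2
    rw [h1, h2, h]
  | hs v j hj ih =>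
    have h1 := LinearMap.congr_fun (hA.1 j) (Finsupp.single v 1)
    have h2 := LinearMap.congr_fun (hB.1 j) (Finsupp.single v 1)
    simp only [Module.End.mul_apply, rightOp_pos b q hj] at h1 h2
    rw [h1, h2, ih]

theorem IsLeftOp.mul {A B : Module.End ℂ (ExtAffineWeyl Φ →₀ ℂ)} (hA : IsLeftOp b q A)
    (hB : IsLeftOp b q B) : IsLeftOp b q (A * B) :=
  ⟨fun j => (hA.1 j).mul_left (hB.1 j), fun u hu => (hA.2 u hu).mul_left (hB.2 u hu)⟩

theorem IsLeftOp.add {A B : Module.End ℂ (ExtAffineWeyl Φ →₀ ℂ)} (hA : IsLeftOp b q A)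
    (hB : IsLeftOp b q B) : IsLeftOp b q (A + B) :=
  ⟨fun j => (hA.1 j).add_left (hB.1 j), fun u hu => (hA.2 u hu).add_left (hB.2 u hu)⟩

theorem IsLeftOp.smul {A : Module.End ℂ (ExtAffineWeyl Φ →₀ ℂ)} (c : ℂ) (hA : IsLeftOp b q A) :
    IsLeftOp b q (c • A) :=
  ⟨fun j => (hA.1 j).smul_left c, fun u hu => (hA.2 u hu).smul_left c⟩

/-- The regular representation. -/
def regRep : Hecke b q →ₐ[ℂ] Module.End ℂ (ExtAffineWeyl Φ →₀ ℂ) :=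
  RingQuot.liftAlgHom ℂ ⟨FreeAlgebra.lift ℂ (regOp hq), by
    rintro _ _ (_ | ⟨u, v, h⟩ | ⟨w, i, h⟩)
    · rw [FreeAlgebra.lift_ι_apply, map_one]
      refine (isLeftOp_regOp hq 1).ext ⟨fun _ => Commute.one_left _, fun _ _ => Commute.one_left _⟩ ?_
      rw [regOp_one, Module.End.one_apply]
    · rw [map_mul, FreeAlgebra.lift_ι_apply, FreeAlgebra.lift_ι_apply, FreeAlgebra.lift_ι_apply]
      refine ((isLeftOp_regOp hq u).mul (isLeftOp_regOp hq v)).ext (isLeftOp_regOp hq _) ?_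
      rw [Module.End.mul_apply, regOp_one, regOp_one,
        (isLeftOp_regOp hq u).apply_single b q (regOp_one hq u) h]
    · rw [map_mul, map_add, map_smul, FreeAlgebra.lift_ι_apply, FreeAlgebra.lift_ι_apply,
        FreeAlgebra.lift_ι_apply]
      refine ((isLeftOp_regOp hq w).mul (isLeftOp_regOp hq _)).ext
        ((isLeftOp_regOp hq _).add ((isLeftOp_regOp hq _).smul _)) ?_
      have hn : ¬ AffPos b (act Φ w (simpleRoot b i)) := fun hp => by
        rw [length_mul_simpleReflection b hp] at h
        omega
      have hp : AffPos b (act Φ (1 : ExtAffineWeyl Φ) (simpleRoot b i)) := by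
        rw [act_one]; exact affPos_simpleRoot b i
      have h1 := LinearMap.congr_fun ((isLeftOp_regOp hq w).1 i) (Finsupp.single 1 1)
      simp only [Module.End.mul_apply] at h1
      rw [rightOp_pos b q hp, one_mul, regOp_one, rightOp_neg b q hn] at h1
      rw [Module.End.mul_apply, regOp_one, h1, LinearMap.add_apply, LinearMap.smul_apply,
        regOp_one, regOp_one]
      rfl⟩

theorem regRep_T (u : ExtAffineWeyl Φ) : regRep hq (T b q u) = regOp hq u := by
  rw [regRep, T, RingQuot.liftAlgHom_mkAlgHom_apply, FreeAlgebra.lift_ι_apply]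

/-- The coefficients with respect to the `T_w`. -/
def heckeCoeff : Hecke b q →ₗ[ℂ] (ExtAffineWeyl Φ →₀ ℂ) where
  toFun h := regRep hq h (Finsupp.single 1 1)
  map_add' x y := by rw [map_add]; rfl
  map_smul' c x := by rw [map_smul]; rfl

theorem heckeCoeff_T (u : ExtAffineWeyl Φ) : heckeCoeff hq (T b q u) = Finsupp.single u 1 := by
  change regRep hq (T b q u) (Finsupp.single 1 1) = _
  rw [regRep_T, regOp_one]

/-- Acting on the basis vector of 1, the T_u give distinct basis vectors of the regular
representation. -/
theorem linearIndependent_T (hq : IsReducedParameterSystem b q) : LinearIndependent ℂ (T b q) := by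
  refine LinearIndependent.of_comp (heckeCoeff hq) ?_
  have : (heckeCoeff hq : Hecke b q → _) ∘ T b q = fun u => Finsupp.single u 1 :=
    funext fun u => heckeCoeff_T hq u
  rw [this]
  exact Finsupp.linearIndependent_single_one ℂ _

/-- The `ℓ¹`-norm on the Hecke algebra. -/
def heckeNorm (h : Hecke b q) : ℝ := sumNorm (heckeCoeff hq h)

theorem isSumBounded_regRep (h : Hecke b q) : IsSumBounded (regRep hq h) := by
  induction h using hecke_induction with
  | hT w => rw [regRep_T]; exact isSumBounded_regOp hq w
  | hz => rw [map_zero]; exact ⟨0, fun e => by simp [sumNorm]⟩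
  | ha x y hx hy => rw [map_add]; exact hx.add hy
  | hs c x hx => rw [map_smul, Algebra.smul_def]; exact (isSumBounded_algebraMap c).mul hx

theorem exists_heckeNorm_mul_le (h : Hecke b q) :
    ∃ C, 0 ≤ C ∧ ∀ x, heckeNorm hq (h * x) ≤ C * heckeNorm hq x := by
  obtain ⟨C, hC⟩ := isSumBounded_regRep hq h
  refine ⟨|C|, abs_nonneg C, fun x => ?_⟩
  have : heckeCoeff hq (h * x) = regRep hq h (heckeCoeff hq x) := by
    change regRep hq (h * x) _ = _
    rw [map_mul]; rfl
  rw [heckeNorm, this]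
  exact (hC _).trans (mul_le_mul_of_nonneg_right (le_abs_self C) (sumNorm_nonneg _))

end HeckeBasis

/-! ### The canonical trace. -/

section Trace

variable [Finite ι] [Nonempty ι] {Φ : RootPairing ι ℝ M N} {b : Φ.Base} [Φ.IsCrystallographic]
  [Φ.IsReduced] [Φ.IsIrreducible] {q : Option b.support → ℝ} (hq : IsReducedParameterSystem b q)

open Classical in
theorem Tr_T (hq : IsReducedParameterSystem b q) (w : ExtAffineWeyl Φ) :
    Tr b q (T b q w) = if w = 1 then 1 else 0 := by
  have h : ∃ τ : Hecke b q →ₗ[ℂ] ℂ, ∀ w, τ (T b q w) = if w = 1 then 1 else 0 :=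
    ⟨Finsupp.lapply 1 ∘ₗ heckeCoeff hq, fun w => by
      rw [LinearMap.comp_apply, heckeCoeff_T, Finsupp.lapply_apply, Finsupp.single_apply]⟩
  have h2 : Tr b q = h.choose := dif_pos h
  rw [h2]
  exact h.choose_spec w

theorem Tr_eq (h : Hecke b q) : Tr b q h = heckeCoeff hq h 1 := by
  classical
  induction h using hecke_induction with
  | hT w => rw [Tr_T hq, heckeCoeff_T, Finsupp.single_apply]
  | hz => simp
  | ha x y hx hy => rw [map_add, map_add, hx, hy]; rfl
  | hs c x hx => rw [map_smul, map_smul, hx]; rfl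

theorem norm_Tr_le (h : Hecke b q) : ‖Tr b q h‖ ≤ heckeNorm hq h := by
  rw [Tr_eq hq]; exact norm_apply_le_sumNorm _ _

-- Move one simple factor at a time from u to v. A quadratic term contributes Tr(T_u T_v), which
-- could be nonzero only for u = v⁻¹; but uα_j is positive and v⁻¹α_j is negative. The criterion is
-- symmetric in u and v, which makes `Tr` a trace.
open Classical in
theorem Tr_T_mul_T (hq : IsReducedParameterSystem b q) (u v : ExtAffineWeyl Φ) :
    Tr b q (T b q u * T b q v) = if u * v = 1 then 1 else 0 := by
  induction u using right_induction b generalizing v with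
  | h0 u hu => rw [T_mul (length_mul_of_length_eq_zero b hu), Tr_T hq]
  | hs u j hj ih =>
    rw [← T_mul_simple_pos hj, mul_assoc]
    by_cases h : AffPos b (act Φ v⁻¹ (simpleRoot b j))
    · rw [T_simple_mul_pos h, ih, mul_assoc]
    · have huv : u * v ≠ 1 := fun h1 => h (by rwa [← eq_inv_of_mul_eq_one_left h1])
      rw [T_simple_mul_neg h, mul_add, map_add, ih, mul_smul_comm, map_smul, ih, if_neg huv,
        smul_zero, add_zero, mul_assoc]

theorem Tr_mul_comm (hq : IsReducedParameterSystem b q) (x y : Hecke b q) :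
    Tr b q (x * y) = Tr b q (y * x) := by
  classical
  induction x using hecke_induction with
  | hT u =>
    induction y using hecke_induction with
    | hT v =>
      rw [Tr_T_mul_T hq, Tr_T_mul_T hq]
      simp only [mul_eq_one_comm (a := u)]
    | hz => simp
    | ha x y hx hy => rw [mul_add, add_mul, map_add, map_add, hx, hy]
    | hs c x hx => rw [mul_smul_comm, smul_mul_assoc, map_smul, map_smul, hx]
  | hz => simp
  | ha x y hx hy => rw [mul_add, add_mul, map_add, map_add, hx, hy]
  | hs c x hx => rw [mul_smul_comm, smul_mul_assoc, map_smul, map_smul, hx]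

end Trace

/-! ### Dominant translations and the elements x^μ. -/

section DominantTranslations

variable [Finite ι] [Nonempty ι] {Φ : RootPairing ι ℝ M N} {b : Φ.Base} [Φ.IsCrystallographic]
  [Φ.IsReduced] [Φ.IsIrreducible]

theorem AffPos.snd_nonneg {a : ι × ℤ} (h : AffPos b a) : 0 ≤ a.2 := by
  rcases h with h | ⟨h, -⟩
  · exact h.le
  · exact h.ge

theorem not_affPos_of_neg {a : ι × ℤ} (h : a.2 < 0) : ¬ AffPos b a := fun h' =>
  absurd (AffPos.snd_nonneg h') (not_le.2 h)

/-- What matters is that the constant becomes strictly negative: then neither an element of W₀ nor a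
further dominant translation can make the affine root positive again, so lengths add. -/
theorem isPos_and_neg_of_translation {μ : coweightLattice Φ} (hμ : IsDominant b μ) {a : ι × ℤ}
    (ha : AffPos b a) (h : ¬ AffPos b (act Φ (translation Φ μ) a)) :
    b.IsPos a.1 ∧ a.2 - pair Φ a.1 μ < 0 := by
  rw [act_translation] at h
  have hp : b.IsPos a.1 := by
    by_contra hp
    have h1 := pair_nonneg_of_isPos b ((isPos_negIdx b _).2 hp) hμ
    rw [pair_negIdx] at h1
    rcases ha with h2 | ⟨-, h2⟩
    · exact h (Or.inl (by simp only; linarith))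
    · exact hp h2
  refine ⟨hp, ?_⟩
  by_contra! h1
  rcases h1.lt_or_eq with h2 | h2
  · exact h (Or.inl h2)
  · exact h (Or.inr ⟨h2.symm, hp⟩)

theorem length_translation_add {μ ν : coweightLattice Φ} (hμ : IsDominant b μ)
    (hν : IsDominant b ν) : length b (translation Φ μ * translation Φ ν) =
      length b (translation Φ μ) + length b (translation Φ ν) := by
  refine length_mul_of_forall b fun a h1 h2 => ?_
  obtain ⟨hp, hn⟩ := isPos_and_neg_of_translation hν h1 h2
  refine not_affPos_of_neg ?_
  rw [act_translation, act_translation]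
  have := pair_nonneg_of_isPos b hp hμ
  simp only
  linarith

theorem length_finWeyl_mul_translation (w : weylGroup Φ) {μ : coweightLattice Φ}
    (hμ : IsDominant b μ) : length b (finWeyl Φ w * translation Φ μ) =
      length b (finWeyl Φ w) + length b (translation Φ μ) := by
  refine length_mul_of_forall b fun a h1 h2 => ?_
  obtain ⟨hp, hn⟩ := isPos_and_neg_of_translation hμ h1 h2
  refine not_affPos_of_neg ?_
  rwa [act_finWeyl, act_translation]

theorem IsDominant.add {μ ν : coweightLattice Φ} (hμ : IsDominant b μ) (hν : IsDominant b ν) :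
    IsDominant b (μ + ν) := (isDominant_iff b).2 fun j => by
  rw [map_add]
  exact add_nonneg ((isDominant_iff b).1 hμ j) ((isDominant_iff b).1 hν j)

theorem isDominant_zero : IsDominant b 0 := (isDominant_iff b).2 fun j => by simp

variable {q : Option b.support → ℝ}

theorem T_translation_mul {μ ν : coweightLattice Φ} (hμ : IsDominant b μ)
    (hν : IsDominant b ν) : T b q (translation Φ μ) * T b q (translation Φ ν) =
      T b q (translation Φ (μ + ν)) := by
  rw [T_mul (length_translation_add hμ hν), translation_add]

/-- This is independence of the chosen decomposition in a form without inverses. It follows from the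
commutativity of the T of dominant translations after multiplying by an invertible one. -/
theorem x_mul_T {μ ν : coweightLattice Φ} (hμ : IsDominant b μ) (hν : IsDominant b ν) :
    x b q (μ - ν) * T b q (translation Φ ν) = T b q (translation Φ μ) := by
  obtain ⟨h1, h2, h3⟩ := (exists_dominant_sub b (μ - ν)).choose_spec
  set p := (exists_dominant_sub b (μ - ν)).choose
  have hx : x b q (μ - ν) = T b q (translation Φ p.1) *
    Ring.inverse (T b q (translation Φ p.2)) := rfl
  have hu := isUnit_T (q := q) (translation Φ p.2)
  rw [← hu.mul_left_inj, mul_assoc, T_translation_mul hν h2, add_comm, ← T_translation_mul h2 hν, hx,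
    mul_assoc, ← mul_assoc (Ring.inverse _), Ring.inverse_mul_cancel _ hu, one_mul,
    T_translation_mul h1 hν, T_translation_mul hμ h2]
  congr 2
  have : μ = p.1 - p.2 + ν := by rw [← h3]; abel
  rw [this]; abel

theorem x_of_isDominant {μ : coweightLattice Φ} (hμ : IsDominant b μ) :
    x b q μ = T b q (translation Φ μ) := by
  have := x_mul_T (q := q) hμ isDominant_zero
  rwa [sub_zero, translation_zero, T_one, mul_one] at this

theorem x_zero : x b q 0 = 1 := by
  rw [x_of_isDominant isDominant_zero, translation_zero, T_one]

theorem x_add (μ ν : coweightLattice Φ) : x b q (μ + ν) = x b q μ * x b q ν := by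
  obtain ⟨⟨p1, p2⟩, h1, h2, h3⟩ := exists_dominant_sub b μ
  obtain ⟨⟨r1, r2⟩, h4, h5, h6⟩ := exists_dominant_sub b ν
  simp only at h1 h2 h3 h4 h5 h6
  have e : μ + ν = p1 + r1 - (r2 + p2) := by rw [h3, h6]; abel
  have hu := isUnit_T (q := q) (translation Φ (r2 + p2))
  rw [← hu.mul_left_inj]
  conv_lhs => rw [e, x_mul_T (h1.add h4) (h5.add h2)]
  rw [← T_translation_mul h5 h2, mul_assoc, ← mul_assoc (x b q ν), h6, x_mul_T h4 h5,
    T_translation_mul h4 h2, add_comm r1 p2, ← T_translation_mul h2 h4, ← mul_assoc, h3, x_mul_T h1 h2,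
    T_translation_mul h1 h4]

theorem x_neg_mul (μ : coweightLattice Φ) : x b q (-μ) * x b q μ = 1 := by
  rw [← x_add, neg_add_cancel, x_zero]

theorem x_mul_neg (μ : coweightLattice Φ) : x b q μ * x b q (-μ) = 1 := by
  rw [← x_add, add_neg_cancel, x_zero]

theorem T_finWeyl_mul_x (w : weylGroup Φ) {μ : coweightLattice Φ} (hμ : IsDominant b μ) :
    T b q (finWeyl Φ w) * x b q μ = T b q (finWeyl Φ w * translation Φ μ) := by
  rw [x_of_isDominant hμ, T_mul (length_finWeyl_mul_translation w hμ)]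

variable (b q) in
/-- The generators `T_i` of the finite Hecke algebra. -/
def Ts (i : b.support) : Hecke b q := T b q (finWeyl Φ (finSimple b i))

theorem Ts_eq (i : b.support) : Ts b q i = T b q (simpleReflection b (some i)) := by
  rw [Ts, simpleReflection_some]

theorem pair_finSimple (i : b.support) (μ : coweightLattice Φ) :
    pair Φ i (weylAct Φ (finSimple b i) μ) = -pair Φ i μ := by
  rw [finSimple, weylAct_weylReflection, map_sub, map_zsmul, pair_corootP_same, smul_eq_mul]
  ring

theorem weylAct_finSimple (i : b.support) (μ : coweightLattice Φ) :
    weylAct Φ (finSimple b i) μ = μ - pair Φ i μ • corootP Φ i :=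
  weylAct_weylReflection Φ i μ

theorem commute_Ts_x_of_isDominant (i : b.support) {μ : coweightLattice Φ} (hμ : IsDominant b μ)
    (h : pair Φ i μ = 0) : Ts b q i * x b q μ = x b q μ * Ts b q i := by
  have e : finWeyl Φ (finSimple b i) * translation Φ μ =
      translation Φ μ * finWeyl Φ (finSimple b i) := by
    rw [finWeyl_mul_translation, weylAct_finSimple, h, zero_smul, sub_zero]
  rw [Ts, T_finWeyl_mul_x _ hμ, x_of_isDominant hμ, T_mul, e]
  rw [← e, length_finWeyl_mul_translation _ hμ, add_comm]

/-- Such a μ is an integral combination of the fundamental coweights other than the i-th. These are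
dominant and orthogonal to α_i, and commutation passes to products and inverses. -/
theorem commute_Ts_x (i : b.support) {μ : coweightLattice Φ} (h : pair Φ i μ = 0) :
    Ts b q i * x b q μ = x b q μ * Ts b q i := by
  have hz : ∀ ν : coweightLattice Φ, Ts b q i * x b q ν = x b q ν * Ts b q i → ∀ n : ℤ,
      Ts b q i * x b q (n • ν) = x b q (n • ν) * Ts b q i := by
    intro ν hν n
    have hneg : Ts b q i * x b q (-ν) = x b q (-ν) * Ts b q i := by
      calc Ts b q i * x b q (-ν) = x b q (-ν) * (x b q ν * Ts b q i) * x b q (-ν) := by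
            rw [← mul_assoc, x_neg_mul, one_mul]
        _ = x b q (-ν) * Ts b q i := by
            rw [← hν, mul_assoc, mul_assoc, x_mul_neg, mul_one]
    induction n using Int.induction_on with
    | zero => rw [zero_smul, x_zero, mul_one, one_mul]
    | succ n ih => rw [add_smul, one_smul, x_add, ← mul_assoc, ih, mul_assoc, hν, mul_assoc]
    | pred n ih =>
      rw [sub_smul, one_smul, sub_eq_add_neg, x_add, ← mul_assoc, ih, mul_assoc, hneg, mul_assoc]
  rw [coweight_eq_sum b μ]
  generalize (Finset.univ : Finset b.support) = s
  classical
  induction s using Finset.induction_on with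
  | empty => rw [Finset.sum_empty, x_zero, mul_one, one_mul]
  | insert j s hj ih =>
    rw [Finset.sum_insert hj, x_add, ← mul_assoc]
    have : Ts b q i * x b q (pair Φ j μ • fundCoweight b j) =
        x b q (pair Φ j μ • fundCoweight b j) * Ts b q i := by
      by_cases hji : i = j
      · rw [← hji, h, zero_smul, x_zero, mul_one, one_mul]
      · exact hz _ (commute_Ts_x_of_isDominant i (isDominant_fundCoweight b j)
          (pair_fundCoweight_ne b hji)) _
    rw [this, mul_assoc, ih, mul_assoc]

/-- Write ϖ for the fundamental coweight, t for its translation and s = s_i. The coweight ν = 2ϖ -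
α_i^∨ is dominant and orthogonal to α_i, and t s t = s t_ν with lengths adding on both sides. Since
T_{ts} = x^ϖ T_s⁻¹, this reads x^ϖ T_s⁻¹ x^ϖ = T_s x^ν = x^ν T_s. Cancel x^ϖ on the left and use
T_s⁻¹ = T_s - κ. -/
theorem Ts_mul_x_fundCoweight (i : b.support) :
    Ts b q i * x b q (fundCoweight b i) =
      x b q (fundCoweight b i - corootP Φ i) * Ts b q i +
        kappa b q (some i) • x b q (fundCoweight b i) := by
  set l := fundCoweight b i with hl
  have hd : IsDominant b l := isDominant_fundCoweight b i
  set ν := l + (l - corootP Φ i) with hν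
  have hνd : IsDominant b ν := (isDominant_iff b).2 fun j => by
    rw [hν, map_add, map_sub]
    by_cases h : j = i
    · rw [h, pair_fundCoweight_self, pair_corootP_same]; norm_num
    · rw [pair_fundCoweight_ne b h, pair_corootP]
      have := b.pairingIn_le_zero_of_ne (fun e => h (Subtype.ext e)) j.2 i.2
      linarith
  have hν0 : pair Φ i ν = 0 := by
    rw [hν, map_add, map_sub, pair_fundCoweight_self, pair_corootP_same]; norm_num
  set s := finWeyl Φ (finSimple b i) with hs
  set t := translation Φ l with ht
  have e : t * s * t = s * translation Φ ν := by
    rw [hs, finWeyl_mul_translation, weylAct_finSimple, hν0, zero_smul, sub_zero, mul_assoc,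
      finWeyl_mul_translation, ← mul_assoc, ht, ← translation_add, weylAct_finSimple,
      pair_fundCoweight_self, one_smul, hν]
  have h1 : T b q (t * s) * Ts b q i = T b q t := by
    have hp : AffPos b (act Φ (t * s) (simpleRoot b (some i))) := by
      rw [act_mul, hs, ← simpleReflection_some, act_simpleReflection_self, act_affNeg, ht,
        act_translation, affPos_affNeg]
      refine not_affPos_of_neg ?_
      simp [simpleRoot, hl]
    have := T_mul_simple_pos (q := q) hp
    rw [← Ts_eq, simpleReflection_some, ← hs, mul_assoc] at this
    rw [this, hs, ← map_mul, finSimple_mul_self, map_one, mul_one]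
  have h2 : T b q (t * s) * T b q t = Ts b q i * x b q ν := by
    rw [show Ts b q i = T b q (finWeyl Φ (finSimple b i)) from rfl, T_finWeyl_mul_x _ hνd, ← hs, ← e,
      T_mul]
    refine length_mul_of_forall b fun a ha ha' => ?_
    obtain ⟨hp, hn⟩ := isPos_and_neg_of_translation hd ha ha'
    rw [hl] at hn
    rw [act_mul, hs, act_finWeyl, ht, act_translation, act_translation]
    simp only
    -- For the gradient α_i the two translations cancel: the constant returns to `a.2`, which is at
    -- most 0, and the gradient is now -α_i. For other gradients the constant stays strictly
    -- negative.
    by_cases hai : a.1 = i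
    · rw [hai, finSimple_smul_self, pair_negIdx, hl, pair_fundCoweight_self]
      rw [hai, pair_fundCoweight_self] at hn
      rintro (h | ⟨-, h⟩)
      · simp only at h; linarith
      · exact (isPos_negIdx b _).1 h (isPos_simple b i)
    · refine not_affPos_of_neg ?_
      have : 0 ≤ pair Φ (finSimple b i • a.1) l :=
        pair_nonneg_of_isPos b (isPos_reflection b hp i hai) hd
      rw [← hl] at hn
      simp only
      linarith
  have h3 : T b q (t * s) = x b q l * (Ts b q i - algebraMap ℂ _ (kappa b q (some i))) := by
    have h4 : Ts b q i * (Ts b q i - algebraMap ℂ _ (kappa b q (some i))) = 1 := by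
      rw [Ts_eq]; exact T_simple_mul_inv (some i)
    rw [x_of_isDominant hd, ← ht, ← h1, mul_assoc, h4, mul_one]
  rw [h3, ht, ← x_of_isDominant hd, commute_Ts_x i hν0, hν, x_add, mul_assoc, mul_assoc] at h2
  have h5 := congrArg (fun y => x b q (-l) * y) h2
  simp only [← mul_assoc, x_neg_mul, one_mul] at h5
  rw [← h5, sub_mul, ← Algebra.smul_def]
  abel

/-- Peel off one fundamental coweight at a time: each application of the previous relation
contributes the next term of the string from μ towards s_i μ. -/
theorem Ts_mul_x_nat (i : b.support) (k : ℕ) (μ : coweightLattice Φ) (h : pair Φ i μ = k) :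
    Ts b q i * x b q μ = x b q (weylAct Φ (finSimple b i) μ) * Ts b q i +
      kappa b q (some i) • ∑ j ∈ Finset.range k, x b q (μ - j • corootP Φ i) := by
  induction k generalizing μ with
  | zero =>
    rw [weylAct_finSimple, h]
    simpa using commute_Ts_x i (by simpa using h)
  | succ k ih =>
    set l := fundCoweight b i with hl
    set ν := μ - l with hν
    have hνk : pair Φ i ν = k := by
      rw [hν, map_sub, h, pair_fundCoweight_self]; push_cast; ring
    have e : μ = l + ν := by rw [hν]; abel
    have e2 : weylAct Φ (finSimple b i) μ = (l - corootP Φ i) + weylAct Φ (finSimple b i) ν := by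
      rw [e, map_add, weylAct_finSimple i l, pair_fundCoweight_self, one_smul]
    rw [e2]
    conv_lhs => rw [e, x_add, ← mul_assoc, Ts_mul_x_fundCoweight, add_mul, mul_assoc, ih ν hνk,
      smul_mul_assoc, ← x_add, ← e, mul_add, ← mul_assoc, ← x_add, mul_smul_comm]
    rw [Finset.sum_range_succ', zero_smul, sub_zero, smul_add, add_assoc, Finset.mul_sum]
    congr 3
    refine Finset.sum_congr rfl fun j _ => ?_
    rw [← x_add, hν, ← hl]
    congr 1
    rw [add_smul, one_smul]; abel

end DominantTranslations

/-! ### The group algebra of P and the Bernstein relation. -/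

section LaurentPolynomials

variable [Finite ι] [Nonempty ι] {Φ : RootPairing ι ℝ M N} {b : Φ.Base} [Φ.IsCrystallographic]
  [Φ.IsReduced] [Φ.IsIrreducible] {q : Option b.support → ℝ}

variable (Φ) in
/-- The group algebra of the coweight lattice. -/
abbrev LaurentAlg : Type _ := AddMonoidAlgebra ℂ (coweightLattice Φ)

variable (Φ) in
/-- The monomial `e^μ`. -/
def mono (μ : coweightLattice Φ) : LaurentAlg Φ := AddMonoidAlgebra.single μ 1

theorem mono_add (μ ν : coweightLattice Φ) : mono Φ (μ + ν) = mono Φ μ * mono Φ ν := by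
  simp [mono, AddMonoidAlgebra.single_mul_single]

theorem mono_zero : mono Φ 0 = 1 := rfl

theorem laurent_induction {p : LaurentAlg Φ → Prop} (f : LaurentAlg Φ) (hm : ∀ μ, p (mono Φ μ))
    (ha : ∀ f g, p f → p g → p (f + g)) (hs : ∀ (c : ℂ) f, p f → p (c • f)) : p f :=
  AddMonoidAlgebra.induction_on f hm ha hs

variable (b q) in
/-- The embedding of the group algebra of the coweight lattice in the Hecke algebra. -/
def X : LaurentAlg Φ →ₐ[ℂ] Hecke b q :=
  AddMonoidAlgebra.lift ℂ (Hecke b q) (coweightLattice Φ)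
    { toFun := fun μ => x b q (Multiplicative.toAdd μ)
      map_one' := x_zero
      map_mul' := fun _ _ => x_add _ _ }

@[simp] theorem X_mono (μ : coweightLattice Φ) : X b q (mono Φ μ) = x b q μ := by
  rw [X, mono, AddMonoidAlgebra.lift_single, one_smul]; rfl

/-- The Bernstein relation. -/
theorem bernstein (i : b.support) (μ : coweightLattice Φ) :
    ∃ D : LaurentAlg Φ, (1 - mono Φ (-corootP Φ i)) * D =
        mono Φ μ - mono Φ (weylAct Φ (finSimple b i) μ) ∧
      Ts b q i * x b q μ = x b q (weylAct Φ (finSimple b i) μ) * Ts b q i +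
        kappa b q (some i) • X b q D := by
  have key : ∀ (k : ℕ) (μ : coweightLattice Φ), pair Φ i μ = k →
      ∃ D : LaurentAlg Φ, (1 - mono Φ (-corootP Φ i)) * D =
        mono Φ μ - mono Φ (weylAct Φ (finSimple b i) μ) ∧
      Ts b q i * x b q μ = x b q (weylAct Φ (finSimple b i) μ) * Ts b q i +
        kappa b q (some i) • X b q D := by
    intro k μ h
    refine ⟨∑ j ∈ Finset.range k, mono Φ (μ - j • corootP Φ i), ?_, ?_⟩
    · have : weylAct Φ (finSimple b i) μ = μ - k • corootP Φ i := by
        rw [weylAct_finSimple, h, natCast_zsmul]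
      rw [this]
      clear h this
      induction k with
      | zero => simp
      | succ k ih =>
        rw [Finset.sum_range_succ, mul_add, ih, sub_mul, one_mul, ← mono_add]
        have : -corootP Φ i + (μ - k • corootP Φ i) = μ - (k + 1) • corootP Φ i := by
          rw [add_smul, one_smul]; abel
        rw [this]; abel
    · rw [Ts_mul_x_nat i k μ h, map_sum]
      simp only [X_mono]
  rcases le_total 0 (pair Φ i μ) with h | h
  · exact key (pair Φ i μ).toNat μ (Int.toNat_of_nonneg h).symm
  · obtain ⟨D, hD, hT⟩ := key (pair Φ i (-μ)).toNat (-μ)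
      (Int.toNat_of_nonneg (by rw [map_neg]; linarith)).symm
    set ν := weylAct Φ (finSimple b i) μ with hν
    rw [map_neg, ← hν] at hD hT
    -- For a nonpositive pairing, take the relation for -μ and multiply it by x^{s_i μ} on the left
    -- and x^μ on the right.
    refine ⟨-(mono Φ μ * D * mono Φ ν), ?_, ?_⟩
    · have : (1 - mono Φ (-corootP Φ i)) * -(mono Φ μ * D * mono Φ ν) =
        -(mono Φ μ * ((1 - mono Φ (-corootP Φ i)) * D) * mono Φ ν) := by ring
      rw [this, hD, mul_sub, sub_mul, ← mono_add, ← mono_add, mul_assoc, ← mono_add]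
      simp [mono_zero]
    · have h1 : x b q ν * (Ts b q i * x b q (-μ)) * x b q μ = _ :=
        congrArg (fun y => x b q ν * y * x b q μ) hT
      rw [mul_assoc, mul_assoc, x_neg_mul, mul_one, mul_add, add_mul, ← mul_assoc (x b q ν),
        x_mul_neg, one_mul] at h1
      rw [h1, map_neg, map_mul, map_mul, X_mono, X_mono, smul_neg, mul_smul_comm, smul_mul_assoc,
        ← X_mono ν, ← X_mono μ, ← map_mul, ← map_mul, ← map_mul, ← map_mul]
      have : mono Φ μ * D * mono Φ ν = mono Φ ν * D * mono Φ μ := by ring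
      rw [this]; abel

end LaurentPolynomials

/-! ### The basis T_w x^μ of ℋ. -/

section BernsteinBasis

variable [Finite ι] [Nonempty ι] {Φ : RootPairing ι ℝ M N} {b : Φ.Base} [Φ.IsCrystallographic]
  [Φ.IsReduced] [Φ.IsIrreducible]

open Classical in
variable (b) in
/-- The pairing with the sum of the positive roots. -/
def posSum (μ : coweightLattice Φ) : ℤ :=
  ∑ k ∈ (Set.toFinite {k | b.IsPos k}).toFinset, pair Φ k μ

/-- s_i permutes the positive roots other than α_i and negates α_i. -/
theorem posSum_finSimple (i : b.support) (μ : coweightLattice Φ) :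
    posSum b (weylAct Φ (finSimple b i) μ) = posSum b μ - 2 * pair Φ i μ := by
  classical
  set S := (Set.toFinite {k | b.IsPos k}).toFinset with hS
  have hi : (i : ι) ∈ S := by simpa [hS] using isPos_simple b i
  have hmem : ∀ k ∈ S.erase (i : ι), finSimple b i • k ∈ S.erase (i : ι) := by
    intro k hk
    simp only [hS, Finset.mem_erase, Set.Finite.mem_toFinset, Set.mem_ofPred_eq] at hk ⊢
    refine ⟨fun h => ?_, isPos_reflection b hk.2 i hk.1⟩
    have h1 : k = negIdx Φ i := by
      rw [← finSimple_smul_self, ← h, ← mul_smul, finSimple_mul_self, one_smul]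
    exact (isPos_negIdx b _).1 (h1 ▸ hk.2) (isPos_simple b i)
  have h2 : ∑ k ∈ S.erase (i : ι), pair Φ k (weylAct Φ (finSimple b i) μ) =
      ∑ k ∈ S.erase (i : ι), pair Φ k μ := by
    refine Finset.sum_nbij' (fun k => finSimple b i • k) (fun k => finSimple b i • k) hmem hmem
      (fun k _ => ?_) (fun k _ => ?_) (fun k _ => ?_)
    · rw [← mul_smul, finSimple_mul_self, one_smul]
    · rw [← mul_smul, finSimple_mul_self, one_smul]
    · conv_rhs => rw [← weylAct_inv_weylAct Φ (finSimple b i) μ, finSimple_inv, pair_smul]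
  rw [posSum, posSum, ← hS, ← Finset.add_sum_erase S _ hi, ← Finset.add_sum_erase S _ hi, h2,
    pair_finSimple]
  ring

-- Maximise `posSum` over the finite orbit: a negative simple pairing would let a simple reflection
-- increase it.
variable (b) in
theorem exists_isDominant_weylAct (μ : coweightLattice Φ) : ∃ w, IsDominant b (weylAct Φ w μ) := by
  obtain ⟨w, hw⟩ := Finite.exists_max fun w : weylGroup Φ => posSum b (weylAct Φ w μ)
  refine ⟨w, (isDominant_iff b).2 fun i => ?_⟩
  have := hw (finSimple b i * w)
  rw [weylAct_mul, posSum_finSimple] at this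
  linarith

variable (b) in
theorem exists_isDominant_add (s : Finset (coweightLattice Φ)) :
    ∃ l, IsDominant b l ∧ ∀ μ ∈ s, IsDominant b (μ + l) := by
  classical
  induction s using Finset.induction_on with
  | empty => exact ⟨0, isDominant_zero, by simp⟩
  | insert μ s _ ih =>
    obtain ⟨l, hl, h⟩ := ih
    obtain ⟨⟨p1, p2⟩, h1, h2, h3⟩ := exists_dominant_sub b μ
    simp only at h1 h2 h3
    refine ⟨l + p2, hl.add h2, fun ν hν => ?_⟩
    rcases Finset.mem_insert.1 hν with rfl | hν
    · have : ν + (l + p2) = p1 + l := by rw [h3]; abel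
      rw [this]; exact h1.add hl
    · rw [← add_assoc]; exact (h ν hν).add h2

variable {q : Option b.support → ℝ}

variable (b q) in
/-- The elements `T_w x^μ` with `w ∈ W₀` and `μ ∈ P`. -/
def bernsteinFamily (p : weylGroup Φ × coweightLattice Φ) : Hecke b q :=
  T b q (finWeyl Φ p.1) * x b q p.2

/-- Multiply a finite relation on the right by x^l with l so dominant that all exponents become
dominant. The terms turn into T_g for distinct g = w t_{μ+l}. -/
theorem linearIndependent_bernsteinFamily (hq : IsReducedParameterSystem b q) :
    LinearIndependent ℂ (bernsteinFamily b q) := by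
  classical
  rw [linearIndependent_iff']
  intro s g hg
  obtain ⟨l, -, hl⟩ := exists_isDominant_add b (s.image Prod.snd)
  have hinj : Function.Injective fun p : weylGroup Φ × coweightLattice Φ =>
      finWeyl Φ p.1 * translation Φ (p.2 + l) := by
    rintro ⟨w, μ⟩ ⟨v, ν⟩ h
    simp only [finWeyl_mul_translation, ← mkAff_eq, mkAff_inj] at h
    obtain ⟨h1, rfl⟩ := h
    have := (weylAct Φ w).injective h1
    rw [add_left_inj] at this
    rw [this]
  have h1 := (linearIndependent_iff'.1 ((linearIndependent_T hq).comp _ hinj)) s g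
  refine h1 ?_
  have h2 := congrArg (· * x b q l) hg
  simp only [zero_mul, Finset.sum_mul] at h2
  rw [← h2]
  refine Finset.sum_congr rfl fun p hp => ?_
  rw [bernsteinFamily, smul_mul_assoc, mul_assoc, ← x_add,
    T_finWeyl_mul_x _ (hl _ (Finset.mem_image_of_mem _ hp))]
  rfl

theorem Ts_mul_T_pos {w : weylGroup Φ} {i : b.support} (h : b.IsPos (w⁻¹ • (i : ι))) :
    Ts b q i * T b q (finWeyl Φ w) = T b q (finWeyl Φ (finSimple b i * w)) := by
  rw [Ts_eq, T_simple_mul_pos, map_mul, simpleReflection_some]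
  rwa [← map_inv, affPos_smul_simple]

theorem Ts_mul_T_neg {w : weylGroup Φ} {i : b.support} (h : ¬ b.IsPos (w⁻¹ • (i : ι))) :
    Ts b q i * T b q (finWeyl Φ w) = T b q (finWeyl Φ (finSimple b i * w)) +
      kappa b q (some i) • T b q (finWeyl Φ w) := by
  rw [Ts_eq, T_simple_mul_neg, map_mul, simpleReflection_some]
  rwa [← map_inv, affPos_smul_simple]

/-- The subalgebra of the elements whose left multiplication preserves a subspace. -/
def leftStabilizer (S : Submodule ℂ (Hecke b q)) : Subalgebra ℂ (Hecke b q) where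
  carrier := {h | ∀ s ∈ S, h * s ∈ S}
  mul_mem' {x y} hx hy s hs := by rw [mul_assoc]; exact hx _ (hy _ hs)
  add_mem' {x y} hx hy s hs := by rw [add_mul]; exact S.add_mem (hx _ hs) (hy _ hs)
  algebraMap_mem' c s hs := by rw [← Algebra.smul_def]; exact S.smul_mem c hs

theorem Ts_mul_mem_span (i : b.support) :
    ∀ s ∈ Submodule.span ℂ (Set.range (bernsteinFamily b q)),
      Ts b q i * s ∈ Submodule.span ℂ (Set.range (bernsteinFamily b q)) := by
  set S := Submodule.span ℂ (Set.range (bernsteinFamily b q)) with hS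
  intro s hs
  induction hs using Submodule.span_induction with
  | mem _ h =>
    obtain ⟨⟨v, μ⟩, rfl⟩ := h
    rw [bernsteinFamily, ← mul_assoc]
    by_cases hp : b.IsPos (v⁻¹ • (i : ι))
    · rw [Ts_mul_T_pos hp]
      exact Submodule.subset_span ⟨(_, μ), rfl⟩
    · rw [Ts_mul_T_neg hp, add_mul, smul_mul_assoc]
      exact S.add_mem (Submodule.subset_span ⟨(_, μ), rfl⟩)
        (S.smul_mem _ (Submodule.subset_span ⟨(_, μ), rfl⟩))
  | zero => rw [mul_zero]; exact S.zero_mem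
  | add y z _ _ hy hz => rw [mul_add]; exact S.add_mem hy hz
  | smul c y _ hy => rw [mul_smul_comm]; exact S.smul_mem c hy

/-- Move the polynomial past one T_i at a time by the Bernstein relation. The statement is for all
polynomials since the divided difference D need not be a monomial. -/
theorem X_mul_T_mem_span (w : weylGroup Φ) (f : LaurentAlg Φ) :
    X b q f * T b q (finWeyl Φ w) ∈ Submodule.span ℂ (Set.range (bernsteinFamily b q)) := by
  set S := Submodule.span ℂ (Set.range (bernsteinFamily b q)) with hS
  have hTs := Ts_mul_mem_span (b := b) (q := q)
  rw [← hS] at hTs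
  induction w using weyl_induction b generalizing f with
  | h1 =>
    rw [map_one, T_one, mul_one]
    induction f using laurent_induction with
    | hm μ =>
      refine Submodule.subset_span ⟨(1, μ), ?_⟩
      rw [bernsteinFamily, map_one, T_one, one_mul, X_mono]
    | ha f g hf hg => rw [map_add]; exact S.add_mem hf hg
    | hs c f hf => rw [map_smul]; exact S.smul_mem c hf
  | hs w i hw ih =>
    induction f using laurent_induction with
    | hm μ =>
      obtain ⟨D, -, hD⟩ := bernstein (q := q) i (weylAct Φ (finSimple b i) μ)
      rw [← weylAct_mul, finSimple_mul_self, weylAct_one, ← sub_eq_iff_eq_add] at hD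
      rw [← Ts_mul_T_pos hw, ← mul_assoc, X_mono, ← hD, sub_mul, mul_assoc, smul_mul_assoc]
      refine S.sub_mem (hTs i _ ?_) (S.smul_mem _ (ih D))
      rw [← X_mono]; exact ih _
    | ha f g hf hg => rw [map_add, add_mul]; exact S.add_mem hf hg
    | hs c f hf => rw [map_smul, smul_mul_assoc]; exact S.smul_mem c hf

/-- The left stabiliser of the span contains all x^μ and T_i; it remains to reach every T_g. Write g
= t_μ v and choose w with wμ dominant. Then T of t_{wμ} is x^{wμ}, and multiplying by T_i on either
side moves from T_g to T_{gs_i} or T_{s_ig} modulo a multiple of T_g. This reaches w⁻¹ t_{wμ} w v =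
g. -/
theorem span_bernsteinFamily : Submodule.span ℂ (Set.range (bernsteinFamily b q)) = ⊤ := by
  set S := Submodule.span ℂ (Set.range (bernsteinFamily b q)) with hS
  set A := leftStabilizer S with hA
  have hx : ∀ μ, x b q μ ∈ A := by
    intro μ s hs
    induction hs using Submodule.span_induction with
    | mem _ h =>
      obtain ⟨⟨v, ν⟩, rfl⟩ := h
      rw [bernsteinFamily, ← mul_assoc, ← X_mono]
      have hmem := X_mul_T_mem_span (q := q) v (mono Φ μ)
      rw [← hS] at hmem
      generalize X b q (mono Φ μ) * T b q (finWeyl Φ v) = y at hmem ⊢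
      induction hmem using Submodule.span_induction with
      | mem _ h =>
        obtain ⟨⟨u, ρ⟩, rfl⟩ := h
        rw [bernsteinFamily, mul_assoc, ← x_add]
        exact Submodule.subset_span ⟨(u, ρ + ν), rfl⟩
      | zero => rw [zero_mul]; exact S.zero_mem
      | add y z _ _ hy hz => rw [add_mul]; exact S.add_mem hy hz
      | smul c y _ hy => rw [smul_mul_assoc]; exact S.smul_mem c hy
    | zero => rw [mul_zero]; exact S.zero_mem
    | add y z _ _ hy hz => rw [mul_add]; exact S.add_mem hy hz
    | smul c y _ hy => rw [mul_smul_comm]; exact S.smul_mem c hy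
  have hTs : ∀ i : b.support, Ts b q i ∈ A := Ts_mul_mem_span
  have hright : ∀ (i : b.support) (g : ExtAffineWeyl Φ), T b q g ∈ A →
      T b q (g * finWeyl Φ (finSimple b i)) ∈ A := by
    intro i g hg
    have h1 := A.mul_mem hg (hTs i)
    rw [Ts_eq] at h1
    by_cases hp : AffPos b (act Φ g (simpleRoot b (some i)))
    · rwa [T_mul_simple_pos hp, simpleReflection_some] at h1
    · rw [T_mul_simple_neg hp, simpleReflection_some] at h1
      exact by simpa using A.sub_mem h1 (A.smul_mem hg (kappa b q (some i)))
  have hleft : ∀ (i : b.support) (g : ExtAffineWeyl Φ), T b q g ∈ A →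
      T b q (finWeyl Φ (finSimple b i) * g) ∈ A := by
    intro i g hg
    have h1 := A.mul_mem (hTs i) hg
    rw [Ts_eq] at h1
    by_cases hp : AffPos b (act Φ g⁻¹ (simpleRoot b (some i)))
    · rwa [T_simple_mul_pos hp, simpleReflection_some] at h1
    · rw [T_simple_mul_neg hp, simpleReflection_some] at h1
      exact by simpa using A.sub_mem h1 (A.smul_mem hg (kappa b q (some i)))
  have hright' : ∀ (w : weylGroup Φ) (g : ExtAffineWeyl Φ), T b q g ∈ A →
      T b q (g * finWeyl Φ w) ∈ A := by
    intro w
    induction w using weyl_induction b with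
    | h1 => intro g hg; rwa [map_one, mul_one]
    | hs w i _ ih => intro g hg; rw [map_mul, ← mul_assoc]; exact ih _ (hright i g hg)
  have hleft' : ∀ (w : weylGroup Φ) (g : ExtAffineWeyl Φ), T b q g ∈ A →
      T b q (finWeyl Φ w * g) ∈ A := by
    intro w
    induction w using weyl_induction b with
    | h1 => intro g hg; rwa [map_one, one_mul]
    | hs w i _ ih => intro g hg; rw [map_mul, mul_assoc]; exact hleft i _ (ih g hg)
  have hT : ∀ g, T b q g ∈ A := by
    intro g
    obtain ⟨w, hw⟩ := exists_isDominant_weylAct b (transPart Φ g)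
    have h1 := hx (weylAct Φ w (transPart Φ g))
    rw [x_of_isDominant hw] at h1
    have h2 := hright' (w * g.right) _ (hleft' w⁻¹ _ h1)
    rwa [finWeyl_mul_translation, weylAct_inv_weylAct, mul_assoc, ← map_mul, inv_mul_cancel_left,
      ← mkAff_eq, ← mkAff_ext] at h2
  rw [eq_top_iff]
  intro h _
  have h1 : (1 : Hecke b q) ∈ S :=
    Submodule.subset_span ⟨(1, 0), by rw [bernsteinFamily, map_one, T_one, x_zero, one_mul]⟩
  have h2 : h ∈ A := by
    induction h using hecke_induction with
    | hT w => exact hT w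
    | hz => exact A.zero_mem
    | ha y z hy hz => exact A.add_mem (hy trivial) (hz trivial)
    | hs c y hy => exact A.smul_mem (hy trivial) c
  simpa using h2 1 h1

/-- The basis `T_w x^μ`, `w ∈ W₀`, `μ ∈ P`, of the affine Hecke algebra. -/
def bernsteinBasis (hq : IsReducedParameterSystem b q) :
    Module.Basis (weylGroup Φ × coweightLattice Φ) ℂ (Hecke b q) :=
  Module.Basis.mk (linearIndependent_bernsteinFamily hq) span_bernsteinFamily.ge

theorem bernsteinBasis_apply (hq : IsReducedParameterSystem b q)
    (p : weylGroup Φ × coweightLattice Φ) :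
    bernsteinBasis hq p = T b q (finWeyl Φ p.1) * x b q p.2 := Module.Basis.mk_apply _ _ _

open Classical in
/-- The coefficient of `T_w` in `h = ∑ T_w X(c_w)`. -/
def weylCoeff (hq : IsReducedParameterSystem b q) (w : weylGroup Φ) :
    Hecke b q →ₗ[ℂ] LaurentAlg Φ :=
  (bernsteinBasis hq).constr ℂ fun p => if p.1 = w then mono Φ p.2 else 0

open Classical in
theorem weylCoeff_T_mul_X (hq : IsReducedParameterSystem b q) (w v : weylGroup Φ)
    (f : LaurentAlg Φ) :
    weylCoeff hq w (T b q (finWeyl Φ v) * X b q f) = if v = w then f else 0 := by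
  induction f using laurent_induction with
  | hm μ =>
    rw [X_mono, ← bernsteinBasis_apply hq (v, μ), weylCoeff, Module.Basis.constr_basis]
  | ha f g hf hg => rw [map_add, mul_add, map_add, hf, hg]; split_ifs <;> simp
  | hs c f hf => rw [map_smul, mul_smul_comm, map_smul, hf]; split_ifs <;> simp

theorem bernstein_induction {p : Hecke b q → Prop} (hm : ∀ w f, p (T b q (finWeyl Φ w) * X b q f))
    (ha : ∀ x y, p x → p y → p (x + y)) (hs : ∀ (c : ℂ) x, p x → p (c • x)) (h : Hecke b q) :
    p h := by
  have hmem : h ∈ Submodule.span ℂ (Set.range (bernsteinFamily b q)) := by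
    rw [span_bernsteinFamily]; trivial
  induction hmem using Submodule.span_induction with
  | mem y hy => obtain ⟨⟨w, μ⟩, rfl⟩ := hy; have := hm w (mono Φ μ); rwa [X_mono] at this
  | zero => simpa using hm 1 0
  | add y z _ _ hy hz => exact ha _ _ hy hz
  | smul c y _ hy => exact hs _ _ hy

theorem weylCoeff_mul_X (hq : IsReducedParameterSystem b q) (w : weylGroup Φ) (h : Hecke b q)
    (f : LaurentAlg Φ) : weylCoeff hq w (h * X b q f) = weylCoeff hq w h * f := by
  classical
  induction h using bernstein_induction with
  | hm v g =>
    rw [mul_assoc, ← map_mul, weylCoeff_T_mul_X, weylCoeff_T_mul_X]; split_ifs <;> simp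
  | ha y z hy hz => rw [add_mul, map_add, hy, hz, map_add, add_mul]
  | hs c y hy => rw [smul_mul_assoc, map_smul, hy, map_smul, smul_mul_assoc]

theorem eq_sum_weylCoeff [Fintype (weylGroup Φ)] (hq : IsReducedParameterSystem b q)
    (h : Hecke b q) : h = ∑ w, T b q (finWeyl Φ w) * X b q (weylCoeff hq w h) := by
  classical
  induction h using bernstein_induction with
  | hm v g => simp [weylCoeff_T_mul_X, apply_ite (X b q), mul_ite]
  | ha y z hy hz =>
    conv_lhs => rw [hy, hz]
    simp only [map_add, mul_add, Finset.sum_add_distrib]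
  | hs c y hy =>
    conv_lhs => rw [hy]
    simp only [map_smul, mul_smul_comm, Finset.smul_sum]

end BernsteinBasis

/-! ### Points of the torus, Laurent polynomials, Zariski density. -/

section TorusFunctions

variable [Finite ι] [Nonempty ι] {Φ : RootPairing ι ℝ M N} {b : Φ.Base} [Φ.IsCrystallographic]
  [Φ.IsReduced] [Φ.IsIrreducible]

namespace Torus

theorem pow_add (t : Torus Φ) (μ ν : coweightLattice Φ) :
    t.pow (μ + ν) = t.pow μ * t.pow ν := by
  simp [pow, ofAdd_add]

@[simp] theorem pow_zero (t : Torus Φ) : t.pow 0 = 1 := by simp [pow]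

theorem pow_ne_zero (t : Torus Φ) (μ : coweightLattice Φ) : t.pow μ ≠ 0 := Units.ne_zero _

theorem pow_neg (t : Torus Φ) (μ : coweightLattice Φ) : t.pow (-μ) = (t.pow μ)⁻¹ := by
  simp [pow, ofAdd_neg]

theorem weyl_pow (w : weylGroup Φ) (t : Torus Φ) (μ : coweightLattice Φ) :
    (t.weyl w).pow μ = t.pow (weylAct Φ w⁻¹ μ) := rfl

theorem ext_pow {s t : Torus Φ} (h : ∀ μ, s.pow μ = t.pow μ) : s = t :=
  MonoidHom.ext fun μ => Units.ext (h (Multiplicative.toAdd μ))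

theorem weyl_mul (v w : weylGroup Φ) (t : Torus Φ) : t.weyl (v * w) = (t.weyl w).weyl v :=
  ext_pow fun μ => by rw [weyl_pow, weyl_pow, weyl_pow, mul_inv_rev, weylAct_mul]

@[simp] theorem weyl_one (t : Torus Φ) : t.weyl 1 = t :=
  ext_pow fun μ => by rw [weyl_pow, inv_one, weylAct_one]

theorem weyl_pow_corootP (w : weylGroup Φ) (t : Torus Φ) (i : ι) :
    (t.weyl w).pow (corootP Φ i) = t.pow (corootP Φ (w⁻¹ • i)) := by
  rw [weyl_pow, weylAct_corootP]

theorem IsRegular.weyl {t : Torus Φ} (ht : t.IsRegular) (w : weylGroup Φ) :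
    (t.weyl w).IsRegular := fun i => by
  rw [weyl_pow_corootP]; exact ht _

theorem IsRegular.one_sub_ne_zero {t : Torus Φ} (ht : t.IsRegular) (i : ι) :
    1 - t.pow (-corootP Φ i) ≠ 0 := by
  rw [← corootP_negIdx, sub_ne_zero]
  exact (ht _).symm

/-- Evaluation of Laurent polynomials at a point of the torus. -/
def ev (t : Torus Φ) : LaurentAlg Φ →ₐ[ℂ] ℂ :=
  AddMonoidAlgebra.lift ℂ ℂ (coweightLattice Φ) ((Units.coeHom ℂ).comp t)

@[simp] theorem ev_mono (t : Torus Φ) (μ : coweightLattice Φ) : t.ev (mono Φ μ) = t.pow μ := by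
  rw [ev, mono, AddMonoidAlgebra.lift_single, one_smul]; rfl

theorem ev_eq_eval (t : Torus Φ) (f : LaurentAlg Φ) : t.ev f = t.eval f.coeff := by
  rw [ev, AddMonoidAlgebra.lift_apply]; rfl

end Torus

theorem exists_ev_weyl (w : weylGroup Φ) (f : LaurentAlg Φ) :
    ∃ g : LaurentAlg Φ, ∀ t : Torus Φ, (t.weyl w).ev f = t.ev g := by
  induction f using laurent_induction with
  | hm μ => exact ⟨mono Φ (weylAct Φ w⁻¹ μ), fun t => by rw [t.ev_mono, Torus.ev_mono]; rfl⟩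
  | ha f g hf hg =>
    obtain ⟨f', hf⟩ := hf
    obtain ⟨g', hg⟩ := hg
    exact ⟨f' + g', fun t => by rw [map_add, map_add, hf, hg]⟩
  | hs c f hf =>
    obtain ⟨f', hf⟩ := hf
    exact ⟨c • f', fun t => by rw [map_smul, map_smul, hf]⟩

theorem posSum_add (μ ν : coweightLattice Φ) : posSum b (μ + ν) = posSum b μ + posSum b ν := by
  simp only [posSum, map_add, Finset.sum_add_distrib]

variable (b) in
/-- `posSum` as a homomorphism. -/
def posSumHom : coweightLattice Φ →+ ℤ := AddMonoidHom.mk' (posSum b) posSum_add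

theorem posSum_corootP (i : b.support) : posSum b (corootP Φ i) = 2 := by
  have h := posSum_finSimple (b := b) i (corootP Φ i)
  rw [weylAct_corootP, finSimple_smul_self, corootP_negIdx, pair_corootP_same] at h
  have h2 : posSum b (-corootP Φ i) = -posSum b (corootP Φ i) := map_neg (posSumHom b) _
  omega

/-- The homomorphism `μ ↦ c ^ n(μ)`. -/
def zpowHom {G : Type*} [Group G] (c : G) (n : coweightLattice Φ →+ ℤ) :
    Multiplicative (coweightLattice Φ) →* G where
  toFun μ := c ^ n (Multiplicative.toAdd μ)
  map_one' := by simp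
  map_mul' μ ν := by rw [toAdd_mul, map_add, zpow_add]

-- Take t^μ = e^{posSum μ} with e > 0 small; `posSum` is 2 on each simple coroot, so the condition
-- becomes e² < r.
variable (b) in
theorem exists_torus_lt {r : ℝ} (hr : 0 < r) :
    ∃ t : Torus Φ, ∀ i ∈ b.support, ‖t.pow (corootP Φ i)‖ < r := by
  set e : ℝ := min (r / 2) 1 with he
  have he0 : 0 < e := lt_min (half_pos hr) one_pos
  refine ⟨zpowHom (Units.mk0 (e : ℂ) (by exact_mod_cast he0.ne')) (posSumHom b), fun i hi => ?_⟩
  have h1 : posSumHom b (corootP Φ i) = 2 := posSum_corootP ⟨i, hi⟩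
  have h2 : e * e < r := by
    have h3 : e ≤ r / 2 := min_le_left _ _
    have h4 : e ≤ 1 := min_le_right _ _
    nlinarith
  simp only [Torus.pow, zpowHom, MonoidHom.coe_mk, OneHom.coe_mk, toAdd_ofAdd, h1]
  rw [Units.val_zpow_eq_zpow_val, Units.val_mk0]
  simp only [zpow_ofNat, norm_pow, Complex.norm_real, Real.norm_eq_abs, sq_abs]
  rwa [sq]

/-- The characters `u ↦ u^μ` of the compact torus. -/
def circleChar (μ : coweightLattice Φ) : (Multiplicative (coweightLattice Φ) →* Circle) →* ℂ :=
  Circle.coeHom.comp (MonoidHom.eval (Multiplicative.ofAdd μ))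

theorem circleChar_injective (b : Φ.Base) : Function.Injective (circleChar (Φ := Φ)) := by
  intro μ ν h
  refine coweight_ext b fun i => ?_
  by_contra hn
  set n : ℤ := pair Φ i μ - pair Φ i ν with hn'
  have hn0 : (n : ℂ) ≠ 0 := by exact_mod_cast sub_ne_zero.2 hn
  -- Test the two characters on the element sending a coweight ρ to exp(iπ/n)^{⟨ρ, α_i⟩}: their
  -- quotient there is exp(iπ) = -1.
  have h1 : Circle.exp (Real.pi / n) ^ pair Φ i μ = Circle.exp (Real.pi / n) ^ pair Φ i ν :=
    Circle.coe_injective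
      (congrArg (fun f => f (zpowHom (Circle.exp (Real.pi / n)) (pair Φ i))) h)
  rw [← mul_inv_eq_one, ← zpow_sub, ← hn'] at h1
  have h2 := congrArg (fun z : Circle => (z : ℂ)) h1
  simp only [Circle.coe_zpow, Circle.coe_exp, Circle.coe_one, ← Complex.exp_int_mul] at h2
  have h3 : (n : ℂ) * (((Real.pi / n : ℝ) : ℂ) * Complex.I) = Real.pi * Complex.I := by
    push_cast; field_simp
  rw [h3, Complex.exp_pi_mul_I] at h2
  norm_num at h2

/-- The region `|t^{αᵢ^∨}| < r` is Zariski dense in the torus. -/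
theorem laurent_ext (b : Φ.Base) {r : ℝ} (hr : 0 < r) {f g : LaurentAlg Φ}
    (h : ∀ t : Torus Φ, (∀ i ∈ b.support, ‖t.pow (corootP Φ i)‖ < r) → t.ev f = t.ev g) :
    f = g := by
  suffices key : ∀ f : LaurentAlg Φ,
      (∀ t : Torus Φ, (∀ i ∈ b.support, ‖t.pow (corootP Φ i)‖ < r) → t.ev f = 0) → f = 0 by
    rw [← sub_eq_zero]
    exact key _ fun t ht => by rw [map_sub, h t ht, sub_self]
  clear h f g
  intro f hf
  obtain ⟨t, ht⟩ := exists_torus_lt b hr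
  -- The region is stable under the compact torus. Fixing t and varying a unitary factor turns the
  -- vanishing of f into a linear relation between distinct characters, which Dedekind's theorem
  -- forbids.
  have hli := (linearIndependent_monoidHom (Multiplicative (coweightLattice Φ) →* Circle) ℂ).comp _
    (circleChar_injective b)
  rw [linearIndependent_iff'] at hli
  have h0 := hli f.coeff.support (fun μ => f.coeff μ * t.pow μ) (by
    ext u
    have h1 := hf (t * Circle.toUnits.comp u) (fun i hi => by
      have : (t * Circle.toUnits.comp u : Torus Φ).pow (corootP Φ i) = t.pow (corootP Φ i) *
          (u (Multiplicative.ofAdd (corootP Φ i)) : ℂ) := rfl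
      rw [this, norm_mul, Circle.norm_coe, mul_one]
      exact ht i hi)
    rw [Torus.ev_eq_eval, Torus.eval, Finsupp.sum] at h1
    rw [Finset.sum_apply, Pi.zero_apply, ← h1]
    refine Finset.sum_congr rfl fun μ _ => ?_
    simp only [Pi.smul_apply, smul_eq_mul, Function.comp_apply, mul_assoc]
    rfl)
  refine AddMonoidAlgebra.coeff_eq_zero.1 (Finsupp.support_eq_empty.1 ?_)
  refine Finset.eq_empty_of_forall_notMem fun μ hμ => ?_
  exact mul_ne_zero (Finsupp.mem_support_iff.1 hμ) (t.pow_ne_zero μ) (h0 μ hμ)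

variable (b) in
open Classical in
/-- The Laurent polynomial `d`. -/
def dLaurent : LaurentAlg Φ :=
  ∏ i ∈ (Set.toFinite {i | b.IsPos i}).toFinset, (1 - mono Φ (-corootP Φ i))

theorem d_eq_ev (t : Torus Φ) : d b t = t.ev (dLaurent b) := by
  rw [d, finprod_mem_eq_finite_toFinset_prod _ (Set.toFinite _), dLaurent, map_prod]
  exact Finset.prod_congr rfl fun i _ => by rw [map_sub, map_one, Torus.ev_mono]

theorem Torus.IsRegular.d_ne_zero {t : Torus Φ} (ht : t.IsRegular) : d b t ≠ 0 := by
  rw [d, finprod_mem_eq_finite_toFinset_prod _ (Set.toFinite _)]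
  exact Finset.prod_ne_zero_iff.2 fun i _ => ht.one_sub_ne_zero i

theorem Torus.norm_pow_sum (t : Torus Φ) (c : b.support → ℕ) :
    ‖t.pow (∑ j, c j • corootP Φ j)‖ = ∏ j : b.support, ‖t.pow (corootP Φ j)‖ ^ c j := by
  classical
  have hn : ∀ (n : ℕ) (μ : coweightLattice Φ), t.pow (n • μ) = t.pow μ ^ n := by
    intro n μ
    induction n with
    | zero => simp
    | succ n ih => rw [add_smul, one_smul, t.pow_add, ih, pow_succ]
  generalize (Finset.univ : Finset b.support) = s
  induction s using Finset.induction_on with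
  | empty => simp
  | insert j s hj ih =>
    rw [Finset.sum_insert hj, Finset.prod_insert hj, t.pow_add, norm_mul, ih, hn, norm_pow]

/-- A positive coroot is a nonnegative combination of simple coroots, not all coefficients being
zero since its pairing with its own root is 2. -/
theorem norm_pow_corootP_lt {r : ℝ} (hr : r ≤ 1) {t : Torus Φ}
    (ht : ∀ i ∈ b.support, ‖t.pow (corootP Φ i)‖ < r) {k : ι} (hk : b.IsPos k) :
    ‖t.pow (corootP Φ k)‖ < 1 := by
  obtain ⟨c, hc⟩ := exists_corootP_eq_sum b hk
  have hlt : ∀ j : b.support, ‖t.pow (corootP Φ j)‖ < 1 := fun j => (ht j j.2).trans_le hr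
  have hne : ∃ j, c j ≠ 0 := by
    by_contra! h0
    simp only [h0, zero_smul, Finset.sum_const_zero] at hc
    have := pair_corootP_same Φ k
    rw [hc, map_zero] at this
    norm_num at this
  obtain ⟨j, hj⟩ := hne
  classical
  rw [hc, t.norm_pow_sum]
  rw [← Finset.mul_prod_erase _ _ (Finset.mem_univ j)]
  refine (mul_le_of_le_one_right (by positivity) (Finset.prod_le_one (fun _ _ => by positivity)
    fun i _ => pow_le_one₀ (norm_nonneg _) (hlt i).le)).trans_lt ?_
  exact pow_lt_one₀ (norm_nonneg _) (hlt j) hj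

theorem isRegular_of_norm_lt {r : ℝ} (hr : r ≤ 1) {t : Torus Φ}
    (ht : ∀ i ∈ b.support, ‖t.pow (corootP Φ i)‖ < r) : t.IsRegular := by
  intro k h
  by_cases hk : b.IsPos k
  · have := norm_pow_corootP_lt hr ht hk
    rw [h, norm_one] at this
    exact this.false
  · have := norm_pow_corootP_lt hr ht ((isPos_negIdx b k).2 hk)
    rw [corootP_negIdx, t.pow_neg, h, inv_one, norm_one] at this
    exact this.false

/-- Some simple root is made negative by w⁻¹. At its coroot, t has absolute value below 1 and wt
above 1. -/
theorem weyl_ne_of_norm_lt {r : ℝ} (hr : r ≤ 1) {t : Torus Φ}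
    (ht : ∀ i ∈ b.support, ‖t.pow (corootP Φ i)‖ < r) {w : weylGroup Φ} (hw : w ≠ 1) :
    t.weyl w ≠ t := by
  intro h
  obtain ⟨i, hi⟩ := exists_simple_not_isPos b (inv_ne_one.2 hw)
  have h1 := t.weyl_pow_corootP w i
  rw [h] at h1
  have h2 := norm_pow_corootP_lt hr ht (isPos_simple b i)
  have h3 := norm_pow_corootP_lt hr ht ((isPos_negIdx b _).2 hi)
  rw [corootP_negIdx, t.pow_neg, ← h1, norm_inv] at h3
  have h4 : 0 < ‖t.pow (corootP Φ i)‖ := norm_pos_iff.2 (t.pow_ne_zero _)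
  rw [inv_lt_one₀ h4] at h3
  exact lt_asymm h2 h3

end TorusFunctions

/-! ### The length filtration and leading terms. -/

section Filtration

variable [Finite ι] [Nonempty ι] {Φ : RootPairing ι ℝ M N} {b : Φ.Base} [Φ.IsCrystallographic]
  [Φ.IsReduced] [Φ.IsIrreducible] {q : Option b.support → ℝ}

variable (b q) in
/-- The right `ℂ[P]`-submodule of the Hecke algebra spanned by the `T_w`, `w ∈ W₀`, with
`ℓ(w) < n`. -/
def lowSpan (n : ℕ) : Submodule ℂ (Hecke b q) :=
  Submodule.span ℂ {y | ∃ (v : weylGroup Φ) (f : LaurentAlg Φ), length b (finWeyl Φ v) < n ∧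
    y = T b q (finWeyl Φ v) * X b q f}

theorem T_mul_X_mem_lowSpan {n : ℕ} {v : weylGroup Φ} (h : length b (finWeyl Φ v) < n)
    (f : LaurentAlg Φ) : T b q (finWeyl Φ v) * X b q f ∈ lowSpan b q n :=
  Submodule.subset_span ⟨v, f, h, rfl⟩

theorem T_mem_lowSpan {n : ℕ} {v : weylGroup Φ} (h : length b (finWeyl Φ v) < n) :
    T b q (finWeyl Φ v) ∈ lowSpan b q n := by
  simpa using T_mul_X_mem_lowSpan (q := q) h 1

theorem lowSpan_mono {m n : ℕ} (h : m ≤ n) : lowSpan b q m ≤ lowSpan b q n :=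
  Submodule.span_mono fun _ ⟨v, f, hv, e⟩ => ⟨v, f, hv.trans_le h, e⟩

theorem length_finSimple_mul_le (i : b.support) (w : weylGroup Φ) :
    length b (finWeyl Φ (finSimple b i * w)) ≤ length b (finWeyl Φ w) + 1 := by
  by_cases h : b.IsPos (w⁻¹ • (i : ι))
  · exact (length_finSimple_mul b h).le
  · have := length_finSimple_mul' b h
    omega

theorem Ts_mul_mem_lowSpan {n : ℕ} {y : Hecke b q} (hy : y ∈ lowSpan b q n) (i : b.support) :
    Ts b q i * y ∈ lowSpan b q (n + 1) := by
  induction hy using Submodule.span_induction with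
  | mem _ h =>
    obtain ⟨v, f, hv, rfl⟩ := h
    have h1 := length_finSimple_mul_le i v
    rw [← mul_assoc]
    by_cases hp : b.IsPos (v⁻¹ • (i : ι))
    · rw [Ts_mul_T_pos hp]
      exact T_mul_X_mem_lowSpan (by omega) f
    · rw [Ts_mul_T_neg hp, add_mul, smul_mul_assoc]
      exact Submodule.add_mem _ (T_mul_X_mem_lowSpan (by omega) f)
        (Submodule.smul_mem _ _ (T_mul_X_mem_lowSpan (by omega) f))
  | zero => rw [mul_zero]; exact Submodule.zero_mem _
  | add y z _ _ hy hz => rw [mul_add]; exact Submodule.add_mem _ hy hz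
  | smul c y _ hy => rw [mul_smul_comm]; exact Submodule.smul_mem _ c hy

/-- Apply the Bernstein relation along a reduced word. The leading term twists μ by the simple
reflection, and the correction X(D) T_w stays below ℓ(s_i w) = ℓ(w) + 1. -/
theorem x_mul_T_sub_mem_lowSpan (w : weylGroup Φ) (μ : coweightLattice Φ) :
    x b q μ * T b q (finWeyl Φ w) - T b q (finWeyl Φ w) * x b q (weylAct Φ w⁻¹ μ) ∈
      lowSpan b q (length b (finWeyl Φ w)) := by
  induction w using weyl_induction b generalizing μ with
  | h1 =>
    rw [map_one, T_one, mul_one, one_mul, inv_one, weylAct_one, sub_self]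
    exact Submodule.zero_mem _
  | hs w i hw ih =>
    rw [length_finSimple_mul b hw]
    obtain ⟨D, -, hD⟩ := bernstein (q := q) i (weylAct Φ (finSimple b i) μ)
    rw [← weylAct_mul, finSimple_mul_self, weylAct_one, ← sub_eq_iff_eq_add] at hD
    have h1 : X b q D * T b q (finWeyl Φ w) ∈ lowSpan b q (length b (finWeyl Φ w) + 1) := by
      clear hD
      induction D using laurent_induction with
      | hm ν =>
        rw [X_mono, ← sub_add_cancel (x b q ν * _) (T b q (finWeyl Φ w) * x b q (weylAct Φ w⁻¹ ν))]
        refine Submodule.add_mem _ (lowSpan_mono (Nat.le_succ _) (ih ν)) ?_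
        rw [← X_mono]
        exact T_mul_X_mem_lowSpan (Nat.lt_succ_self _) _
      | ha f g hf hg => rw [map_add, add_mul]; exact Submodule.add_mem _ hf hg
      | hs c f hf => rw [map_smul, smul_mul_assoc]; exact Submodule.smul_mem _ c hf
    have h2 := Ts_mul_mem_lowSpan (ih (weylAct Φ (finSimple b i) μ)) i
    have e : x b q μ * T b q (finWeyl Φ (finSimple b i * w)) -
        T b q (finWeyl Φ (finSimple b i * w)) * x b q (weylAct Φ (finSimple b i * w)⁻¹ μ) =
        Ts b q i * (x b q (weylAct Φ (finSimple b i) μ) * T b q (finWeyl Φ w) -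
          T b q (finWeyl Φ w) * x b q (weylAct Φ w⁻¹ (weylAct Φ (finSimple b i) μ))) -
        kappa b q (some i) • (X b q D * T b q (finWeyl Φ w)) := by
      rw [← Ts_mul_T_pos hw, ← mul_assoc, ← hD, mul_inv_rev, finSimple_inv, ← weylAct_mul]
      simp only [sub_mul, mul_sub, mul_assoc, smul_mul_assoc]
      abel
    rw [e]
    exact Submodule.sub_mem _ h2 (Submodule.smul_mem _ _ h1)

theorem weylCoeff_eq_zero_of_mem_lowSpan (hq : IsReducedParameterSystem b q) {n : ℕ}
    {y : Hecke b q} (hy : y ∈ lowSpan b q n) {v : weylGroup Φ} (hv : n ≤ length b (finWeyl Φ v)) :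
    weylCoeff hq v y = 0 := by
  classical
  induction hy using Submodule.span_induction with
  | mem _ h =>
    obtain ⟨u, f, hu, rfl⟩ := h
    rw [weylCoeff_T_mul_X, if_neg]
    rintro rfl
    omega
  | zero => exact map_zero _
  | add y z _ _ hy hz => rw [map_add, hy, hz, add_zero]
  | smul c y _ hy => rw [map_smul, hy, smul_zero]

end Filtration

/-! ### Weight vectors, weight functionals and intertwiners. -/

section Weights

variable [Finite ι] [Nonempty ι] {Φ : RootPairing ι ℝ M N} {b : Φ.Base} [Φ.IsCrystallographic]
  [Φ.IsReduced] [Φ.IsIrreducible] {q : Option b.support → ℝ}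

variable (b q) in
/-- The scalar `κ_i / (1 - s^{-α_i^∨})`. -/
def intertwiner (s : Torus Φ) (i : b.support) : ℂ :=
  kappa b q (some i) / (1 - s.pow (-corootP Φ i))

theorem kappa_mul_ev {s : Torus Φ} (hs : s.IsRegular) {i : b.support} {D : LaurentAlg Φ}
    {μ ν : coweightLattice Φ} (hD : (1 - mono Φ (-corootP Φ i)) * D = mono Φ μ - mono Φ ν) :
    kappa b q (some i) * s.ev D = intertwiner b q s i * (s.pow μ - s.pow ν) := by
  have h := congrArg s.ev hD
  rw [map_mul, map_sub, map_sub, map_one, s.ev_mono, s.ev_mono, s.ev_mono] at h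
  rw [← h, intertwiner, ← mul_assoc, div_mul_cancel₀ _ (hs.one_sub_ne_zero i)]

section Vectors

variable {V : Type*} [AddCommGroup V] [Module (Hecke b q) V] [Module ℂ V]
  [IsScalarTower ℂ (Hecke b q) V]

/-- Weight vectors for the action of the `x^μ`. -/
def IsWeightVector (s : Torus Φ) (u : V) : Prop := ∀ μ, x b q μ • u = s.pow μ • u

theorem IsWeightVector.X_smul {s : Torus Φ} {u : V} (hu : IsWeightVector (q := q) s u)
    (f : LaurentAlg Φ) : X b q f • u = s.ev f • u := by
  induction f using laurent_induction with
  | hm μ => rw [X_mono, s.ev_mono]; exact hu μ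
  | ha f g hf hg => rw [map_add, add_smul, hf, hg, map_add, add_smul]
  | hs c f hf => rw [map_smul, smul_assoc, hf, map_smul, smul_assoc]

/-- On a vector of weight s the error term of the Bernstein relation is `intertwiner b q s i` times
a difference of two weights; subtracting this scalar from T_i cancels it. Regularity of s keeps the
scalar finite. -/
theorem IsWeightVector.intertwine {s : Torus Φ} (hs : s.IsRegular) {u : V}
    (hu : IsWeightVector (q := q) s u) (i : b.support) :
    IsWeightVector (q := q) (s.weyl (finSimple b i))
      ((Ts b q i - algebraMap ℂ _ (intertwiner b q s i)) • u) := by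
  intro μ
  obtain ⟨D, hD, hT⟩ := bernstein (q := q) i (weylAct Φ (finSimple b i) μ)
  rw [← weylAct_mul, finSimple_mul_self, weylAct_one] at hD hT
  have hc : ∀ (c : ℂ) (y : Hecke b q) (v : V), y • c • v = c • y • v := fun c y v => by
    rw [← algebraMap_smul (Hecke b q) c v, ← mul_smul, ← Algebra.commutes, mul_smul,
      algebraMap_smul]
  have h1 : x b q μ • Ts b q i • u = s.pow (weylAct Φ (finSimple b i) μ) • Ts b q i • u -
      (intertwiner b q s i * (s.pow (weylAct Φ (finSimple b i) μ) - s.pow μ)) • u := by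
    rw [← kappa_mul_ev hs hD, ← mul_smul, ← sub_eq_iff_eq_add.2 hT, sub_smul, mul_smul, hu,
      hc, smul_assoc, hu.X_smul, mul_smul]
  rw [sub_smul, algebraMap_smul, smul_sub, h1, hc, hu, Torus.weyl_pow, finSimple_inv, smul_sub,
    mul_sub, sub_smul, mul_smul, mul_smul, smul_comm (s.pow _) (intertwiner b q s i) u]
  abel

end Vectors

/-- Functionals of weight `s` for the left multiplication with the `x^μ`. -/
def IsLeftWeight (s : Torus Φ) (φ : Hecke b q →ₗ[ℂ] ℂ) : Prop :=
  ∀ μ h, φ (x b q μ * h) = s.pow μ * φ h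

/-- Functionals of weight `s` for the right multiplication with the `x^μ`. -/
def IsRightWeight (s : Torus Φ) (φ : Hecke b q →ₗ[ℂ] ℂ) : Prop :=
  ∀ μ h, φ (h * x b q μ) = s.pow μ * φ h

theorem IsLeftWeight.X_mul {s : Torus Φ} {φ : Hecke b q →ₗ[ℂ] ℂ} (hφ : IsLeftWeight s φ)
    (f : LaurentAlg Φ) (h : Hecke b q) : φ (X b q f * h) = s.ev f * φ h := by
  induction f using laurent_induction with
  | hm μ => rw [X_mono, s.ev_mono, hφ]
  | ha f g hf hg => rw [map_add, add_mul, map_add, hf, hg, map_add, add_mul]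
  | hs c f hf => rw [map_smul, smul_mul_assoc, map_smul, hf, map_smul, smul_eq_mul, smul_eq_mul,
      mul_assoc]

/-- The dual of the statement for weight vectors, with the same scalar. It changes left weights
without touching right weights. -/
theorem IsLeftWeight.intertwine {s : Torus Φ} (hs : s.IsRegular) {φ : Hecke b q →ₗ[ℂ] ℂ}
    (hφ : IsLeftWeight s φ) (i : b.support) :
    IsLeftWeight (s.weyl (finSimple b i))
      (φ ∘ₗ LinearMap.mulLeft ℂ (Ts b q i - algebraMap ℂ _ (intertwiner b q s i))) := by
  intro μ h
  obtain ⟨D, hD, hT⟩ := bernstein (q := q) i μ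
  simp only [LinearMap.comp_apply, LinearMap.mulLeft_apply, sub_mul, map_sub]
  rw [← mul_assoc, hT, add_mul, map_add, mul_assoc, hφ, smul_mul_assoc, map_smul, hφ.X_mul,
    smul_eq_mul, ← mul_assoc, kappa_mul_ev hs hD, ← Algebra.smul_def, ← Algebra.smul_def,
    map_smul, map_smul, hφ, Torus.weyl_pow, finSimple_inv, smul_eq_mul, smul_eq_mul]
  ring

theorem IsRightWeight.comp_mulLeft {s : Torus Φ} {φ : Hecke b q →ₗ[ℂ] ℂ} (hφ : IsRightWeight s φ)
    (y : Hecke b q) : IsRightWeight s (φ ∘ₗ LinearMap.mulLeft ℂ y) := fun μ h => by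
  simp only [LinearMap.comp_apply, LinearMap.mulLeft_apply, ← mul_assoc]
  exact hφ μ _

end Weights

/-! ### Bases and characters of V(t). -/

section PrincipalSeries

variable [Finite ι] [Nonempty ι] {Φ : RootPairing ι ℝ M N} {b : Φ.Base} [Φ.IsCrystallographic]
  [Φ.IsReduced] [Φ.IsIrreducible] {q : Option b.support → ℝ}

variable (b q) in
/-- The image of `h` in `V(t)`. -/
def toPrincipal (t : Torus Φ) : Hecke b q →ₗ[ℂ] PrincipalSeries b q t :=
  (principalIdeal b q t).mkQ.restrictScalars ℂ

theorem toPrincipal_surjective (t : Torus Φ) : Function.Surjective (toPrincipal b q t) := fun m => by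
  obtain ⟨h, hh⟩ := (principalIdeal b q t).mkQ_surjective m
  exact ⟨h, hh⟩

theorem toPrincipal_mul (t : Torus Φ) (h y : Hecke b q) :
    toPrincipal b q t (h * y) = h • toPrincipal b q t y := rfl

theorem isWeightVector_one (t : Torus Φ) : IsWeightVector (q := q) t (toPrincipal b q t 1) := by
  intro μ
  have h : toPrincipal b q t (x b q μ) =
      toPrincipal b q t (algebraMap ℂ (Hecke b q) (t.pow μ)) :=
    (Submodule.Quotient.eq _).2 (Submodule.subset_span ⟨μ, rfl⟩)
  rw [← toPrincipal_mul, mul_one, h, Algebra.algebraMap_eq_smul_one, map_smul]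

theorem toPrincipal_mul_X (t : Torus Φ) (h : Hecke b q) (f : LaurentAlg Φ) :
    toPrincipal b q t (h * X b q f) = t.ev f • toPrincipal b q t h := by
  rw [← mul_one (X b q f), ← mul_assoc, mul_assoc, toPrincipal_mul, toPrincipal_mul,
    (isWeightVector_one t).X_smul, ← map_smul, ← toPrincipal_mul, mul_smul_comm, mul_one, map_smul]

/-- Functionals of right weight `t` factor through `V(t)`. -/
theorem IsRightWeight.exists_descend {t : Torus Φ} {φ : Hecke b q →ₗ[ℂ] ℂ}
    (hφ : IsRightWeight t φ) :
    ∃ ψ : PrincipalSeries b q t →ₗ[ℂ] ℂ, ∀ h, ψ (toPrincipal b q t h) = φ h := by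
  have hk : ∀ y ∈ principalIdeal b q t, ∀ h, φ (h * y) = 0 := by
    intro y hy
    induction hy using Submodule.span_induction with
    | mem _ hy =>
      obtain ⟨μ, rfl⟩ := hy
      intro h
      rw [mul_sub, map_sub, hφ, ← Algebra.commutes, ← Algebra.smul_def, map_smul, smul_eq_mul,
        sub_self]
    | zero => intro h; rw [mul_zero, map_zero]
    | add y z _ _ hy hz => intro h; rw [mul_add, map_add, hy, hz, add_zero]
    | smul a y _ hy => intro h; rw [smul_eq_mul, ← mul_assoc]; exact hy _
  refine ⟨((principalIdeal b q t).restrictScalars ℂ).liftQ φ (fun y hy => ?_) ∘ₗ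
    (Submodule.Quotient.restrictScalarsEquiv ℂ (principalIdeal b q t)).symm.toLinearMap,
    fun h => rfl⟩
  have := hk y hy 1
  rwa [one_mul] at this

/-- The functional "coefficient of `T_w v_t`" on the Hecke algebra. -/
def evCoeff (hq : IsReducedParameterSystem b q) (t : Torus Φ) (w : weylGroup Φ) :
    Hecke b q →ₗ[ℂ] ℂ := t.ev.toLinearMap ∘ₗ weylCoeff hq w

theorem isRightWeight_evCoeff (hq : IsReducedParameterSystem b q) (t : Torus Φ)
    (w : weylGroup Φ) : IsRightWeight t (evCoeff hq t w) := fun μ h => by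
  rw [← X_mono]
  simp only [evCoeff, LinearMap.comp_apply, weylCoeff_mul_X, AlgHom.toLinearMap_apply, map_mul,
    Torus.ev_mono]
  exact mul_comm _ _

open Classical in
theorem evCoeff_T (hq : IsReducedParameterSystem b q) (t : Torus Φ) (w v : weylGroup Φ) :
    evCoeff hq t w (T b q (finWeyl Φ v)) = if v = w then 1 else 0 := by
  have := weylCoeff_T_mul_X hq w v 1
  rw [map_one, mul_one] at this
  rw [evCoeff, LinearMap.comp_apply, this]
  split_ifs <;> simp

theorem toPrincipal_eq_sum [Fintype (weylGroup Φ)] (hq : IsReducedParameterSystem b q)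
    (t : Torus Φ) (h : Hecke b q) : toPrincipal b q t h =
      ∑ w, evCoeff hq t w h • toPrincipal b q t (T b q (finWeyl Φ w)) := by
  conv_lhs => rw [eq_sum_weylCoeff hq h, map_sum]
  exact Finset.sum_congr rfl fun w _ => toPrincipal_mul_X t _ _

/-- The coordinates on `V(t)` with respect to the `T_w v_t`. -/
def principalCoord (hq : IsReducedParameterSystem b q) (t : Torus Φ) (w : weylGroup Φ) :
    PrincipalSeries b q t →ₗ[ℂ] ℂ := (isRightWeight_evCoeff hq t w).exists_descend.choose

theorem principalCoord_toPrincipal (hq : IsReducedParameterSystem b q) (t : Torus Φ)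
    (w : weylGroup Φ) (h : Hecke b q) :
    principalCoord hq t w (toPrincipal b q t h) = evCoeff hq t w h :=
  (isRightWeight_evCoeff hq t w).exists_descend.choose_spec h

open Classical in
/-- The basis `T_w v_t`, `w ∈ W₀`, of `V(t)`. -/
def principalBasis (hq : IsReducedParameterSystem b q) (t : Torus Φ) :
    Module.Basis (weylGroup Φ) ℂ (PrincipalSeries b q t) :=
  letI := Fintype.ofFinite (weylGroup Φ)
  Module.Basis.ofEquivFun (LinearEquiv.ofLinearMap (LinearMap.pi (principalCoord hq t))
    (Fintype.linearCombination ℂ fun w => toPrincipal b q t (T b q (finWeyl Φ w)))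
    (by
      refine LinearMap.pi_ext' fun w => LinearMap.ext_ring (funext fun v => ?_)
      change principalCoord hq t v (Fintype.linearCombination ℂ _ (Pi.single w 1)) =
        (Pi.single w 1 : weylGroup Φ → ℂ) v
      rw [Fintype.linearCombination_apply_single, one_smul, principalCoord_toPrincipal, evCoeff_T,
        Pi.single_apply]
      simp only [eq_comm])
    (by
      refine LinearMap.ext fun m => ?_
      obtain ⟨h, rfl⟩ := toPrincipal_surjective t m
      rw [LinearMap.comp_apply, Fintype.linearCombination_apply, LinearMap.id_apply]
      conv_rhs => rw [toPrincipal_eq_sum hq t h]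
      refine Finset.sum_congr rfl fun w _ => ?_
      rw [LinearMap.pi_apply, principalCoord_toPrincipal]))

theorem principalBasis_repr (hq : IsReducedParameterSystem b q) (t : Torus Φ)
    (h : Hecke b q) (w : weylGroup Φ) :
    (principalBasis hq t).repr (toPrincipal b q t h) w = evCoeff hq t w h := by
  rw [principalBasis, Module.Basis.ofEquivFun_repr_apply]
  exact principalCoord_toPrincipal hq t w h

theorem principalBasis_apply (hq : IsReducedParameterSystem b q) (t : Torus Φ)
    (w : weylGroup Φ) : principalBasis hq t w = toPrincipal b q t (T b q (finWeyl Φ w)) := by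
  classical
  refine (principalBasis hq t).repr.injective (Finsupp.ext fun v => ?_)
  rw [principalBasis_repr, evCoeff_T, Module.Basis.repr_self, Finsupp.single_apply]

theorem finiteDimensional_principalSeries (hq : IsReducedParameterSystem b q) (t : Torus Φ) :
    FiniteDimensional ℂ (PrincipalSeries b q t) := Module.Finite.of_basis (principalBasis hq t)

/-- In the basis T_w v_t the diagonal entries are the coefficients of T_w in h T_w, which are
Laurent polynomials independent of t, evaluated at t. -/
theorem exists_ev_eq_χ (hq : IsReducedParameterSystem b q) (h : Hecke b q) :
    ∃ f : LaurentAlg Φ, ∀ t : Torus Φ, χ b q t h = t.ev f := by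
  classical
  have := Fintype.ofFinite (weylGroup Φ)
  refine ⟨∑ w, weylCoeff hq w (h * T b q (finWeyl Φ w)), fun t => ?_⟩
  rw [χ, LinearMap.trace_eq_matrix_trace ℂ (principalBasis hq t), Matrix.trace, map_sum]
  refine Finset.sum_congr rfl fun w _ => ?_
  rw [Matrix.diag_apply, LinearMap.toMatrix_apply, principalBasis_apply]
  exact principalBasis_repr hq t (h * T b q (finWeyl Φ w)) w

/-- Apply intertwiners along a reduced word of w. Each is T_i minus a scalar, so T_w stays the
leading term; this triangularity makes the resulting vectors a basis. -/
theorem exists_weight_element {t : Torus Φ} (ht : t.IsRegular) (w : weylGroup Φ) :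
    ∃ y : Hecke b q, y - T b q (finWeyl Φ w) ∈ lowSpan b q (length b (finWeyl Φ w)) ∧
      IsWeightVector (q := q) (t.weyl w) (toPrincipal b q t y) := by
  induction w using weyl_induction b with
  | h1 =>
    refine ⟨1, ?_, ?_⟩
    · rw [map_one, T_one, sub_self]; exact Submodule.zero_mem _
    · rw [Torus.weyl_one]; exact isWeightVector_one t
  | hs w i hw ih =>
    obtain ⟨y, hy, hwt⟩ := ih
    refine ⟨(Ts b q i - algebraMap ℂ _ (intertwiner b q (t.weyl w) i)) * y, ?_, ?_⟩
    · rw [length_finSimple_mul b hw, ← Ts_mul_T_pos hw]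
      have e : (Ts b q i - algebraMap ℂ _ (intertwiner b q (t.weyl w) i)) * y -
          Ts b q i * T b q (finWeyl Φ w) = Ts b q i * (y - T b q (finWeyl Φ w)) -
            intertwiner b q (t.weyl w) i • ((y - T b q (finWeyl Φ w)) + T b q (finWeyl Φ w)) := by
        rw [sub_add_cancel, Algebra.smul_def, sub_mul, mul_sub]; abel
      rw [e]
      refine Submodule.sub_mem _ (Ts_mul_mem_lowSpan hy i) (Submodule.smul_mem _ _ ?_)
      exact Submodule.add_mem _ (lowSpan_mono (Nat.le_succ _) hy) (T_mem_lowSpan (Nat.lt_succ_self _))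
    · rw [Torus.weyl_mul, toPrincipal_mul]
      exact hwt.intertwine (ht.weyl w) i

theorem exists_weightBasis (hq : IsReducedParameterSystem b q) {t : Torus Φ} (ht : t.IsRegular) :
    ∃ u : Module.Basis (weylGroup Φ) ℂ (PrincipalSeries b q t),
      u 1 = toPrincipal b q t 1 ∧ ∀ w, IsWeightVector (q := q) (t.weyl w) (u w) := by
  have := Fintype.ofFinite (weylGroup Φ)
  choose y hy hwt using fun w => exists_weight_element (b := b) (q := q) ht w
  have hspan : ∀ w, toPrincipal b q t (T b q (finWeyl Φ w)) ∈
      Submodule.span ℂ (Set.range fun w => toPrincipal b q t (y w)) := by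
    intro w
    induction hn : length b (finWeyl Φ w) using Nat.strong_induction_on generalizing w with
    | _ n ih =>
      have e : T b q (finWeyl Φ w) = y w - (y w - T b q (finWeyl Φ w)) := by abel
      rw [e, map_sub]
      refine Submodule.sub_mem _ (Submodule.subset_span ⟨w, rfl⟩) ?_
      have h1 := hy w
      rw [hn] at h1
      generalize y w - T b q (finWeyl Φ w) = z at h1
      induction h1 using Submodule.span_induction with
      | mem _ h =>
        obtain ⟨v, f, hv, rfl⟩ := h
        rw [toPrincipal_mul_X]
        exact Submodule.smul_mem _ _ (ih _ hv v rfl)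
      | zero => rw [map_zero]; exact Submodule.zero_mem _
      | add y z _ _ hy hz => rw [map_add]; exact Submodule.add_mem _ hy hz
      | smul c y _ hy => rw [map_smul]; exact Submodule.smul_mem _ c hy
  have htop : ⊤ ≤ Submodule.span ℂ (Set.range fun w => toPrincipal b q t (y w)) := by
    rw [← (principalBasis hq t).span_eq, Submodule.span_le]
    rintro _ ⟨w, rfl⟩
    rw [principalBasis_apply]
    exact hspan w
  refine ⟨basisOfTopLeSpanOfCardEqFinrank _ htop
    (Module.finrank_eq_card_basis (principalBasis hq t)).symm, ?_, fun w => ?_⟩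
  · rw [coe_basisOfTopLeSpanOfCardEqFinrank]
    have h1 := hy 1
    have h0 : length b (1 : ExtAffineWeyl Φ) = 0 := by
      have := length_mul_of_forall b (u := 1) (v := (1 : ExtAffineWeyl Φ))
        fun a ha ha' => absurd ha (by rwa [act_one] at ha')
      rw [mul_one] at this
      omega
    rw [map_one, h0, T_one] at h1
    -- For w = 1 there are no lower terms, so the weight element is exactly 1.
    have hbot : lowSpan b q 0 = ⊥ := by
      rw [lowSpan, eq_bot_iff, Submodule.span_le]
      rintro _ ⟨v, f, hv, -⟩
      exact absurd hv (Nat.not_lt_zero _)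
    rw [hbot, Submodule.mem_bot, sub_eq_zero] at h1
    exact congrArg _ h1
  · rw [coe_basisOfTopLeSpanOfCardEqFinrank]
    exact hwt w

end PrincipalSeries

/-! ### Functionals with left and right weight t, and the generic character formula. -/

section Densities

variable [Finite ι] [Nonempty ι] {Φ : RootPairing ι ℝ M N} {b : Φ.Base} [Φ.IsCrystallographic]
  [Φ.IsReduced] [Φ.IsIrreducible] {q : Option b.support → ℝ}

/-- Functionals with left and right weight `s` are determined by their value at `1`. -/
theorem IsLeftWeight.ext (hq : IsReducedParameterSystem b q) {s : Torus Φ} (hs : s.IsRegular)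
    (hs' : ∀ w : weylGroup Φ, w ≠ 1 → s.weyl w ≠ s) {φ φ' : Hecke b q →ₗ[ℂ] ℂ}
    (hl : IsLeftWeight s φ) (hr : IsRightWeight s φ) (hl' : IsLeftWeight s φ')
    (hr' : IsRightWeight s φ') (h1 : φ 1 = φ' 1) : φ = φ' := by
  obtain ⟨ψ, hψ⟩ := hr.exists_descend
  obtain ⟨ψ', hψ'⟩ := hr'.exists_descend
  obtain ⟨u, hu1, hu⟩ := exists_weightBasis hq hs
  -- A functional of left weight s vanishes on every vector whose weight differs from s.
  have hzero : ∀ (φ : Hecke b q →ₗ[ℂ] ℂ) (ψ : PrincipalSeries b q s →ₗ[ℂ] ℂ),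
      IsLeftWeight s φ → (∀ h, ψ (toPrincipal b q s h) = φ h) → ∀ w ≠ 1, ψ (u w) = 0 := by
    intro φ ψ hl hψ w hw
    obtain ⟨μ, hμ⟩ : ∃ μ, (s.weyl w).pow μ ≠ s.pow μ := by
      by_contra! h
      exact hs' w hw (Torus.ext_pow h)
    obtain ⟨h, hh⟩ := toPrincipal_surjective s (u w)
    have e1 := congrArg ψ (hu w μ)
    rw [← hh, ← toPrincipal_mul, hψ, hl, map_smul, hψ, smul_eq_mul] at e1
    rw [← hh, hψ]
    by_contra h0
    exact hμ (mul_right_cancel₀ h0 e1).symm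
  have : ψ = ψ' := u.ext fun w => by
    by_cases hw : w = 1
    · rw [hw, hu1, hψ, hψ', h1]
    · rw [hzero φ ψ hl hψ w hw, hzero φ' ψ' hl' hψ' w hw]
  ext h
  rw [← hψ, this, hψ']

open Classical in
variable (b) in
/-- The positive roots which are mapped to negative roots by `w`. -/
def negSet (w : weylGroup Φ) : Finset ι :=
  (Set.toFinite {k | b.IsPos k ∧ ¬ b.IsPos (w • k)}).toFinset

theorem mem_negSet {w : weylGroup Φ} {k : ι} :
    k ∈ negSet b w ↔ b.IsPos k ∧ ¬ b.IsPos (w • k) := by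
  simp [negSet]

open Classical in
theorem negSet_finSimple_mul {w : weylGroup Φ} {i : b.support} (h : b.IsPos (w⁻¹ • (i : ι))) :
    negSet b (finSimple b i * w) = insert (w⁻¹ • (i : ι)) (negSet b w) := by
  ext k
  rw [Finset.mem_insert, mem_negSet, mem_negSet, mul_smul]
  by_cases hk : w • k = i
  · have hk' : k = w⁻¹ • (i : ι) := by rw [← hk, inv_smul_smul]
    refine iff_of_true ⟨hk' ▸ h, ?_⟩ (Or.inl hk')
    rw [hk, finSimple_smul_self, isPos_negIdx, not_not]
    exact isPos_simple b i
  · have hk' : k ≠ w⁻¹ • (i : ι) := fun h => hk (by rw [h, smul_inv_smul])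
    rw [or_iff_right hk']
    refine and_congr_right fun hp => not_congr (isPos_reflection_iff b i hk fun h2 => ?_)
    have : k = negIdx Φ (w⁻¹ • (i : ι)) := by rw [← smul_negIdx, ← h2, inv_smul_smul]
    exact (isPos_negIdx b _).1 (this ▸ hp) h

variable (Φ) in
/-- The product of the factors `1 - x^{-α^∨}` over a set of roots. -/
def rootProd (s : Finset ι) : LaurentAlg Φ := ∏ k ∈ s, (1 - mono Φ (-corootP Φ k))

-- Y_t is a product of intertwiners along a reduced word of w. Each new factor has a single pole,
-- along the root added to `negSet`, so one factor 1 - t^{-β^∨} per inversion clears the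
-- denominators. The last clause quantifies over all ψ so that, in the induction, left
-- multiplication by T_i can be absorbed into ψ.
variable (b q) in
theorem exists_intertwining_element (w : weylGroup Φ) : ∃ Y : Torus Φ → Hecke b q,
    (∀ t, Y t - T b q (finWeyl Φ w) ∈ lowSpan b q (length b (finWeyl Φ w))) ∧
    (∀ t : Torus Φ, t.IsRegular → ∀ φ, IsLeftWeight (t.weyl w) φ →
      IsLeftWeight t (φ ∘ₗ LinearMap.mulLeft ℂ (Y t))) ∧
    ∀ ψ : Hecke b q →ₗ[ℂ] LaurentAlg Φ, ∃ f : LaurentAlg Φ, ∀ t : Torus Φ, t.IsRegular →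
      t.ev (rootProd Φ (negSet b w)) * t.ev (ψ (Y t)) = t.ev f := by
  classical
  induction w using weyl_induction b with
  | h1 =>
    refine ⟨fun _ => 1, fun t => ?_, fun t _ φ hφ => ?_, fun ψ => ?_⟩
    · rw [map_one, T_one, sub_self]; exact Submodule.zero_mem _
    · rw [Torus.weyl_one] at hφ
      rwa [LinearMap.mulLeft_one, LinearMap.comp_id]
    · exact ⟨rootProd Φ (negSet b 1) * ψ 1, fun t _ => (map_mul _ _ _).symm⟩
  | hs w i hw ih =>
    obtain ⟨Y, hY, hφ, hψ⟩ := ih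
    refine ⟨fun t => (Ts b q i - algebraMap ℂ _ (intertwiner b q (t.weyl (finSimple b i * w)) i)) *
      Y t, fun t => ?_, fun t ht φ hl => ?_, fun ψ => ?_⟩
    · rw [length_finSimple_mul b hw, ← Ts_mul_T_pos hw]
      beta_reduce
      generalize intertwiner b q (t.weyl (finSimple b i * w)) i = c
      have e : (Ts b q i - algebraMap ℂ _ c) * Y t - Ts b q i * T b q (finWeyl Φ w) =
          Ts b q i * (Y t - T b q (finWeyl Φ w)) -
            c • ((Y t - T b q (finWeyl Φ w)) + T b q (finWeyl Φ w)) := by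
        rw [sub_add_cancel, Algebra.smul_def, sub_mul, mul_sub]; abel
      rw [e]
      refine Submodule.sub_mem _ (Ts_mul_mem_lowSpan (hY t) i) (Submodule.smul_mem _ _ ?_)
      exact Submodule.add_mem _ (lowSpan_mono (Nat.le_succ _) (hY t))
        (T_mem_lowSpan (Nat.lt_succ_self _))
    · have h1 := hl.intertwine (ht.weyl _) i
      rw [← Torus.weyl_mul, ← mul_assoc, finSimple_mul_self, one_mul] at h1
      have h2 := hφ t ht _ h1
      rwa [LinearMap.comp_assoc, ← LinearMap.mulLeft_mul] at h2
    · set β := w⁻¹ • (i : ι) with hβ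
      obtain ⟨f, hf⟩ := hψ (ψ ∘ₗ LinearMap.mulLeft ℂ (Ts b q i))
      obtain ⟨g, hg⟩ := hψ ψ
      refine ⟨(1 - mono Φ (-corootP Φ β)) * f + kappa b q (some i) • (mono Φ (-corootP Φ β) * g),
        fun t ht => ?_⟩
      have hnot : β ∉ negSet b w := by
        rw [mem_negSet, hβ, smul_inv_smul]
        exact fun h => h.2 (isPos_simple b i)
      -- At the point s_i w t the denominator of the intertwiner is 1 - t^{β^∨} with β = w⁻¹α_i,
      -- which is -t^{β^∨}(1 - t^{-β^∨}).
      have hc : (1 - t.pow (-corootP Φ β)) * intertwiner b q (t.weyl (finSimple b i * w)) i =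
          -(kappa b q (some i) * t.pow (-corootP Φ β)) := by
        have e : (t.weyl (finSimple b i * w)).pow (-corootP Φ i) = t.pow (corootP Φ β) := by
          rw [← corootP_negIdx, Torus.weyl_pow_corootP, smul_negIdx, mul_inv_rev, finSimple_inv,
            mul_smul, finSimple_smul_self, smul_negIdx, negIdx_negIdx]
        have h1 : 1 - t.pow (corootP Φ β) ≠ 0 := sub_ne_zero.2 (ht β).symm
        have h2 := t.pow_ne_zero (corootP Φ β)
        rw [intertwiner, e, t.pow_neg]
        field_simp
        ring
      have hf' := hf t ht
      have hg' := hg t ht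
      rw [LinearMap.comp_apply, LinearMap.mulLeft_apply] at hf'
      have e1 : t.ev (ψ ((Ts b q i - algebraMap ℂ _
          (intertwiner b q (t.weyl (finSimple b i * w)) i)) * Y t)) = t.ev (ψ (Ts b q i * Y t)) -
            intertwiner b q (t.weyl (finSimple b i * w)) i * t.ev (ψ (Y t)) := by
        rw [sub_mul, ← Algebra.smul_def, map_sub, map_sub, map_smul, map_smul, smul_eq_mul]
      have e2 : t.ev ((1 - mono Φ (-corootP Φ β)) * f +
          kappa b q (some i) • (mono Φ (-corootP Φ β) * g)) = (1 - t.pow (-corootP Φ β)) * t.ev f +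
            kappa b q (some i) * (t.pow (-corootP Φ β) * t.ev g) := by
        rw [map_add, map_smul, map_mul, map_mul, map_sub, map_one, Torus.ev_mono, smul_eq_mul]
      have e3 : t.ev (rootProd Φ (negSet b (finSimple b i * w))) =
          (1 - t.pow (-corootP Φ β)) * t.ev (rootProd Φ (negSet b w)) := by
        rw [negSet_finSimple_mul hw, rootProd, Finset.prod_insert hnot, ← rootProd, map_mul,
          map_sub, map_one, Torus.ev_mono]
      beta_reduce
      rw [e1, e2, e3, ← hf', ← hg']
      linear_combination (-(t.ev (rootProd Φ (negSet b w)) * t.ev (ψ (Y t)))) * hc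

/-- Modulo shorter terms, x^μ T_v is T_v x^{v⁻¹μ}. When w has maximal length the shorter terms never
contain T_w, so its coefficient sees only the leading term for v = w. -/
theorem isLeftWeight_evCoeff (hq : IsReducedParameterSystem b q) (t : Torus Φ) {w : weylGroup Φ}
    (hw : ∀ v : weylGroup Φ, length b (finWeyl Φ v) ≤ length b (finWeyl Φ w)) :
    IsLeftWeight (t.weyl w) (evCoeff hq t w) := by
  classical
  intro μ h
  induction h using bernstein_induction with
  | hm v f =>
    have h1 := weylCoeff_eq_zero_of_mem_lowSpan hq (x_mul_T_sub_mem_lowSpan (q := q) v μ) (hw v)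
    rw [map_sub, sub_eq_zero, ← X_mono, ← X_mono, weylCoeff_T_mul_X] at h1
    rw [← X_mono]
    simp only [evCoeff, LinearMap.comp_apply, AlgHom.toLinearMap_apply]
    rw [← mul_assoc, weylCoeff_mul_X, h1, weylCoeff_T_mul_X]
    split_ifs with hv
    · rw [map_mul, Torus.ev_mono, Torus.weyl_pow, hv]
    · simp
  | ha y z hy hz => rw [mul_add, map_add, hy, hz, map_add, mul_add]
  | hs c y hy => rw [mul_smul_comm, map_smul, hy, map_smul, smul_eq_mul, smul_eq_mul]; ring

/-- Start from the coefficient of T_w with w longest, which has right weight t and left weight wt,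
and precompose with left multiplication by Y_t to make the left weight t. The value at 1 is the
leading coefficient of Y_t, namely 1. -/
theorem exists_biweight (hq : IsReducedParameterSystem b q) :
    ∃ f : Torus Φ → Hecke b q →ₗ[ℂ] ℂ, (∀ t : Torus Φ, t.IsRegular →
      IsLeftWeight t (f t) ∧ IsRightWeight t (f t) ∧ f t 1 = 1) ∧
      ∀ h, ∃ p : LaurentAlg Φ, ∀ t : Torus Φ, t.IsRegular → d b t * f t h = t.ev p := by
  classical
  obtain ⟨w, hw⟩ := Finite.exists_max fun w : weylGroup Φ => length b (finWeyl Φ w)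
  obtain ⟨Y, hY, hφ, hψ⟩ := exists_intertwining_element b q w
  refine ⟨fun t => evCoeff hq t w ∘ₗ LinearMap.mulLeft ℂ (Y t), fun t ht =>
    ⟨hφ t ht _ (isLeftWeight_evCoeff hq t hw), (isRightWeight_evCoeff hq t w).comp_mulLeft _, ?_⟩,
    fun h => ?_⟩
  · rw [LinearMap.comp_apply, LinearMap.mulLeft_apply, mul_one,
      ← sub_add_cancel (Y t) (T b q (finWeyl Φ w)), map_add, evCoeff_T, if_pos rfl, evCoeff,
      LinearMap.comp_apply, weylCoeff_eq_zero_of_mem_lowSpan hq (hY t) le_rfl, map_zero, zero_add]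
  · obtain ⟨p, hp⟩ := hψ (weylCoeff hq w ∘ₗ LinearMap.mulRight ℂ h)
    -- Only the inclusion of `negSet b w` in the positive roots is used; the factors of d over any
    -- remaining positive roots are put into the numerator.
    refine ⟨rootProd Φ ((Set.toFinite {i | b.IsPos i}).toFinset \ negSet b w) * p, fun t ht => ?_⟩
    have hsub : negSet b w ⊆ (Set.toFinite {i | b.IsPos i}).toFinset := fun k hk => by
      simpa using (mem_negSet.1 hk).1
    have hd : dLaurent b = rootProd Φ ((Set.toFinite {i | b.IsPos i}).toFinset \ negSet b w) *
        rootProd Φ (negSet b w) := (Finset.prod_sdiff hsub).symm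
    rw [d_eq_ev, hd, map_mul, map_mul, ← hp t ht, mul_assoc]
    rfl

/-- The character formula at generic points. -/
theorem χ_eq_sum_of_generic [Fintype (weylGroup Φ)] (hq : IsReducedParameterSystem b q)
    {f : Torus Φ → Hecke b q →ₗ[ℂ] ℂ}
    (hf : ∀ t : Torus Φ, t.IsRegular → IsLeftWeight t (f t) ∧ IsRightWeight t (f t) ∧ f t 1 = 1)
    {t : Torus Φ} (ht : t.IsRegular) (ht' : ∀ w : weylGroup Φ, w ≠ 1 → t.weyl w ≠ t)
    (h : Hecke b q) : χ b q t h = ∑ w : weylGroup Φ, f (t.weyl w) h := by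
  classical
  obtain ⟨u, -, hu⟩ := exists_weightBasis hq ht
  rw [χ, LinearMap.trace_eq_matrix_trace ℂ u, Matrix.trace]
  refine Finset.sum_congr rfl fun w _ => ?_
  rw [Matrix.diag_apply, LinearMap.toMatrix_apply]
  -- The diagonal matrix coefficient at u_w has both weights equal to wt and value 1 at 1, so
  -- uniqueness identifies it with f at wt.
  set φ : Hecke b q →ₗ[ℂ] ℂ := u.coord w ∘ₗ (LinearMap.toSpanSingleton (Hecke b q)
    (PrincipalSeries b q t) (u w)).restrictScalars ℂ with hφ
  have hφa : ∀ h, φ h = u.coord w (h • u w) := fun h => rfl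
  obtain ⟨hl, hr, h1⟩ := hf _ (ht.weyl w)
  have hlφ : IsLeftWeight (t.weyl w) φ := by
    intro μ h
    rw [hφa, hφa, mul_smul]
    generalize h • u w = m
    have : u.coord w ∘ₗ (principalRep b q t (x b q μ)) = (t.weyl w).pow μ • u.coord w :=
      u.ext fun v => by
        have : principalRep b q t (x b q μ) (u v) = x b q μ • u v := rfl
        rw [LinearMap.comp_apply, this, hu v μ, map_smul, LinearMap.smul_apply,
          Module.Basis.coord_apply, Module.Basis.repr_self, Finsupp.single_apply]
        split_ifs with hvw
        · rw [hvw]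
        · simp
    exact congrArg (fun g => g m) this
  have hrφ : IsRightWeight (t.weyl w) φ := by
    intro μ h
    rw [hφa, hφa, mul_smul, hu w μ, ← algebraMap_smul (Hecke b q) ((t.weyl w).pow μ) (u w),
      ← mul_smul, ← Algebra.commutes, mul_smul, algebraMap_smul, map_smul, smul_eq_mul]
  have h1φ : φ 1 = 1 := by
    rw [hφa, one_smul, Module.Basis.coord_apply, Module.Basis.repr_self, Finsupp.single_eq_same]
  -- The stabiliser of wt is conjugate to that of t, hence also trivial.
  have hgen : ∀ v : weylGroup Φ, v ≠ 1 → (t.weyl w).weyl v ≠ t.weyl w := by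
    intro v hv e
    refine ht' (w⁻¹ * v * w) (fun e2 => hv ?_) ?_
    · rw [mul_assoc, inv_mul_eq_one] at e2
      exact mul_eq_right.1 e2.symm
    · rw [mul_assoc, Torus.weyl_mul, Torus.weyl_mul, e, ← Torus.weyl_mul, inv_mul_cancel,
        Torus.weyl_one]
  have := IsLeftWeight.ext hq (ht.weyl w) hgen hlφ hrφ hl hr (h1φ.trans h1.symm)
  exact congrArg (fun g => g h) this

end Densities

/-! ### Vanishing of the trace outside the cone of negative coroots. -/

section Support

variable [Finite ι] [Nonempty ι] {Φ : RootPairing ι ℝ M N} {b : Φ.Base} [Φ.IsCrystallographic]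
  [Φ.IsReduced] [Φ.IsIrreducible]

variable (b) in
open Classical in
/-- The invariant quadratic form `∑ ⟨μ, α⟩²`, summed over the positive roots. -/
def posSq (μ : coweightLattice Φ) : ℤ :=
  ∑ k ∈ (Set.toFinite {k | b.IsPos k}).toFinset, pair Φ k μ ^ 2

theorem posSq_finSimple (i : b.support) (μ : coweightLattice Φ) :
    posSq b (weylAct Φ (finSimple b i) μ) = posSq b μ := by
  classical
  have hinv : ∀ k : ι, finSimple b i • finSimple b i • k = k := fun k => by
    rw [← mul_smul, finSimple_mul_self, one_smul]
  have hpair : ∀ k : ι, pair Φ k (weylAct Φ (finSimple b i) μ) = pair Φ (finSimple b i • k) μ := by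
    intro k
    conv_rhs => rw [← weylAct_inv_weylAct Φ (finSimple b i) μ, finSimple_inv, pair_smul]
  set p : ι → ι := fun k => if k = i then k else finSimple b i • k with hp
  have hmem : ∀ k ∈ (Set.toFinite {k | b.IsPos k}).toFinset,
      p k ∈ (Set.toFinite {k | b.IsPos k}).toFinset := by
    intro k hk
    simp only [Set.Finite.mem_toFinset, Set.mem_ofPred_eq] at hk ⊢
    rw [hp]
    dsimp only
    split_ifs with h
    · exact hk
    · exact isPos_reflection b hk i h
  have hpp : ∀ k ∈ (Set.toFinite {k | b.IsPos k}).toFinset, p (p k) = k := by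
    intro k hk
    simp only [Set.Finite.mem_toFinset, Set.mem_ofPred_eq] at hk
    by_cases h : k = i
    · simp [hp, h]
    · have h2 : finSimple b i • k ≠ i := fun h3 => by
        have h4 : k = negIdx Φ i := by rw [← finSimple_smul_self, ← h3, hinv]
        exact (isPos_negIdx b _).1 (h4 ▸ hk) (isPos_simple b i)
      simp [hp, h, h2, hinv]
  refine Finset.sum_nbij' p p hmem hmem hpp hpp fun k _ => ?_
  by_cases h : k = i
  · simp [hp, h, pair_finSimple]
  · simp [hp, h, hpair]

/-- Along the α_i-string, m ↦ `posSq` at μ + mα_i^∨ is a convex quadratic with equal values at m = 0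
and m = k, the latter being s_i μ. In between it is no larger. -/
theorem posSq_add_smul_le {i : b.support} {μ : coweightLattice Φ} {k m : ℤ}
    (h : pair Φ i μ = -k) (hm : 0 ≤ m) (hmk : m ≤ k) :
    posSq b (μ + m • corootP Φ i) ≤ posSq b μ := by
  classical
  set S := (Set.toFinite {k | b.IsPos k}).toFinset
  have hexp : ∀ m : ℤ, posSq b (μ + m • corootP Φ i) = posSq b μ +
      m * (2 * ∑ j ∈ S, pair Φ j μ * pair Φ j (corootP Φ i)) +
      m ^ 2 * ∑ j ∈ S, pair Φ j (corootP Φ i) ^ 2 := by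
    intro m
    rw [posSq, posSq, Finset.mul_sum, Finset.mul_sum, Finset.mul_sum, ← Finset.sum_add_distrib,
      ← Finset.sum_add_distrib]
    refine Finset.sum_congr rfl fun j _ => ?_
    rw [map_add, map_zsmul, smul_eq_mul]
    ring
  have hc : 0 ≤ ∑ j ∈ S, pair Φ j (corootP Φ i) ^ 2 := Finset.sum_nonneg fun _ _ => sq_nonneg _
  have hk := posSq_finSimple i μ
  rw [weylAct_finSimple, h, sub_eq_add_neg, ← neg_smul, neg_neg, hexp] at hk
  rw [hexp]
  generalize 2 * ∑ j ∈ S, pair Φ j μ * pair Φ j (corootP Φ i) = B at hk ⊢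
  generalize ∑ j ∈ S, pair Φ j (corootP Φ i) ^ 2 = C at hc hk ⊢
  rcases (hm.trans hmk).eq_or_lt with h0 | h0
  · have : m = 0 := by omega
    simp [this]
  · have h1 : k * (B + k * C) = 0 := by linear_combination hk
    have h2 : B + k * C = 0 := (mul_eq_zero.1 h1).resolve_left h0.ne'
    have h3 : m * B + m ^ 2 * C = m * (m - k) * C := by linear_combination m * h2
    have h4 : m * (m - k) * C ≤ 0 :=
      mul_nonpos_of_nonpos_of_nonneg (mul_nonpos_of_nonneg_of_nonpos hm (by omega)) hc
    linarith

/-- It makes `posSq` - `posSum` a natural number, the descent measure for `Tr_x_mul_eq_zero`. -/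
theorem posSum_le_posSq (μ : coweightLattice Φ) : posSum b μ ≤ posSq b μ :=
  Finset.sum_le_sum fun _ _ => Int.le_self_sq _

variable {q : Option b.support → ℝ}

variable (b) in
/-- The nonnegative integral combinations of the simple coroots. -/
def corootCone : Submodule ℕ (coweightLattice Φ) :=
  Submodule.span ℕ (Set.range fun j : b.support => corootP Φ j)

variable (b q) in
/-- The span of the `T_w` with `w ∈ W₀`. -/
def finHecke : Submodule ℂ (Hecke b q) :=
  Submodule.span ℂ (Set.range fun w => T b q (finWeyl Φ w))

theorem Ts_mul_mem_finHecke {y : Hecke b q} (hy : y ∈ finHecke b q) (i : b.support) :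
    Ts b q i * y ∈ finHecke b q := by
  induction hy using Submodule.span_induction with
  | mem _ h =>
    obtain ⟨v, rfl⟩ := h
    by_cases hp : b.IsPos (v⁻¹ • (i : ι))
    · rw [Ts_mul_T_pos hp]
      exact Submodule.subset_span ⟨_, rfl⟩
    · rw [Ts_mul_T_neg hp]
      exact Submodule.add_mem _ (Submodule.subset_span ⟨_, rfl⟩)
        (Submodule.smul_mem _ _ (Submodule.subset_span ⟨_, rfl⟩))
  | zero => rw [mul_zero]; exact Submodule.zero_mem _
  | add y z _ _ hy hz => rw [mul_add]; exact Submodule.add_mem _ hy hz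
  | smul c y _ hy => rw [mul_smul_comm]; exact Submodule.smul_mem _ c hy

theorem mul_Ts_mem_finHecke {y : Hecke b q} (hy : y ∈ finHecke b q) (i : b.support) :
    y * Ts b q i ∈ finHecke b q := by
  induction hy using Submodule.span_induction with
  | mem _ h =>
    obtain ⟨v, rfl⟩ := h
    dsimp only
    rw [Ts_eq]
    by_cases hp : AffPos b (act Φ (finWeyl Φ v) (simpleRoot b (some i)))
    · rw [T_mul_simple_pos hp, simpleReflection_some, ← map_mul]
      exact Submodule.subset_span ⟨_, rfl⟩
    · rw [T_mul_simple_neg hp, simpleReflection_some, ← map_mul]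
      exact Submodule.add_mem _ (Submodule.subset_span ⟨_, rfl⟩)
        (Submodule.smul_mem _ _ (Submodule.subset_span ⟨_, rfl⟩))
  | zero => rw [zero_mul]; exact Submodule.zero_mem _
  | add y z _ _ hy hz => rw [add_mul]; exact Submodule.add_mem _ hy hz
  | smul c y _ hy => rw [smul_mul_assoc]; exact Submodule.smul_mem _ c hy

/-- For dominant μ the trace of T_{t_μ} T_w is nonzero only if μ = 0, which the hypothesis excludes.
Otherwise let ⟨μ, α_i⟩ = -k < 0. The Bernstein relation expresses x^μ as T_i x^{s_iμ} T_i⁻¹ minus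
κ_i times the sum of x^{s_iμ - jα_i^∨} T_i⁻¹ over j < k, and the trace property moves the leading
T_i to the right, into the finite part. All new exponents are μ + mα_i^∨ with 0 < m ≤ k. There
`posSq` has not grown while `posSum` has increased, and the negative is still outside the cone,
since otherwise adding mα_i^∨ would put -μ in it. -/
theorem Tr_x_mul_eq_zero (hq : IsReducedParameterSystem b q) {μ : coweightLattice Φ}
    (hμ : -μ ∉ corootCone b) {h : Hecke b q} (hh : h ∈ finHecke b q) :
    Tr b q (x b q μ * h) = 0 := by
  classical
  induction hn : (posSq b μ - posSum b μ).toNat using Nat.strong_induction_on generalizing μ h with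
  | _ n ih =>
  by_cases hd : IsDominant b μ
  · induction hh using Submodule.span_induction with
    | mem _ hh =>
      obtain ⟨w, rfl⟩ := hh
      dsimp only
      rw [x_of_isDominant hd, Tr_T_mul_T hq, if_neg]
      intro h1
      rw [← mkAff_eq] at h1
      have h2 : μ = 0 := congrArg (transPart Φ) h1
      rw [h2, neg_zero] at hμ
      exact hμ (Submodule.zero_mem _)
    | zero => rw [mul_zero, map_zero]
    | add y z _ _ hy hz => rw [mul_add, map_add, hy, hz, add_zero]
    | smul c y _ hy => rw [mul_smul_comm, map_smul, hy, smul_zero]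
  · obtain ⟨i, hi⟩ : ∃ i : b.support, pair Φ i μ < 0 := by
      by_contra! h0
      exact hd ((isDominant_iff b).2 h0)
    obtain ⟨k, hk⟩ : ∃ k : ℕ, pair Φ i μ = -k := ⟨(pair Φ i μ).natAbs, by omega⟩
    have hk0 : 0 < k := by omega
    have step : ∀ j < k, ∀ y ∈ finHecke b q,
        Tr b q (x b q (weylAct Φ (finSimple b i) μ - j • corootP Φ i) * y) = 0 := by
      intro j hj y hy
      have e : weylAct Φ (finSimple b i) μ - j • corootP Φ i =
          μ + ((k - j : ℕ) : ℤ) • corootP Φ i := by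
        rw [weylAct_finSimple, hk, Nat.cast_sub hj.le, sub_smul, neg_smul, natCast_zsmul,
          natCast_zsmul]
        abel
      rw [e]
      refine ih _ ?_ (fun h1 => hμ ?_) hy rfl
      · have h1 := posSq_add_smul_le hk (m := ((k - j : ℕ) : ℤ)) (by omega) (by omega)
        have h2 : posSum b (μ + ((k - j : ℕ) : ℤ) • corootP Φ i) =
            posSum b μ + ((k - j : ℕ) : ℤ) * 2 := by
          have h3 : posSum b (((k - j : ℕ) : ℤ) • corootP Φ i) =
              ((k - j : ℕ) : ℤ) • posSum b (corootP Φ i) := map_zsmul (posSumHom b) _ _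
          rw [posSum_add, h3, posSum_corootP, smul_eq_mul]
        have h3 := posSum_le_posSq (b := b) (μ + ((k - j : ℕ) : ℤ) • corootP Φ i)
        omega
      · have h2 : -μ = -(μ + ((k - j : ℕ) : ℤ) • corootP Φ i) + (k - j) • corootP Φ i := by
          rw [natCast_zsmul]; abel
        rw [h2]
        exact Submodule.add_mem _ h1
          (Submodule.smul_mem _ _ (Submodule.subset_span ⟨i, rfl⟩))
    have hT := Ts_mul_x_nat (q := q) i k (weylAct Φ (finSimple b i) μ)
      (by rw [pair_finSimple, hk, neg_neg])
    rw [← weylAct_mul, finSimple_mul_self, weylAct_one] at hT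
    set Ti := Ts b q i - algebraMap ℂ _ (kappa b q (some i)) with hTi
    have h1 : Ts b q i * Ti = 1 := by rw [hTi, Ts_eq]; exact T_simple_mul_inv _
    have hTih : Ti * h ∈ finHecke b q := by
      rw [hTi, sub_mul, ← Algebra.smul_def]
      exact Submodule.sub_mem _ (Ts_mul_mem_finHecke hh i) (Submodule.smul_mem _ _ hh)
    have e : x b q μ * h = Ts b q i * (x b q (weylAct Φ (finSimple b i) μ) * (Ti * h)) -
        kappa b q (some i) • ∑ j ∈ Finset.range k,
          x b q (weylAct Φ (finSimple b i) μ - j • corootP Φ i) * (Ti * h) := by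
      rw [← mul_assoc (Ts b q i), hT, add_mul, smul_mul_assoc, Finset.sum_mul, add_sub_cancel_right,
        mul_assoc, ← mul_assoc (Ts b q i), h1, one_mul]
    rw [e, map_sub, map_smul, map_sum, Tr_mul_comm hq, mul_assoc,
      Finset.sum_eq_zero fun j hj => step j (Finset.mem_range.1 hj) _ hTih, smul_zero, sub_zero]
    have := step 0 hk0 _ (mul_Ts_mem_finHecke hTih i)
    rwa [zero_smul, sub_zero] at this

end Support

/-! ### Absolute convergence of F_t and nonvanishing of F_t(1). -/

section Convergence

theorem summable_pow_sum (α : Type*) [Finite α] {r : ℝ} (h0 : 0 ≤ r) (h1 : r < 1) :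
    ∀ [Fintype α], Summable fun n : α → ℕ => r ^ ∑ j, n j := by
  induction α using Finite.induction_empty_option with
  | of_equiv e ih =>
    intro _
    have := Fintype.ofEquiv _ e.symm
    refine (Equiv.summable_iff (Equiv.arrowCongr e (Equiv.refl ℕ))).1 ?_
    convert ih using 2 with n
    simp [Function.comp_def, ← Equiv.sum_comp e]
  | h_empty => intro _; exact Summable.of_finite
  | h_option ih =>
    intro inst
    obtain rfl : inst = instFintypeOption := Subsingleton.elim _ _
    refine (Equiv.summable_iff Equiv.piOptionEquivProd.symm).1 ?_
    have h := (summable_geometric_of_lt_one h0 h1).mul_of_nonneg (ih)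
      (fun n => pow_nonneg h0 n) (fun n => pow_nonneg h0 _)
    convert h using 2 with n
    simp [Fintype.sum_option, pow_add]

variable [Finite ι] [Nonempty ι] {Φ : RootPairing ι ℝ M N} {b : Φ.Base} [Φ.IsCrystallographic]
  [Φ.IsReduced] [Φ.IsIrreducible] {q : Option b.support → ℝ}

theorem exists_eq_sum_of_mem_corootCone {μ : coweightLattice Φ} (h : μ ∈ corootCone b) :
    ∃ n : b.support → ℕ, ∑ j, n j • corootP Φ j = μ :=
  (Submodule.mem_span_range_iff_exists_fun ℕ).1 h

theorem sum_corootP_injective :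
    Function.Injective fun n : b.support → ℕ => -∑ j, n j • corootP Φ j := by
  intro n m h
  have h1 := congrArg (fun μ : coweightLattice Φ => (μ : N)) (neg_injective h)
  have h2 : LinearIndependent ℝ fun j : b.support => Φ.coroot j := b.linearIndepOn_coroot
  have h3 : ∀ n : b.support → ℕ, ((∑ j, n j • corootP Φ j : coweightLattice Φ) : N) =
      ∑ j, (n j : ℝ) • Φ.coroot j := by
    intro n
    simp only [AddSubgroup.val_finsetSum, AddSubgroup.coe_nsmul, Nat.cast_smul_eq_nsmul]
    rfl
  simp only [h3] at h1
  funext j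
  have := Fintype.linearIndependent_iff.1 h2 (fun j => (n j : ℝ) - m j)
    (by simp only [sub_smul, Finset.sum_sub_distrib, h1, sub_self]) j
  exact_mod_cast sub_eq_zero.1 this

theorem heckeNorm_nonneg (hq : IsReducedParameterSystem b q) (h : Hecke b q) :
    0 ≤ heckeNorm hq h := sumNorm_nonneg _

theorem exists_heckeNorm_x_mul_le (hq : IsReducedParameterSystem b q) :
    ∃ R : ℝ, 1 ≤ R ∧ ∀ (n : b.support → ℕ) (h : Hecke b q),
      heckeNorm hq (x b q (-∑ j, n j • corootP Φ j) * h) ≤ R ^ (∑ j, n j) * heckeNorm hq h := by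
  classical
  choose C hC0 hC using fun j : b.support =>
    exists_heckeNorm_mul_le hq (x b q (-corootP Φ j))
  -- One constant, at least 1, bounds left multiplication by every x^{-α_j^∨}.
  have hR : ∀ j, C j ≤ 1 + ∑ j, C j := fun j =>
    (Finset.single_le_sum (fun i _ => hC0 i) (Finset.mem_univ j)).trans (by linarith)
  have hR1 : 1 ≤ 1 + ∑ j, C j := by
    have := Finset.sum_nonneg fun (j : b.support) (_ : j ∈ Finset.univ) => hC0 j
    linarith
  set R := 1 + ∑ j, C j
  refine ⟨R, hR1, fun n => ?_⟩
  have h1 : ∀ (j : b.support) (m : ℕ) (h : Hecke b q),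
      heckeNorm hq (x b q (-(m • corootP Φ j)) * h) ≤ R ^ m * heckeNorm hq h := by
    intro j m
    induction m with
    | zero => intro h; rw [zero_smul, neg_zero, x_zero, one_mul, pow_zero, one_mul]
    | succ m ih =>
      intro h
      rw [add_smul, one_smul, neg_add, x_add, mul_assoc]
      calc _ ≤ R ^ m * heckeNorm hq (x b q (-corootP Φ j) * h) := ih _
        _ ≤ R ^ m * (R * heckeNorm hq h) := by
          refine mul_le_mul_of_nonneg_left ((hC j h).trans ?_) (by positivity)
          exact mul_le_mul_of_nonneg_right (hR j) (heckeNorm_nonneg hq h)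
        _ = _ := by ring
  generalize (Finset.univ : Finset b.support) = s
  induction s using Finset.induction_on with
  | empty => intro h; simp [x_zero]
  | insert j s hj ih =>
    intro h
    rw [Finset.sum_insert hj, Finset.sum_insert hj, neg_add, x_add, mul_assoc]
    calc _ ≤ R ^ n j * heckeNorm hq (x b q (-∑ j ∈ s, n j • corootP Φ j) * h) := h1 _ _ _
      _ ≤ R ^ n j * (R ^ (∑ j ∈ s, n j) * heckeNorm hq h) :=
        mul_le_mul_of_nonneg_left (ih h) (by positivity)
      _ = _ := by rw [pow_add]; ring

variable (b q) in
/-- The terms of the series `F_t(h)`. -/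
def FTerm (t : Torus Φ) (h : Hecke b q) (μ : coweightLattice Φ) : ℂ :=
  t.pow (-μ) * Tr b q (x b q μ * h)

/-- The trace property turns right multiplication by x^ν into left multiplication, where it shifts
the summation index. -/
theorem FTerm_mul_x (hq : IsReducedParameterSystem b q) (t : Torus Φ) (h : Hecke b q)
    (ν μ : coweightLattice Φ) :
    FTerm b q t (h * x b q ν) μ = t.pow ν * FTerm b q t h (μ + ν) := by
  have h1 : t.pow (-μ) = t.pow ν * t.pow (-(μ + ν)) := by rw [← t.pow_add]; congr 1; abel
  rw [FTerm, FTerm, ← mul_assoc, Tr_mul_comm hq, ← mul_assoc, ← x_add, h1, add_comm ν, mul_assoc]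

theorem FTerm_x_mul (t : Torus Φ) (h : Hecke b q) (ν μ : coweightLattice Φ) :
    FTerm b q t (x b q ν * h) μ = t.pow ν * FTerm b q t h (μ + ν) := by
  have h1 : t.pow (-μ) = t.pow ν * t.pow (-(μ + ν)) := by rw [← t.pow_add]; congr 1; abel
  rw [FTerm, FTerm, ← mul_assoc, ← x_add, h1, mul_assoc]

theorem FTerm_eq_zero (hq : IsReducedParameterSystem b q) (t : Torus Φ) {h : Hecke b q}
    (hh : h ∈ finHecke b q) {μ : coweightLattice Φ}
    (hμ : μ ∉ Set.range fun n : b.support → ℕ => -∑ j, n j • corootP Φ j) :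
    FTerm b q t h μ = 0 := by
  rw [FTerm, Tr_x_mul_eq_zero hq (fun h1 => hμ ?_) hh, mul_zero]
  obtain ⟨n, hn⟩ := exists_eq_sum_of_mem_corootCone h1
  exact ⟨n, by dsimp only; rw [hn, neg_neg]⟩

/-- On the span of the T_w with w ∈ W₀ the series runs over exponents -∑ n_j α_j^∨ only and is
dominated by a geometric series in several variables. The remaining elements T_w x^ν only shift the
index, so summability extends to all of ℋ by linearity. -/
theorem exists_region (hq : IsReducedParameterSystem b q) :
    ∃ r : ℝ, 0 < r ∧ r ≤ 1 ∧ ∀ t : Torus Φ,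
      (∀ i ∈ b.support, ‖t.pow (corootP Φ i)‖ < r) →
        (∀ h, Summable (FTerm b q t h)) ∧ F b q t 1 ≠ 0 := by
  classical
  obtain ⟨R, hR1, hR⟩ := exists_heckeNorm_x_mul_le hq
  have hR0 : 0 < R := by linarith
  have hS := summable_pow_sum b.support (r := 1 / 2) (by norm_num) (by norm_num)
  set S : ℝ := ∑' n : b.support → ℕ, (1 / 2 : ℝ) ^ ∑ j, n j with hSdef
  have hS1 : 1 ≤ S := by
    have := hS.le_tsum 0 (fun n _ => by positivity)
    simpa only [Pi.zero_apply, Finset.sum_const_zero, pow_zero] using this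
  -- Dividing the radius by R absorbs the exponential growth, so the n-th term is at most
  -- ‖h‖ρ^{|n|}. The choice ρ = 1/(4S) makes the nonconstant terms of F_t(1) add up to at most 2ρS =
  -- 1/2.
  have hρ0 : 0 < 1 / (4 * S) := by positivity
  set ρ : ℝ := 1 / (4 * S) with hρ
  have hρS : ρ * S = 1 / 4 := by rw [hρ]; field_simp
  have hρ2 : ρ ≤ 1 / 2 := by nlinarith
  refine ⟨ρ / R, by positivity, ?_, fun t ht => ?_⟩
  · rw [div_le_one hR0]; linarith
  have hbound : ∀ (h : Hecke b q) (n : b.support → ℕ),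
      ‖FTerm b q t h (-∑ j, n j • corootP Φ j)‖ ≤ heckeNorm hq h * ρ ^ ∑ j, n j := by
    intro h n
    have h1 : ‖t.pow (∑ j, n j • corootP Φ j)‖ ≤ (ρ / R) ^ ∑ j, n j := by
      rw [t.norm_pow_sum, ← Finset.prod_pow_eq_pow_sum]
      exact Finset.prod_le_prod (fun _ _ => by positivity) fun j _ =>
        pow_le_pow_left₀ (norm_nonneg _) (ht j j.2).le _
    have h2 := (norm_Tr_le hq _).trans (hR n h)
    rw [FTerm, neg_neg, norm_mul]
    calc _ ≤ (ρ / R) ^ (∑ j, n j) * (R ^ (∑ j, n j) * heckeNorm hq h) :=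
          mul_le_mul h1 h2 (norm_nonneg _) (by positivity)
      _ = heckeNorm hq h * ρ ^ ∑ j, n j := by
        rw [div_pow]; field_simp
  have hfin : ∀ h ∈ finHecke b q, Summable (FTerm b q t h) := by
    intro h hh
    refine (sum_corootP_injective.summable_iff fun μ hμ => FTerm_eq_zero hq t hh hμ).1 ?_
    exact Summable.of_norm_bounded ((summable_pow_sum b.support hρ0.le (by linarith)).mul_left _)
      (hbound h)
  refine ⟨fun h => ?_, ?_⟩
  · induction h using bernstein_induction with
    | hm w f =>
      induction f using laurent_induction with
      | hm ν =>
        rw [X_mono]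
        have h1 := hfin _ (Submodule.subset_span ⟨w, rfl⟩)
        have h2 := ((Equiv.addRight ν).summable_iff.2 h1).mul_left (t.pow ν)
        exact h2.congr fun μ => (FTerm_mul_x hq t _ ν μ).symm
      | ha f g hf hg =>
        refine (hf.add hg).congr fun μ => ?_
        rw [FTerm, FTerm, FTerm, map_add, mul_add, mul_add, map_add, mul_add]
      | hs c f hf =>
        refine (hf.mul_left c).congr fun μ => ?_
        rw [FTerm, FTerm, map_smul, mul_smul_comm, mul_smul_comm, map_smul, smul_eq_mul]
        ring
    | ha y z hy hz =>
      refine (hy.add hz).congr fun μ => ?_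
      rw [FTerm, FTerm, FTerm, mul_add, map_add, mul_add]
    | hs c y hy =>
      refine (hy.mul_left c).congr fun μ => ?_
      rw [FTerm, FTerm, mul_smul_comm, map_smul, smul_eq_mul]
      ring
  · have h1mem : (1 : Hecke b q) ∈ finHecke b q :=
      Submodule.subset_span ⟨1, by dsimp only; rw [map_one, T_one]⟩
    have hn1 : heckeNorm hq (1 : Hecke b q) = 1 := by
      rw [heckeNorm, ← T_one, heckeCoeff_T, sumNorm_single, norm_one]
    have e : F b q t 1 = ∑' n : b.support → ℕ, FTerm b q t 1 (-∑ j, n j • corootP Φ j) := by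
      refine (sum_corootP_injective.tsum_eq (f := FTerm b q t 1) fun μ hμ => ?_).symm
      by_contra h0
      exact hμ (FTerm_eq_zero hq t h1mem h0)
    have hsum : Summable fun n : b.support → ℕ => FTerm b q t 1 (-∑ j, n j • corootP Φ j) :=
      (sum_corootP_injective (b := b)).summable_iff
      (fun μ hμ => FTerm_eq_zero hq t h1mem hμ) |>.2 (hfin 1 h1mem)
    have h0 : FTerm b q t 1 (-∑ j, (0 : b.support → ℕ) j • corootP Φ j) = 1 := by
      have := Tr_T hq (1 : ExtAffineWeyl Φ)
      rw [T_one, if_pos rfl] at this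
      simp [FTerm, x_zero, this]
    have hle : ‖F b q t 1 - 1‖ ≤ 2 * ρ * S := by
      rw [e, hsum.tsum_eq_add_tsum_ite 0, h0, add_sub_cancel_left, hSdef, ← tsum_mul_left]
      refine tsum_of_norm_bounded (hS.mul_left (2 * ρ)).hasSum fun n => ?_
      split_ifs with hn
      · rw [norm_zero]; positivity
      · refine (hbound 1 n).trans ?_
        rw [hn1, one_mul]
        obtain ⟨m, hm⟩ : ∃ m, ∑ j, n j = m + 1 := by
          refine Nat.exists_eq_succ_of_ne_zero fun h => hn (funext fun j => ?_)
          exact (Finset.sum_eq_zero_iff.1 h) j (Finset.mem_univ j)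
        rw [hm, pow_succ, pow_succ]
        -- For |n| = m + 1 this gives ρ^{m+1} ≤ ρ(1/2)^m = 2ρ(1/2)^{|n|}.
        have := pow_le_pow_left₀ hρ0.le hρ2 m
        nlinarith
    intro hF
    rw [hF, zero_sub, norm_neg, norm_one] at hle
    nlinarith

end Convergence

/-! ### Existence and uniqueness of the densities; the character formula at regular points. -/

section CharacterFormula

variable [Finite ι] [Nonempty ι] {Φ : RootPairing ι ℝ M N} {b : Φ.Base} [Φ.IsCrystallographic]
  [Φ.IsReduced] [Φ.IsIrreducible] {q : Option b.support → ℝ}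

/-- `F_t` as a linear functional, where it converges. -/
def FLinear {t : Torus Φ} (ht : ∀ h, Summable (FTerm b q t h)) : Hecke b q →ₗ[ℂ] ℂ where
  toFun := F b q t
  map_add' y z := by
    refine Eq.trans (tsum_congr fun μ => ?_) ((ht y).tsum_add (ht z))
    change _ = t.pow (-μ) * Tr b q (x b q μ * y) + t.pow (-μ) * Tr b q (x b q μ * z)
    rw [mul_add, map_add, mul_add]
  map_smul' c y := by
    refine Eq.trans (tsum_congr fun μ => ?_) ((ht y).tsum_mul_left c)
    change _ = c * (t.pow (-μ) * Tr b q (x b q μ * y))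
    rw [mul_smul_comm, map_smul, smul_eq_mul]
    ring

theorem isLeftWeight_FLinear {t : Torus Φ} (ht : ∀ h, Summable (FTerm b q t h)) :
    IsLeftWeight t (FLinear ht) := fun ν h => by
  refine Eq.trans (tsum_congr (FTerm_x_mul t h ν)) ?_
  rw [tsum_mul_left]
  exact congrArg _ ((Equiv.addRight ν).tsum_eq (FTerm b q t h))

theorem isRightWeight_FLinear (hq : IsReducedParameterSystem b q) {t : Torus Φ}
    (ht : ∀ h, Summable (FTerm b q t h)) : IsRightWeight t (FLinear ht) := fun ν h => by
  refine Eq.trans (tsum_congr (FTerm_mul_x hq t h ν)) ?_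
  rw [tsum_mul_left]
  exact congrArg _ ((Equiv.addRight ν).tsum_eq (FTerm b q t h))

/-- Both F_t and F_t(1)φ have left and right weight t and agree at 1. In the region t is regular
with trivial stabiliser, so they coincide. -/
theorem F_eq_mul (hq : IsReducedParameterSystem b q) {r : ℝ} (hr : r ≤ 1) {t : Torus Φ}
    (ht : ∀ i ∈ b.support, ‖t.pow (corootP Φ i)‖ < r) (hs : ∀ h, Summable (FTerm b q t h))
    {φ : Hecke b q →ₗ[ℂ] ℂ} (hφ : IsLeftWeight t φ ∧ IsRightWeight t φ ∧ φ 1 = 1)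
    (h : Hecke b q) : F b q t h = φ h * F b q t 1 := by
  obtain ⟨hl, hr', h1⟩ := hφ
  have key : FLinear hs = F b q t 1 • φ := by
    refine (isLeftWeight_FLinear hs).ext hq (isRegular_of_norm_lt hr ht)
      (fun w hw => weyl_ne_of_norm_lt hr ht hw) (isRightWeight_FLinear hq hs) (fun ν y => ?_)
      (fun ν y => ?_) ?_
    · rw [LinearMap.smul_apply, LinearMap.smul_apply, hl, smul_eq_mul, smul_eq_mul, mul_left_comm]
    · rw [LinearMap.smul_apply, LinearMap.smul_apply, hr', smul_eq_mul, smul_eq_mul, mul_left_comm]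
    · rw [LinearMap.smul_apply, h1, smul_eq_mul, mul_one]
      rfl
  have := congrArg (fun g => g h) key
  exact this.trans (mul_comm _ _)

theorem isDensity_of_biweight (hq : IsReducedParameterSystem b q)
    {f : Torus Φ → Hecke b q →ₗ[ℂ] ℂ}
    (hf : ∀ t : Torus Φ, t.IsRegular → IsLeftWeight t (f t) ∧ IsRightWeight t (f t) ∧ f t 1 = 1)
    (hd : ∀ h, ∃ p : LaurentAlg Φ, ∀ t : Torus Φ, t.IsRegular → d b t * f t h = t.ev p) :
    IsDensity b q fun t h => f t h where
  eq_on_region := by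
    obtain ⟨r, hr0, hr1, hr⟩ := exists_region hq
    refine ⟨r, hr0, fun t ht => ⟨(hr t ht).2, fun h => ⟨(hr t ht).1 h, ?_⟩⟩⟩
    exact F_eq_mul hq hr1 ht (hr t ht).1 (hf t (isRegular_of_norm_lt hr1 ht)) h
  continuation h := by
    obtain ⟨p, hp⟩ := hd h
    exact ⟨p.coeff, fun t ht => by rw [hp t ht, Torus.ev_eq_eval]⟩

/-- The densities are unique at regular points. -/
theorem IsDensity.eq_of_isRegular {f g : Torus Φ → Hecke b q → ℂ} (hf : IsDensity b q f)
    (hg : IsDensity b q g) {t : Torus Φ} (ht : t.IsRegular) (h : Hecke b q) : f t h = g t h := by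
  obtain ⟨r, hr0, hr⟩ := hf.eq_on_region
  obtain ⟨s, hs0, hs⟩ := hg.eq_on_region
  obtain ⟨p, hp⟩ := hf.continuation h
  obtain ⟨p', hp'⟩ := hg.continuation h
  -- Where both regions overlap, F_t(1) ≠ 0 makes f and g equal; the numerators then agree on a
  -- Zariski dense set.
  have key : AddMonoidAlgebra.ofCoeff p = (AddMonoidAlgebra.ofCoeff p' : LaurentAlg Φ) := by
    refine laurent_ext b (lt_min (lt_min hr0 hs0) one_pos) fun t ht => ?_
    have ht' := isRegular_of_norm_lt (min_le_right _ _) ht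
    obtain ⟨h0, h1⟩ := hr t fun i hi =>
      (ht i hi).trans_le ((min_le_left _ _).trans (min_le_left _ _))
    obtain ⟨-, h2⟩ := hs t fun i hi =>
      (ht i hi).trans_le ((min_le_left _ _).trans (min_le_right _ _))
    have h3 : f t h = g t h := mul_right_cancel₀ h0 ((h1 h).2.symm.trans (h2 h).2)
    rw [Torus.ev_eq_eval, Torus.ev_eq_eval]
    exact (hp t ht').symm.trans ((congrArg _ h3).trans (hp' t ht'))
  have hpp : p = p' := congrArg AddMonoidAlgebra.coeff key
  exact mul_left_cancel₀ (ht.d_ne_zero (b := b)) ((hp t ht).trans (hpp ▸ (hp' t ht).symm))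

/-- The character formula at regular points. -/
theorem χ_eq_sum [Fintype (weylGroup Φ)] (hq : IsReducedParameterSystem b q)
    {f : Torus Φ → Hecke b q →ₗ[ℂ] ℂ}
    (hf : ∀ t : Torus Φ, t.IsRegular → IsLeftWeight t (f t) ∧ IsRightWeight t (f t) ∧ f t 1 = 1)
    (hd : ∀ h, ∃ p : LaurentAlg Φ, ∀ t : Torus Φ, t.IsRegular → d b t * f t h = t.ev p)
    {t : Torus Φ} (ht : t.IsRegular) (h : Hecke b q) :
    ∑ w : weylGroup Φ, f (t.weyl w) h = χ b q t h := by
  classical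
  obtain ⟨p, hp⟩ := hd h
  obtain ⟨c, hc⟩ := exists_ev_eq_χ hq h
  -- Multiplying by all the d(wt) turns the formula into an identity of Laurent polynomials. It is
  -- verified on the dense region, and at a regular t the factors d(wt) are nonzero and can be
  -- cancelled.
  choose D hD using fun w : weylGroup Φ => exists_ev_weyl w (dLaurent b)
  choose P hP using fun w : weylGroup Φ => exists_ev_weyl w p
  have hsum : ∀ t : Torus Φ, t.IsRegular →
      t.ev (∏ w, D w) * ∑ w : weylGroup Φ, f (t.weyl w) h =
        t.ev (∑ w, (∏ v ∈ Finset.univ.erase w, D v) * P w) := by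
    intro t ht
    rw [Finset.mul_sum, map_sum]
    refine Finset.sum_congr rfl fun w _ => ?_
    have h1 := hp _ (ht.weyl w)
    rw [d_eq_ev, hD, hP] at h1
    rw [← Finset.mul_prod_erase _ _ (Finset.mem_univ w), map_mul, map_mul, ← h1]
    ring
  have key : ∑ w, (∏ v ∈ Finset.univ.erase w, D v) * P w = (∏ w, D w) * c := by
    refine laurent_ext b one_pos fun t ht => ?_
    have ht' := isRegular_of_norm_lt le_rfl ht
    rw [← hsum t ht', map_mul, ← hc, χ_eq_sum_of_generic hq hf ht'
      (fun w hw => weyl_ne_of_norm_lt le_rfl ht hw)]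
  have h1 := hsum t ht
  rw [key, map_mul, ← hc] at h1
  refine mul_left_cancel₀ ?_ h1
  rw [map_prod, Finset.prod_ne_zero_iff]
  intro w _
  rw [← hD, ← d_eq_ev]
  exact (ht.weyl w).d_ne_zero

end CharacterFormula

end AffineHecke

end

/-! ### The theorem. -/

open AffineHecke in
theorem theorem6p10 {ι M N : Type*} [AddCommGroup M] [Module ℝ M] [AddCommGroup N] [Module ℝ N]
    [Finite ι] [Nonempty ι] (Φ : RootPairing ι ℝ M N)
    [Φ.IsCrystallographic] [Φ.IsReduced] [Φ.IsIrreducible] (b : Φ.Base)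
    (q : Option b.support → ℝ) (hq : IsReducedParameterSystem b q) :
    (Tr b q (T b q 1) = 1 ∧ ∀ w ≠ 1, Tr b q (T b q w) = 0) ∧
    (∀ t : Torus Φ, FiniteDimensional ℂ (PrincipalSeries b q t)) ∧
    (∃ f, IsDensity b q f) ∧
    ∀ f, IsDensity b q f → ∀ t : Torus Φ, t.IsRegular →
      ∀ h, ∑ᶠ w : weylGroup Φ, f (t.weyl w) h = χ b q t h := by
  have := Fintype.ofFinite (weylGroup Φ)
  obtain ⟨f, hf, hd⟩ := exists_biweight hq
  refine ⟨⟨?_, fun w hw => ?_⟩, finiteDimensional_principalSeries hq,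
    ⟨_, isDensity_of_biweight hq hf hd⟩, fun g hg t ht h => ?_⟩
  · rw [Tr_T hq, if_pos rfl]
  · rw [Tr_T hq, if_neg hw]
  · rw [finsum_eq_sum_of_fintype, ← χ_eq_sum hq hf hd ht h]
    exact Finset.sum_congr rfl fun w _ =>
      hg.eq_of_isRegular (isDensity_of_biweight hq hf hd) (ht.weyl w) h
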